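/- Let $\mathbf{D}$ be a small category with at most one morphism between any two objects. Let $\mathcal{M}$ be a diagram of model categories on $\mathbf{D}$: each object $s$ is assigned a model category $\mathcal{M}(s)$ (with all small limits and colimits and functorial factorizations), and each $a:s\to t$ is assigned a left Quillen functor $a_*:\mathcal{M}(s)\to\mathcal{M}(t)$, with right adjoint $a^*$, compatibly with identities and composition (up to coherent isomorphism). An $\mathcal{M}$-diagram $X$ consists of objects $X(s)\in\mathcal{M}(s)$ and maps $a_*X(s)\to X(t)$ for all $a:s\to t$, compatible with identities and composition. Recall that $\mathbf{D}$ is *direct* if there is a functor from $\mathbf{D}$ to the ordinals taking non-identity maps to non-identity maps, and *inverse* if $\mathbf{D}^{\mathrm{op}}$ is direct. For a model category, *cofibrantly generated* by sets $I$, $J$ of maps means that the domains of $I$ (resp. $J$) are small relative to the relative $I$-cell (resp. $J$-cell) complexes, that the trivial fibrations are the maps with the right lifting property against $I$, and that the fibrations are the maps with the right lifting property against $J$. It is *cellular* if it is cofibrantly generated by some $I$, $J$ such that the domains and codomains of $I$ are compact relative to $I$, the domains of $J$ are small relative to the relative $I$-cell complexes, and all cofibrations are effective monomorphisms. Here $W$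 is compact relative to $I$ if there is a cardinal $\gamma$ such that every map from $W$ to the target of a presented relative $I$-cell complex factors through a subcomplex with at most $\gamma$ cells. For $A\in\mathcal{M}(s)$ let $\mathcal{F}^s_A$ be the free $\mathcal{M}$-diagram with $\mathcal{F}^s_A(t)=a_*A$ if $\mathbf{D}(s,t)=\{a\}$, and $\mathcal{F}^s_A(t)$ initial if $\mathbf{D}(s,t)=\emptyset$. For $\mathbf{D}$ inverse let $\partial\mathcal{F}^s_A(t)=a_*A$ if $\mathbf{D}(s,t)=\{a\}$ and $t\neq s$, and let it be initial otherwise. Suppose that each $\mathcal{M}(s)$ is proper and cellular. (i) If $\mathbf{D}$ is direct, then the diagram-projective model structure on $\mathcal{M}$-diagrams (weak equivalences and fibrations defined objectwise) exists, and it is proper and cellular. If each $\mathcal{M}(s)$ is cofibrantly generated by sets $I_s$, $J_s$, then the diagram-projective model structure is cofibrantly generated by the set of maps $\mathcal{F}^s_A\to\mathcal{F}^s_B$ for all $s$ and all $f:A\to B$ in $I_s$, and the corresponding set for all $f$ in $J_s$. (ii) If $\mathbf{D}$ is inverse, then the diagram-injective model structure on $\mathcal{M}$-diagrams (weak equivalences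 and cofibrations defined objectwise) exists, and it is proper and cellular. If each $\mathcal{M}(s)$ is cofibrantly generated by sets $I_s$, $J_s$, then the diagram-injective model structure is cofibrantly generated by the set of maps $\mathcal{F}^s_A\amalg_{\partial\mathcal{F}^s_A}\partial\mathcal{F}^s_B\to\mathcal{F}^s_B$ for all $s$ and all $f:A\to B$ in $I_s$, and the corresponding set for all $f$ in $J_s$. In both cases the category of $\mathcal{M}$-diagrams has all small limits and colimits, and the model structure has functorial factorizations. -/

import Mathlib

set_option linter.unusedSectionVars false

open CategoryTheory CategoryTheory.Limits CategoryTheory.Bicategory HomotopicalAlgebra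

universe v u

noncomputable section

/-! ## Model category notions, following Hirschhorn's book -/

namespace HirschhornModel

section Cells

variable {C : Type u} [Category.{v} C]

/-- The relative `I`-cell complexes: transfinite compositions of pushouts of coproducts of
elements of `I`. -/
def relCells (I : MorphismProperty C) : MorphismProperty C :=
  MorphismProperty.transfiniteCompositions.{v} (MorphismProperty.coproducts.{v} I).pushouts

/-- The object `W` is small relative to the class `P`: there is a cardinal `κ` such that for
every regular cardinal `μ ≥ κ` and every `μ`-sequence `F` whose successor maps lie in `P`,
the functor `Hom(W, -)` preserves the colimit of `F`. -/
def IsSmallRelTo (W : C) (P : MorphismProperty C) : Prop :=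
  ∃ κ : Cardinal.{v}, ∀ μ : Cardinal.{v}, μ.IsRegular → κ ≤ μ →
    ∀ F : μ.ord.ToType ⥤ C, F.IsWellOrderContinuous →
      (∀ j, P (F.map (homOfLE (Order.le_succ j)))) →
        PreservesColimit F (coyoneda.obj (Opposite.op W))

/-- A presented relative `I`-cell complex of shape `J`: at every stage `j`, a (small) set of
cells from `I` is attached, with chosen attaching maps. -/
abbrev PresentedComplex (I : MorphismProperty C) (J : Type v) [LinearOrder J] [OrderBot J]
    [SuccOrder J] [WellFoundedLT J] {X Y : C} (f : X ⟶ Y) :=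
  RelativeCellComplex.{v} (fun _ : J => I.homFamily) f

/-- The attaching map of a cell. -/
def attachingMap {I : MorphismProperty C} {X₁ X₂ : C} {f : X₁ ⟶ X₂}
    (c : AttachCells.{v} I.homFamily f) (i : c.ι) : (c.π i).1.left ⟶ X₁ :=
  c.cofan₁.inj i ≫ c.g₁

/-- The characteristic map of a cell. -/
def characteristicMap {I : MorphismProperty C} {X₁ X₂ : C} {f : X₁ ⟶ X₂}
    (c : AttachCells.{v} I.homFamily f) (i : c.ι) : (c.π i).1.right ⟶ X₂ :=
  c.cofan₂.inj i ≫ c.g₂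

/-- The presented complex `c' : X ⟶ Z` is a subcomplex of `c : X ⟶ Y`: at every stage its cells
are a subset of the cells of `c` (of the same type), and there is a map of sequences, the identity
on `X`, that carries the attaching and characteristic maps of `c'` to those of `c`. -/
structure Subcomplex {I : MorphismProperty C} {J : Type v} [LinearOrder J] [OrderBot J]
    [SuccOrder J] [WellFoundedLT J] {X Y Z : C} {f : X ⟶ Y} {h : X ⟶ Z}
    (c' : PresentedComplex I J h) (c : PresentedComplex I J f) where
  cell (j : J) (hj : ¬ IsMax j) : (c'.attachCells j hj).ι → (c.attachCells j hj).ι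
  cell_injective (j : J) (hj : ¬ IsMax j) : Function.Injective (cell j hj)
  cell_type (j : J) (hj : ¬ IsMax j) (i : (c'.attachCells j hj).ι) :
    (c'.attachCells j hj).π i = (c.attachCells j hj).π (cell j hj i)
  seq : c'.F ⟶ c.F
  seq_bot : c'.isoBot.inv ≫ seq.app ⊥ = c.isoBot.inv
  attaching (j : J) (hj : ¬ IsMax j) (i : (c'.attachCells j hj).ι) :
    attachingMap (c'.attachCells j hj) i ≫ seq.app j =
      eqToHom (congrArg (fun e => e.1.left) (cell_type j hj i)) ≫
        attachingMap (c.attachCells j hj) (cell j hj i)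
  characteristic (j : J) (hj : ¬ IsMax j) (i : (c'.attachCells j hj).ι) :
    characteristicMap (c'.attachCells j hj) i ≫ seq.app (Order.succ j) =
      eqToHom (congrArg (fun e => e.1.right) (cell_type j hj i)) ≫
        characteristicMap (c.attachCells j hj) (cell j hj i)

/-- The map from the total object of a subcomplex to the total object of the complex. -/
def Subcomplex.inclusion {I : MorphismProperty C} {J : Type v} [LinearOrder J] [OrderBot J]
    [SuccOrder J] [WellFoundedLT J] {X Y Z : C} {f : X ⟶ Y} {h : X ⟶ Z}
    {c' : PresentedComplex I J h} {c : PresentedComplex I J f} (i : Subcomplex c' c) : Z ⟶ Y :=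
  c'.isColimit.map (Cocone.mk Y c.incl) i.seq

/-- The object `W` is compact relative to `I`: for some cardinal `γ`, every map from `W` to
(the target of) a presented relative `I`-cell complex factors through a subcomplex with at most
`γ` cells. -/
def IsCompactRelTo (W : C) (I : MorphismProperty C) : Prop :=
  ∃ γ : Cardinal.{v}, ∀ (J : Type v) [LinearOrder J] [OrderBot J] [SuccOrder J]
    [WellFoundedLT J] (X Y : C) (f : X ⟶ Y) (c : PresentedComplex I J f) (g : W ⟶ Y),
    ∃ (Z : C) (h : X ⟶ Z) (c' : PresentedComplex I J h) (i : Subcomplex c' c),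
      Cardinal.mk c'.Cells ≤ γ ∧ ∃ g' : W ⟶ Z, g' ≫ i.inclusion = g

/-- `f : A ⟶ B` is an effective monomorphism: it is the equalizer of the two natural maps
`B ⇉ B ⨿_A B`. -/
def IsEffectiveMono [HasPushouts C] {A B : C} (f : A ⟶ B) : Prop :=
  Nonempty (IsLimit (Fork.ofι f (pushout.condition (f := f) (g := f))))

end Cells

section Model

variable (C : Type u) [Category.{v} C] [ModelCategory C]

/-- The axioms that one adds to Quillen's closed model axioms to get the usual modern notion:
all small limits and colimits, and functorial factorizations. -/
structure IsBicompleteFunctorial : Prop where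
  hasLimits : HasLimits C
  hasColimits : HasColimits C
  factorization_cof :
    MorphismProperty.HasFunctorialFactorization (cofibrations C) (trivialFibrations C)
  factorization_fib :
    MorphismProperty.HasFunctorialFactorization (trivialCofibrations C) (fibrations C)

/-- Left and right properness. -/
structure IsProper : Prop where
  left : ∀ ⦃A B X Y : C⦄ (w : A ⟶ X) (i : A ⟶ B) (j : X ⟶ Y) (w' : B ⟶ Y),
    IsPushout w i j w' → weakEquivalences C w → cofibrations C i → weakEquivalences C w'
  right : ∀ ⦃A B X Y : C⦄ (w' : A ⟶ X) (q : A ⟶ B) (p : X ⟶ Y) (w : B ⟶ Y),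
    IsPullback w' q p w → weakEquivalences C w → fibrations C p → weakEquivalences C w'

variable {C}

/-- The model category `C` is cofibrantly generated with set of generating cofibrations `I` and
set of generating trivial cofibrations `J`: both are sets that permit the small object argument
and they detect the trivial fibrations and the fibrations. -/
structure IsCofibrantlyGeneratedBy (I J : MorphismProperty C) : Prop where
  small_I : MorphismProperty.IsSmall.{v} I
  small_J : MorphismProperty.IsSmall.{v} J
  domain_I : ∀ ⦃A B : C⦄ (f : A ⟶ B), I f → IsSmallRelTo A (relCells I)
  domain_J : ∀ ⦃A B : C⦄ (f : A ⟶ B), J f → IsSmallRelTo A (relCells J)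
  trivialFibrations_eq : trivialFibrations C = I.rlp
  fibrations_eq : fibrations C = J.rlp

variable (C)

/-- Cellular model categories. -/
def IsCellular : Prop :=
  ∃ I J : MorphismProperty C, IsCofibrantlyGeneratedBy I J ∧
    (∀ ⦃A B : C⦄ (f : A ⟶ B), I f → IsCompactRelTo A I ∧ IsCompactRelTo B I) ∧
    (∀ ⦃A B : C⦄ (f : A ⟶ B), J f → IsSmallRelTo A (relCells I)) ∧
    (∀ ⦃A B : C⦄ (f : A ⟶ B), cofibrations C f → IsEffectiveMono f)

end Model

end HirschhornModel

/-! ## Direct and inverse categories -/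

/-- A direct category: there is a functor to the ordinals that sends every non-identity map to a
non-identity (that is, strictly increasing) map. -/
def IsDirectCategory (D : Type v) [SmallCategory D] : Prop :=
  ∃ d : D ⥤ Ordinal.{v}, ∀ ⦃s t : D⦄ (a : s ⟶ t),
    (∃ h : s = t, a = eqToHom h) ∨ d.obj s < d.obj t

/-- An inverse category: its opposite is direct. -/
def IsInverseCategory (D : Type v) [SmallCategory D] : Prop := IsDirectCategory Dᵒᵖ

/-! ## Diagrams over a diagram of categories -/

namespace DiagramModel

open HirschhornModel

section Diagrams

variable {D : Type v} [SmallCategory D] (M : Pseudofunctor (LocallyDiscrete D) Cat.{v, u})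

/-- The category `M(s)`. -/
abbrev Fib (s : D) : Type u := M.obj ⟨s⟩

/-- The functor `a_* : M(s) ⥤ M(t)`. -/
def push {s t : D} (a : s ⟶ t) : Fib M s ⥤ Fib M t := (M.map a.toLoc).toFunctor

/-- The isomorphism `(𝟙 s)_* ≅ 𝟭`. -/
def pushId (s : D) : push M (𝟙 s) ≅ 𝟭 (Fib M s) := Cat.Hom.toNatIso (M.mapId ⟨s⟩)

/-- The isomorphism `(a ≫ b)_* ≅ b_* a_*`. -/
def pushComp {s t r : D} (a : s ⟶ t) (b : t ⟶ r) : push M (a ≫ b) ≅ push M a ⋙ push M b :=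
  Cat.Hom.toNatIso (M.mapComp a.toLoc b.toLoc)

theorem pushComp_id_right {s t : D} (a : s ⟶ t) (A : Fib M s) :
    (pushComp M a (𝟙 t)).hom.app A ≫ (pushId M t).hom.app ((push M a).obj A) =
      eqToHom (by rw [Category.comp_id]; rfl) := by
  have h := M.mapComp_id_right_hom_app a.toLoc A
  have e : M.map₂ (ρ_ a.toLoc).hom = eqToHom (by rw [Category.comp_id]) := by
    rw [Strict.rightUnitor_eqToIso]
    simp [PrelaxFunctor.map₂_eqToHom]
  rw [e, Cat.Hom₂.eqToHom_toNatTrans, eqToHom_app] at h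
  change (M.mapComp a.toLoc (𝟙 (LocallyDiscrete.mk t))).hom.toNatTrans.app A ≫
    (M.mapId ⟨t⟩).hom.toNatTrans.app ((M.map a.toLoc).toFunctor.obj A) = _
  rw [h, Category.assoc, Cat.Hom.inv_hom_id_toNatTrans_app]
  exact Category.comp_id _

theorem pushComp_assoc {s t r q : D} (a : s ⟶ t) (b : t ⟶ r) (c : r ⟶ q) (A : Fib M s) :
    (pushComp M (a ≫ b) c).hom.app A ≫ (push M c).map ((pushComp M a b).hom.app A) =
      eqToHom (by rw [Category.assoc]) ≫ (pushComp M a (b ≫ c)).hom.app A ≫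
        (pushComp M b c).hom.app ((push M a).obj A) := by
  have h := M.mapComp_assoc_right_hom_app a.toLoc b.toLoc c.toLoc A
  have e : M.map₂ (α_ a.toLoc b.toLoc c.toLoc).inv = eqToHom (by rw [Category.assoc]) := by
    rw [Strict.associator_eqToIso]
    simp [PrelaxFunctor.map₂_eqToHom]
  rw [e, Cat.Hom₂.eqToHom_toNatTrans, eqToHom_app] at h
  exact (eqToHom_comp_iff _ _ _).1 h.symm

/-- An `M`-diagram: objects `X(s)` of `M(s)` with maps `a_* X(s) ⟶ X(t)`, compatible with
identities and composition. -/
structure MDiagram where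
  obj (s : D) : Fib M s
  map {s t : D} (a : s ⟶ t) : (push M a).obj (obj s) ⟶ obj t
  map_id (s : D) : map (𝟙 s) = (pushId M s).hom.app (obj s)
  map_comp {s t r : D} (a : s ⟶ t) (b : t ⟶ r) :
    map (a ≫ b) = (pushComp M a b).hom.app (obj s) ≫ (push M b).map (map a) ≫ map b

variable {M}

/-- Maps of `M`-diagrams. -/
@[ext]
structure MDiagram.Hom (X Y : MDiagram M) where
  app (s : D) : X.obj s ⟶ Y.obj s
  naturality {s t : D} (a : s ⟶ t) : (push M a).map (app s) ≫ Y.map a = X.map a ≫ app t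

instance : Category (MDiagram M) where
  Hom X Y := MDiagram.Hom X Y
  id X :=
    { app := fun s => 𝟙 (X.obj s)
      naturality := fun a => by simp }
  comp f g :=
    { app := fun s => f.app s ≫ g.app s
      naturality := fun a => by
        rw [Functor.map_comp, Category.assoc, g.naturality, ← Category.assoc, f.naturality,
          Category.assoc] }
  id_comp f := MDiagram.Hom.ext (funext fun s => Category.id_comp _)
  comp_id f := MDiagram.Hom.ext (funext fun s => Category.comp_id _)
  assoc f g h := MDiagram.Hom.ext (funext fun s => Category.assoc _ _ _)

theorem MDiagram.hom_ext {X Y : MDiagram M} (f g : X ⟶ Y) (h : ∀ s, f.app s = g.app s) : f = g :=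
  MDiagram.Hom.ext (funext h)

@[simp]
theorem MDiagram.id_app (X : MDiagram M) (s : D) : MDiagram.Hom.app (𝟙 X) s = 𝟙 (X.obj s) := rfl

@[simp]
theorem MDiagram.comp_app {X Y Z : MDiagram M} (f : X ⟶ Y) (g : Y ⟶ Z) (s : D) :
    (f ≫ g).app s = f.app s ≫ g.app s := rfl

end Diagrams

/-! ## Diagrams of model categories -/

/-- `M` is a diagram of model categories: every `M(s)` is a model category with small limits and
colimits and functorial factorizations, and every `a_*` is a left Quillen functor. -/
class IsDiagramOfModelCategories {D : Type v} [SmallCategory D]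
    (M : Pseudofunctor (LocallyDiscrete D) Cat.{v, u}) [∀ s, ModelCategory (Fib M s)] :
    Prop where
  isBicompleteFunctorial (s : D) : IsBicompleteFunctorial (Fib M s)
  isLeftAdjoint {s t : D} (a : s ⟶ t) : (push M a).IsLeftAdjoint
  map_cofibration {s t : D} (a : s ⟶ t) {A B : Fib M s} (f : A ⟶ B) :
    cofibrations (Fib M s) f → cofibrations (Fib M t) ((push M a).map f)
  map_trivialCofibration {s t : D} (a : s ⟶ t) {A B : Fib M s} (f : A ⟶ B) :
    trivialCofibrations (Fib M s) f → trivialCofibrations (Fib M t) ((push M a).map f)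

attribute [instance] IsDiagramOfModelCategories.isLeftAdjoint

instance {D : Type v} [SmallCategory D] (M : Pseudofunctor (LocallyDiscrete D) Cat.{v, u})
    [∀ s, ModelCategory (Fib M s)] [IsDiagramOfModelCategories M] (s : D) :
    HasColimits (Fib M s) :=
  (IsDiagramOfModelCategories.isBicompleteFunctorial (M := M) s).hasColimits

/-- The model structure on `M`-diagrams is the diagram-projective one: weak equivalences and
fibrations are objectwise. -/
structure IsDiagramProjective {D : Type v} [SmallCategory D]
    (M : Pseudofunctor (LocallyDiscrete D) Cat.{v, u}) [∀ s, ModelCategory (Fib M s)]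
    [ModelCategory (MDiagram M)] : Prop where
  weakEquivalences_iff {X Y : MDiagram M} (f : X ⟶ Y) :
    weakEquivalences (MDiagram M) f ↔ ∀ s, weakEquivalences (Fib M s) (f.app s)
  fibrations_iff {X Y : MDiagram M} (f : X ⟶ Y) :
    fibrations (MDiagram M) f ↔ ∀ s, fibrations (Fib M s) (f.app s)

/-- The model structure on `M`-diagrams is the diagram-injective one: weak equivalences and
cofibrations are objectwise. -/
structure IsDiagramInjective {D : Type v} [SmallCategory D]
    (M : Pseudofunctor (LocallyDiscrete D) Cat.{v, u}) [∀ s, ModelCategory (Fib M s)]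
    [ModelCategory (MDiagram M)] : Prop where
  weakEquivalences_iff {X Y : MDiagram M} (f : X ⟶ Y) :
    weakEquivalences (MDiagram M) f ↔ ∀ s, weakEquivalences (Fib M s) (f.app s)
  cofibrations_iff {X Y : MDiagram M} (f : X ⟶ Y) :
    cofibrations (MDiagram M) f ↔ ∀ s, cofibrations (Fib M s) (f.app s)

/-! ## Free diagrams -/

section Free

variable {D : Type v} [SmallCategory D]

/-- A set of maps with domain `s`, closed under postcomposition. -/
structure MapsFrom (s : D) where
  mem {t : D} (a : s ⟶ t) : Prop
  comp_mem {t r : D} (a : s ⟶ t) (b : t ⟶ r) : mem a → mem (a ≫ b)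

/-- All maps with domain `s`. -/
def MapsFrom.all (s : D) : MapsFrom s where
  mem _ := True
  comp_mem _ _ _ := trivial

theorem MapsFrom.mem_all {s t : D} (a : s ⟶ t) : (MapsFrom.all s).mem a := trivial

/-- The maps `s ⟶ t` with `t ≠ s`, in an inverse category. -/
def MapsFrom.boundary (hD : IsInverseCategory D) (s : D) : MapsFrom s where
  mem {t} _ := s ≠ t
  comp_mem {t r} a b hst hsr := by
    subst hsr
    obtain ⟨d, hd⟩ := hD
    have h₁ : d.obj (Opposite.op t) < d.obj (Opposite.op s) := by
      rcases hd a.op with ⟨h, -⟩ | h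
      · exact absurd (Opposite.op_injective h).symm hst
      · exact h
    exact absurd (leOfHom (d.map b.op)) (not_le_of_gt h₁)

variable (M : Pseudofunctor (LocallyDiscrete D) Cat.{v, u}) [∀ s, HasColimits (Fib M s)]
  [∀ {s t : D} (a : s ⟶ t), (push M a).IsLeftAdjoint]

/-- The value at `t` of the diagram generated by `A` along the maps in `S`: the coproduct of
the objects `a_* A` over all `a : s ⟶ t` in `S`. If there is exactly one such `a`, this is `a_* A`;
if there is none, it is the initial object. -/
def freeObj {s : D} (S : MapsFrom s) (A : Fib M s) (t : D) : Fib M t :=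
  ∐ fun a : {a : s ⟶ t // S.mem a} => (push M a.1).obj A

/-- The inclusion of a summand. -/
def freeIncl {s : D} (S : MapsFrom s) (A : Fib M s) {t : D} (a : s ⟶ t) (ha : S.mem a) :
    (push M a).obj A ⟶ freeObj M S A t :=
  Sigma.ι (fun a : {a : s ⟶ t // S.mem a} => (push M a.1).obj A) ⟨a, ha⟩

variable {M}

theorem freeObj_hom_ext {s : D} {S : MapsFrom s} {A : Fib M s} {t : D} {Z : Fib M t}
    {f g : freeObj M S A t ⟶ Z}
    (h : ∀ (a : s ⟶ t) (ha : S.mem a), freeIncl M S A a ha ≫ f = freeIncl M S A a ha ≫ g) :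
    f = g :=
  Sigma.hom_ext _ _ fun a => h a.1 a.2

theorem eqToHom_freeIncl {s : D} (S : MapsFrom s) (A : Fib M s) {t : D} {a a' : s ⟶ t}
    (h : a = a') (ha : S.mem a) (ha' : S.mem a')
    (e : (push M a).obj A = (push M a').obj A) :
    eqToHom e ≫ freeIncl M S A a' ha' = freeIncl M S A a ha := by
  subst h
  simp

/-- The functors `b_*` preserve the coproduct that defines the free diagram. -/
def isColimitPushFree {s : D} (S : MapsFrom s) (A : Fib M s) {t r : D} (b : t ⟶ r) :
    IsColimit (Cofan.mk ((push M b).obj (freeObj M S A t))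
      fun a : {a : s ⟶ t // S.mem a} => (push M b).map (freeIncl M S A a.1 a.2)) :=
  isColimitCofanMkObjOfIsColimit (push M b) _ _
    (coproductIsCoproduct fun a : {a : s ⟶ t // S.mem a} => (push M a.1).obj A)

/-- The structure map `b_* F(t) ⟶ F(r)`: on the summand of `a` it is the canonical isomorphism
`b_* a_* A ≅ (a ≫ b)_* A` onto the summand of `a ≫ b`. -/
def freeMap {s : D} (S : MapsFrom s) (A : Fib M s) {t r : D} (b : t ⟶ r) :
    (push M b).obj (freeObj M S A t) ⟶ freeObj M S A r :=
  Cofan.IsColimit.desc (isColimitPushFree S A b) fun a =>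
    (pushComp M a.1 b).inv.app A ≫ freeIncl M S A (a.1 ≫ b) (S.comp_mem a.1 b a.2)

theorem push_freeIncl_freeMap {s : D} (S : MapsFrom s) (A : Fib M s) {t r : D} (b : t ⟶ r)
    (a : s ⟶ t) (ha : S.mem a) :
    (push M b).map (freeIncl M S A a ha) ≫ freeMap S A b =
      (pushComp M a b).inv.app A ≫ freeIncl M S A (a ≫ b) (S.comp_mem a b ha) :=
  Cofan.IsColimit.fac (isColimitPushFree S A b) _ ⟨a, ha⟩

theorem push_freeObj_hom_ext {s : D} {S : MapsFrom s} {A : Fib M s} {t r : D} {b : t ⟶ r}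
    {Z : Fib M r} {f g : (push M b).obj (freeObj M S A t) ⟶ Z}
    (h : ∀ (a : s ⟶ t) (ha : S.mem a), (push M b).map (freeIncl M S A a ha) ≫ f =
      (push M b).map (freeIncl M S A a ha) ≫ g) : f = g :=
  Cofan.IsColimit.hom_ext (isColimitPushFree S A b) _ _ fun a => h a.1 a.2

/-- The diagram generated by `A` along the maps in `S`. -/
def freeOn {s : D} (S : MapsFrom s) (A : Fib M s) : MDiagram M where
  obj t := freeObj M S A t
  map b := freeMap S A b
  map_id t := by
    refine push_freeObj_hom_ext fun a ha => ?_
    rw [push_freeIncl_freeMap, (pushId M t).hom.naturality,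
      ← eqToHom_freeIncl S A (Category.comp_id a).symm ha (S.comp_mem a (𝟙 t) ha)
        (by rw [Category.comp_id])]
    have h := pushComp_id_right M a A
    rw [← cancel_epi ((pushComp M a (𝟙 t)).hom.app A), Iso.hom_inv_id_app_assoc,
      reassoc_of% h]
    simp
  map_comp {t r q} b c := by
    refine push_freeObj_hom_ext fun a ha => ?_
    have h := pushComp_assoc M a b c A
    have h₁ : (push M c).map ((push M b).map (freeIncl M S A a ha)) ≫
        (push M c).map (freeMap S A b) ≫ freeMap S A c =
        (push M c).map ((pushComp M a b).inv.app A) ≫ (pushComp M (a ≫ b) c).inv.app A ≫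
          freeIncl M S A ((a ≫ b) ≫ c) (S.comp_mem _ c (S.comp_mem a b ha)) := by
      rw [← Functor.map_comp_assoc, push_freeIncl_freeMap, Functor.map_comp, Category.assoc,
        push_freeIncl_freeMap]
    rw [push_freeIncl_freeMap, (pushComp M b c).hom.naturality_assoc, Functor.comp_map, h₁,
      ← cancel_epi ((pushComp M a (b ≫ c)).hom.app A), Iso.hom_inv_id_app_assoc,
      ← cancel_epi (eqToHom (congrArg (fun x => (push M x).obj A) (Category.assoc a b c))),
      eqToHom_freeIncl S A (Category.assoc a b c)
        (S.comp_mem _ c (S.comp_mem a b ha))]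
    rw [← reassoc_of% h, ← Functor.map_comp_assoc, Iso.hom_inv_id_app]
    simp

/-- The map of values at `t` induced by `f : A ⟶ B`. -/
def freeObjMap {s : D} (S : MapsFrom s) {A B : Fib M s} (f : A ⟶ B) (t : D) :
    freeObj M S A t ⟶ freeObj M S B t :=
  Limits.Sigma.map fun a : {a : s ⟶ t // S.mem a} => (push M a.1).map f

theorem freeIncl_freeObjMap {s : D} (S : MapsFrom s) {A B : Fib M s} (f : A ⟶ B) {t : D}
    (a : s ⟶ t) (ha : S.mem a) :
    freeIncl M S A a ha ≫ freeObjMap S f t = (push M a).map f ≫ freeIncl M S B a ha :=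
  Limits.Sigma.ι_map (fun a : {a : s ⟶ t // S.mem a} => (push M a.1).map f) ⟨a, ha⟩

/-- The map of generated diagrams induced by `f : A ⟶ B`. -/
def freeOnMap {s : D} (S : MapsFrom s) {A B : Fib M s} (f : A ⟶ B) :
    freeOn S A ⟶ freeOn S B where
  app t := freeObjMap S f t
  naturality {t r} b := by
    refine push_freeObj_hom_ext fun a ha => ?_
    change (push M b).map (freeIncl M S A a ha) ≫ (push M b).map (freeObjMap S f t) ≫
        freeMap S B b = (push M b).map (freeIncl M S A a ha) ≫ freeMap S A b ≫ freeObjMap S f r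
    have h := (pushComp M a b).inv.naturality f
    rw [Functor.comp_map] at h
    rw [← Functor.map_comp_assoc, freeIncl_freeObjMap, Functor.map_comp, Category.assoc,
      push_freeIncl_freeMap, reassoc_of% (push_freeIncl_freeMap S A b a ha),
      freeIncl_freeObjMap, reassoc_of% h]

/-- The inclusion of values at `t`, for the maps in `S` among all maps. -/
def freeObjToAll {s : D} (S : MapsFrom s) (A : Fib M s) (t : D) :
    freeObj M S A t ⟶ freeObj M (MapsFrom.all s) A t :=
  Limits.Sigma.desc fun a : {a : s ⟶ t // S.mem a} => freeIncl M (MapsFrom.all s) A a.1 (MapsFrom.mem_all a.1)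

theorem freeIncl_freeObjToAll {s : D} (S : MapsFrom s) (A : Fib M s) {t : D}
    (a : s ⟶ t) (ha : S.mem a) :
    freeIncl M S A a ha ≫ freeObjToAll S A t = freeIncl M (MapsFrom.all s) A a (MapsFrom.mem_all a) :=
  Limits.Sigma.ι_desc
    (fun a : {a : s ⟶ t // S.mem a} => freeIncl M (MapsFrom.all s) A a.1 (MapsFrom.mem_all a.1)) ⟨a, ha⟩

/-- The inclusion of the diagram generated along `S` into the one generated along all maps. -/
def freeOnToAll {s : D} (S : MapsFrom s) (A : Fib M s) :
    freeOn S A ⟶ freeOn (MapsFrom.all s) A where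
  app t := freeObjToAll S A t
  naturality {t r} b := by
    refine push_freeObj_hom_ext fun a ha => ?_
    change (push M b).map (freeIncl M S A a ha) ≫ (push M b).map (freeObjToAll S A t) ≫
        freeMap (MapsFrom.all s) A b =
      (push M b).map (freeIncl M S A a ha) ≫ freeMap S A b ≫ freeObjToAll S A r
    rw [← Functor.map_comp_assoc, freeIncl_freeObjToAll,
      push_freeIncl_freeMap, reassoc_of% (push_freeIncl_freeMap S A b a ha),
      freeIncl_freeObjToAll]

/-- The free diagram `F^s_A`. -/
def free (s : D) (A : Fib M s) : MDiagram M := freeOn (MapsFrom.all s) A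

/-- The map of free diagrams `F^s_A ⟶ F^s_B` induced by `f : A ⟶ B`. -/
def freeHom (s : D) {A B : Fib M s} (f : A ⟶ B) : free s A ⟶ free s B :=
  freeOnMap (MapsFrom.all s) f

/-- The boundary `∂F^s_A` of the free diagram, for an inverse category: it agrees with `F^s_A`
away from `s` and is initial at `s`. -/
def boundary (hD : IsInverseCategory D) (s : D) (A : Fib M s) : MDiagram M :=
  freeOn (MapsFrom.boundary hD s) A

/-- The map of boundaries induced by `f : A ⟶ B`. -/
def boundaryHom (hD : IsInverseCategory D) (s : D) {A B : Fib M s} (f : A ⟶ B) :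
    boundary hD s A ⟶ boundary hD s B :=
  freeOnMap (MapsFrom.boundary hD s) f

/-- The inclusion `∂F^s_A ⟶ F^s_A`. -/
def boundaryIncl (hD : IsInverseCategory D) (s : D) (A : Fib M s) :
    boundary hD s A ⟶ free s A :=
  freeOnToAll (MapsFrom.boundary hD s) A

theorem boundary_comm (hD : IsInverseCategory D) (s : D) {A B : Fib M s} (f : A ⟶ B) :
    boundaryIncl hD s A ≫ freeHom s f = boundaryHom hD s f ≫ boundaryIncl hD s B := by
  refine MDiagram.hom_ext _ _ fun t => freeObj_hom_ext fun a ha => ?_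
  change freeIncl M _ A a ha ≫ freeObjToAll _ A t ≫ freeObjMap _ f t =
    freeIncl M _ A a ha ≫ freeObjMap _ f t ≫ freeObjToAll _ B t
  rw [reassoc_of% (freeIncl_freeObjToAll (MapsFrom.boundary hD s) A a ha),
    freeIncl_freeObjMap,
    reassoc_of% (freeIncl_freeObjMap (MapsFrom.boundary hD s) f a ha), freeIncl_freeObjToAll]

/-- The map `F^s_A ⨿_{∂F^s_A} ∂F^s_B ⟶ F^s_B` induced by `f : A ⟶ B`. -/
def boundaryCorner [HasPushouts (MDiagram M)] (hD : IsInverseCategory D) (s : D)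
    {A B : Fib M s} (f : A ⟶ B) :
    pushout (boundaryIncl hD s A) (boundaryHom hD s f) ⟶ free s B :=
  pushout.desc (freeHom s f) (boundaryIncl hD s B) (boundary_comm hD s f)

/-- For `D` direct: the maps of free diagrams `F^s_A ⟶ F^s_B` with `f : A ⟶ B` in `I s`. -/
inductive freeGenerators (I : ∀ s, MorphismProperty (Fib M s)) : MorphismProperty (MDiagram M)
  | mk (s : D) {A B : Fib M s} (f : A ⟶ B) (hf : I s f) : freeGenerators I (freeHom s f)

/-- For `D` inverse: the maps `F^s_A ⨿_{∂F^s_A} ∂F^s_B ⟶ F^s_B` with `f : A ⟶ B` in `I s`. -/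
inductive cornerGenerators [HasPushouts (MDiagram M)] (hD : IsInverseCategory D)
    (I : ∀ s, MorphismProperty (Fib M s)) : MorphismProperty (MDiagram M)
  | mk (s : D) {A B : Fib M s} (f : A ⟶ B) (hf : I s f) :
      cornerGenerators hD I (boundaryCorner hD s f)

/-- If `S` has exactly one map `a : s ⟶ t`, the value at `t` is `a_* A`. -/
theorem isIso_freeIncl [Quiver.IsThin D] {s : D} (S : MapsFrom s) (A : Fib M s) {t : D}
    (a : s ⟶ t) (ha : S.mem a) : IsIso (freeIncl M S A a ha) := by
  refine ⟨Limits.Sigma.desc fun b : {a : s ⟶ t // S.mem a} =>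
    eqToHom (by rw [Subsingleton.elim b.1 a]), ?_, freeObj_hom_ext fun b hb => ?_⟩
  · exact Limits.Sigma.ι_desc _ (⟨a, ha⟩ : {a : s ⟶ t // S.mem a})
  · obtain rfl : b = a := Subsingleton.elim b a
    have h : freeIncl M S A b hb ≫ (Limits.Sigma.desc fun b' : {a : s ⟶ t // S.mem a} =>
        eqToHom (by rw [Subsingleton.elim b'.1 b]) :
          freeObj M S A t ⟶ (push M b).obj A) = 𝟙 _ :=
      Limits.Sigma.ι_desc _ (⟨b, hb⟩ : {a : s ⟶ t // S.mem a})
    exact (Category.assoc _ _ _).symm.trans ((congrArg (· ≫ freeIncl M S A b ha) h).trans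
      ((Category.id_comp _).trans (Category.comp_id _).symm))

/-- If `S` has no map `s ⟶ t`, the value at `t` is initial. -/
theorem nonempty_isInitial_freeObj {s : D} (S : MapsFrom s) (A : Fib M s) {t : D}
    (h : ∀ a : s ⟶ t, ¬ S.mem a) : Nonempty (IsInitial (freeObj M S A t)) :=
  ⟨IsInitial.ofUniqueHom
    (fun _ => Limits.Sigma.desc fun a : {a : s ⟶ t // S.mem a} => (h a.1 a.2).elim)
    fun _ _ => freeObj_hom_ext fun a ha => (h a ha).elim⟩

end Free

end DiagramModel

end

set_option linter.unusedSectionVars false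

/-! Both model structures come from Kan's recognition theorem (`exists_modelCategory`), applied to
the objectwise weak equivalences and the sets `K I`, `K J`, where `K` is `freeGenerators` or
`cornerGenerators`. `IsGeneratorConstruction` isolates what is needed of `K`, and
`exists_modelCategory_of_generators` draws the conclusions. Limits and colimits of diagrams are
objectwise, and in both cases every cofibration is an objectwise cofibration and every fibration an
objectwise fibration. Hence properness and the effective monomorphism condition are inherited from
the `M(s)`.

Lifting. By adjunction, lifting against a map of free diagrams at `s` is lifting against `f` in
`M(s)`. For a corner map it is lifting of `f` against the relative matching map at `s`. Well-founded
recursion over the inverse category then shows that the right lifting property against the corner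
maps is the one against all objectwise (trivial) cofibrations (`hasLiftingProperty_of_objectwise`),
and a retract argument compares the two classes (`rlp_cornerGenerators_eq_inf`).

Smallness and compactness are the hard part. A cell complex of diagrams, evaluated at `s`, is built
from cofibrations that need not be cells of `I s`, so the hypotheses on `M(s)` do not apply to it
directly. The remedy is to fix a directed family `Z` of subobjects of `T`, to call a map to `T` good
if it factors through a member, and to call `T` accessible if a map `E ⟶ T` over which the base
lifts has a section as soon as it has liftings for the squares with good bottom map. Attaching to
the base all cells of `I` over `T` with good projection gives such an `E` that is a genuine cell
complex. A map from a compact `W` to `T` is moved into `E` along the section and lands in a small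
subcomplex; the cells of this subcomplex are good, so the map is good (`good_of_compactWith`).

With `Z` the small subcomplexes of a complex of diagrams this yields compactness
(`exists_attaching_factor`, `Tested.compactWith`). With `Z` the stages of a long chain, and a tower
that respects the stages, it yields smallness (`IsSmallRelTo.chainSmall`). Objects receiving an
objectwise cofibration from a free diagram, such as the domains of the corner maps, are reached by
the relative compactness of maps in the saturation (`exists_good_of_comp_good`). -/

noncomputable section

/-! ### Transfinite recursion with a successor step that depends on the stage. -/

namespace HirschhornModel

section Recursion

variable {C : Type u} [Category.{v} C]

/-- The factor `Set A` is a complete lattice that will record the stage of a recursion; in it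
colimits are suprema, so colimits in the product are formed componentwise. -/
instance hasColimitsOfShape_prod {K : Type v} [SmallCategory K] {A : Type v}
    [HasColimitsOfShape K C] :
    HasColimitsOfShape K (C × Set A) where
  has_colimit F := by
    let p : Set A := ⨆ k, (F.obj k).2
    let c : Cocone F :=
      { pt := (colimit (F ⋙ CategoryTheory.Prod.fst C (Set A)), p)
        ι :=
          { app k := (colimit.ι (F ⋙ CategoryTheory.Prod.fst C (Set A)) k, homOfLE (le_iSup (fun k => (F.obj k).2) k))
            naturality k l f := Prod.ext (by
              simpa using colimit.w (F ⋙ CategoryTheory.Prod.fst C (Set A)) f) (Subsingleton.elim _ _) } }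
    refine ⟨⟨c, ?_⟩⟩
    exact
      { desc s := (colimit.desc (F ⋙ CategoryTheory.Prod.fst C (Set A)) ((CategoryTheory.Prod.fst C (Set A)).mapCocone s),
          homOfLE (iSup_le fun k => leOfHom (s.ι.app k).2))
        fac s k := Prod.ext (colimit.ι_desc ((CategoryTheory.Prod.fst C (Set A)).mapCocone s) k)
          (Subsingleton.elim _ _)
        uniq s m h := Prod.ext (colimit.hom_ext fun k => by
          refine Eq.trans ?_ (colimit.ι_desc ((CategoryTheory.Prod.fst C (Set A)).mapCocone s) k).symm
          exact congrArg Prod.fst (h k)) (Subsingleton.elim _ _) }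

instance hasColimits_prod {A : Type v} [HasColimits C] : HasColimits (C × Set A) where

variable (J : Type v) [LinearOrder J] [OrderBot J] [SuccOrder J] [WellFoundedLT J]

open Classical in
/-- The position of `p` in the well-order `J` when `p` is an initial segment. -/
def segmentIndex (p : Set J) : J := if h : ∃ j, p = Set.Iio j then h.choose else ⊥

theorem segmentIndex_Iio (j : J) : segmentIndex J (Set.Iio j) = j := by
  have h : ∃ i, Set.Iio j = Set.Iio i := ⟨j, rfl⟩
  rw [segmentIndex, dif_pos h]
  exact (Set.Iio_injective h.choose_spec).symm

variable {J}

/-- The successor structure on `C × Set J` which keeps track of the stage in the second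
component. -/
def stagedSuccStruct (X₀ : C) (s : J → C → C) (t : ∀ j X, X ⟶ s j X) :
    SmallObject.SuccStruct (C × Set J) where
  X₀ := (X₀, ∅)
  -- For the segment `Iio j` the set added is `Iic j`, which is `Iio (succ j)` when `j` is not
  -- maximal, so the second component always reads off the current stage.
  succ X := (s (segmentIndex J X.2) X.1, X.2 ∪ {x | Set.Iio x ⊆ X.2})
  toSucc _ := (t _ _, homOfLE Set.subset_union_left)

/-- A cocone in `C` is extended to the product by giving its vertex the second component `⊤`, to
which everything maps. The universal property in the product then restricts to the first component.
-/
theorem fst_isWellOrderContinuous [HasColimits C] (F : J ⥤ C × Set J) [F.IsWellOrderContinuous] :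
    (F ⋙ CategoryTheory.Prod.fst C (Set J)).IsWellOrderContinuous where
  nonempty_isColimit m hm := by
    let G := (Set.principalSegIio m).monotone.functor ⋙ F
    refine ⟨?_⟩
    have h := F.isColimitOfIsWellOrderContinuous m hm
    exact
      { desc := fun s => (h.desc (Cocone.mk (s.pt, (⊤ : Set J))
          { app k := (s.ι.app k, homOfLE le_top)
            naturality k l f := Prod.ext (s.ι.naturality f) (Subsingleton.elim _ _) })).1
        fac := fun s j => congrArg Prod.fst (h.fac (Cocone.mk (s.pt, (⊤ : Set J))
          { app k := (s.ι.app k, homOfLE le_top)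
            naturality k l f := Prod.ext (s.ι.naturality f) (Subsingleton.elim _ _) }) j)
        uniq := fun s m' hm' => congrArg Prod.fst (h.uniq (Cocone.mk (s.pt, (⊤ : Set J))
          { app k := (s.ι.app k, homOfLE le_top)
            naturality k l f := Prod.ext (s.ι.naturality f) (Subsingleton.elim _ _) })
            (m', homOfLE le_top) fun j => Prod.ext (hm' j) (Subsingleton.elim _ _)) }

/-- A functor on a well-order defined by transfinite recursion, with a construction at successors
that depends on the stage. -/
structure StagedIteration (X₀ : C) (s : J → C → C) (t : ∀ j X, X ⟶ s j X) where
  F : J ⥤ C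
  cont : F.IsWellOrderContinuous
  isoBot : F.obj ⊥ ≅ X₀
  isoSucc (j : J) (hj : ¬ IsMax j) : F.obj (Order.succ j) ≅ s j (F.obj j)
  map_succ (j : J) (hj : ¬ IsMax j) :
    F.map (homOfLE (Order.le_succ j)) = t j (F.obj j) ≫ (isoSucc j hj).inv

theorem stagedIteration_snd [HasColimits C] (X₀ : C) (s : J → C → C) (t : ∀ j X, X ⟶ s j X)
    (j : J) : (((stagedSuccStruct X₀ s t).iterationFunctor J).obj j).2 = Set.Iio j := by
  induction j using SuccOrder.limitRecOn with
  | isMin j hj =>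
    obtain rfl := hj.eq_bot
    have e := (stagedSuccStruct X₀ s t).iterationFunctorObjBotIso J
    refine le_antisymm ?_ (by simp)
    exact (leOfHom e.hom.2).trans (Set.empty_subset _)
  | succ j hj ih =>
    have e := (stagedSuccStruct X₀ s t).iterationFunctorObjSuccIso j hj
    have h : (((stagedSuccStruct X₀ s t).iterationFunctor J).obj (Order.succ j)).2 =
        Set.Iio j ∪ {x | Set.Iio x ⊆ Set.Iio j} := by
      rw [← ih]
      exact le_antisymm (leOfHom e.hom.2) (leOfHom e.inv.2)
    rw [h]
    ext x
    simp only [Set.mem_union, Set.mem_Iio, Set.mem_ofPred_eq, Set.Iio_subset_Iio_iff,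
      Order.lt_succ_iff_of_not_isMax hj]
    exact ⟨fun h => h.elim le_of_lt id, Or.inr⟩
  | isSuccLimit j hj ih =>
    have h := ((stagedSuccStruct X₀ s t).iterationFunctor J).isColimitOfIsWellOrderContinuous j hj
    refine le_antisymm ?_ fun i hi => ?_
    -- A cocone whose vertex has second component `Iio j` bounds the colimit from above. The bound
    -- from below holds because `i < j` implies `succ i < j` at a limit.
    · let c : Cocone ((Set.principalSegIio j).monotone.functor ⋙
          (stagedSuccStruct X₀ s t).iterationFunctor J) :=
        Cocone.mk ((((stagedSuccStruct X₀ s t).iterationFunctor J).obj j).1, Set.Iio j)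
          { app k := ((((stagedSuccStruct X₀ s t).iterationFunctor J).map
              (homOfLE (le_of_lt k.2) : k.1 ⟶ j)).1, homOfLE (by
                have := ih k.1 k.2
                refine this.le.trans ?_
                exact Set.Iio_subset_Iio (le_of_lt k.2)))
            naturality k l f := Prod.ext (by
              have h₁ := congrArg Prod.fst (((Set.principalSegIio j).cocone
                ((stagedSuccStruct X₀ s t).iterationFunctor J)).ι.naturality f)
              exact h₁)
              (Subsingleton.elim _ _) }
      exact leOfHom (h.desc c).2
    · have hi' : Order.succ i < j := hj.succ_lt hi
      have h₂ := leOfHom (((stagedSuccStruct X₀ s t).iterationFunctor J).map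
        (homOfLE hi'.le)).2
      rw [ih _ hi'] at h₂
      exact h₂ (Order.lt_succ_of_not_isMax (not_isMax_iff.2 ⟨j, hi⟩))

/-- The iteration of one successor structure on `C × Set J` is projected to `C`. The stage read from
the second component is only propositionally equal to `j`, whence the transport by `eqToIso`. -/
theorem nonempty_stagedIteration [HasColimits C] (X₀ : C) (s : J → C → C)
    (t : ∀ j X, X ⟶ s j X) : Nonempty (StagedIteration X₀ s t) := by
  let Φ := stagedSuccStruct X₀ s t
  have key : ∀ j (hj : ¬ IsMax j), ∃ e : ((Φ.iterationFunctor J).obj (Order.succ j)).1 ≅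
      s j ((Φ.iterationFunctor J).obj j).1,
      ((Φ.iterationFunctor J).map (homOfLE (Order.le_succ j))).1 =
        t j ((Φ.iterationFunctor J).obj j).1 ≫ e.inv := by
    intro j hj
    have e : (Φ.succ ((Φ.iterationFunctor J).obj j)).1 = s j ((Φ.iterationFunctor J).obj j).1 := by
      change s (segmentIndex J ((Φ.iterationFunctor J).obj j).2) _ = _
      rw [stagedIteration_snd, segmentIndex_Iio]
    refine ⟨(CategoryTheory.Prod.fst C (Set J)).mapIso (Φ.iterationFunctorObjSuccIso j hj) ≪≫ eqToIso e, ?_⟩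
    have h := congrArg Prod.fst (Φ.iterationFunctor_map_succ j hj)
    refine h.trans ?_
    change t (segmentIndex J ((Φ.iterationFunctor J).obj j).2) _ ≫ _ =
      _ ≫ (eqToHom e.symm ≫ (Φ.iterationFunctorObjSuccIso j hj).inv.1)
    have aux : ∀ (i : J) (hi : i = j) (X : C) (e : s i X = s j X),
        t i X = t j X ≫ eqToHom e.symm := by
      rintro i rfl X e
      simp
    rw [← Category.assoc, aux _ ((congrArg _ (stagedIteration_snd X₀ s t j)).trans
      (segmentIndex_Iio J j)) _ e]
    rfl
  choose e he using key
  exact ⟨{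
    F := Φ.iterationFunctor J ⋙ CategoryTheory.Prod.fst C (Set J)
    cont := fst_isWellOrderContinuous _
    isoBot := (CategoryTheory.Prod.fst C (Set J)).mapIso (Φ.iterationFunctorObjBotIso J)
    isoSucc := e
    map_succ := he }⟩

end Recursion

end HirschhornModel

/-! ### Towers of cells over a fixed object. -/

namespace HirschhornModel

section Towers

variable {C : Type u} [Category.{v} C] {I : MorphismProperty C} {T : C}

theorem preservesWellOrderContinuousOfShape_of_preservesColimits {E : Type*} [Category.{v} E]
    (G : C ⥤ E) [PreservesColimits G] (J : Type v) [LinearOrder J] :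
    PreservesWellOrderContinuousOfShape J G where
  preservesColimitsOfShape _ _ := inferInstance

/-- A set of cells from `I` to be attached to an object over `T`. -/
structure CellData (I : MorphismProperty C) (X : Over T) where
  ι : Type v
  π : ι → I.toSet
  a (i : ι) : (π i).1.left ⟶ X.left
  b (i : ι) : (π i).1.right ⟶ T
  w (i : ι) : a i ≫ X.hom = (π i).1.hom ≫ b i

namespace CellData

variable [HasColimits C] {X : Over T} (d : CellData I X)

/-- The object over `T` obtained by attaching the cells. -/
def attach : Over T :=
  Over.mk (pushout.desc (f := Sigma.desc d.a) (g := Limits.Sigma.map fun i => (d.π i).1.hom)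
    X.hom (Sigma.desc d.b) (Sigma.hom_ext _ _ fun i => by simp [d.w]) :
      pushout (Sigma.desc d.a) (Limits.Sigma.map fun i => (d.π i).1.hom) ⟶ T)

/-- The inclusion into the object with the cells attached. -/
def incl : X ⟶ d.attach :=
  Over.homMk (pushout.inl _ _) (pushout.inl_desc _ _ _)

/-- The cells exhibit `incl` as an attachment of cells. -/
def attachCells : AttachCells.{v} I.homFamily d.incl.left where
  ι := d.ι
  π := d.π
  cofan₁ := Cofan.mk (∐ fun i => (d.π i).1.left) (Sigma.ι _)
  cofan₂ := Cofan.mk (∐ fun i => (d.π i).1.right) (Sigma.ι _)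
  isColimit₁ := coproductIsCoproduct _
  isColimit₂ := coproductIsCoproduct _
  m := Limits.Sigma.map fun i => (d.π i).1.hom
  hm i := by simp [Cofan.inj, MorphismProperty.homFamily]
  g₁ := Sigma.desc d.a
  g₂ := pushout.inr _ _
  isPushout := IsPushout.of_hasPushout _ _

theorem attachingMap_attachCells (i : d.ι) : attachingMap d.attachCells i = d.a i :=
  Sigma.ι_desc d.a i

theorem characteristicMap_attachCells (i : d.ι) :
    characteristicMap d.attachCells i ≫ d.attach.hom = d.b i := by
  have h : pushout.inr _ _ ≫ d.attach.hom = Sigma.desc d.b := pushout.inr_desc _ _ _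
  calc _ = Sigma.ι (fun i => (d.π i).1.right) i ≫ pushout.inr _ _ ≫ d.attach.hom :=
        Category.assoc _ _ _
    _ = _ := by rw [h, Sigma.ι_desc]

end CellData

variable {J : Type v} [LinearOrder J] [OrderBot J] [SuccOrder J] [WellFoundedLT J]

theorem attachingMap_comp {X₁ X₂ : C} {f : X₁ ⟶ X₂} (c : AttachCells.{v} I.homFamily f) (i : c.ι) :
    attachingMap c i ≫ f = (c.π i).1.hom ≫ characteristicMap c i := by
  have h := c.hm i
  dsimp [attachingMap, characteristicMap]
  rw [Category.assoc, c.isPushout.w, ← Category.assoc, h, Category.assoc]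
  rfl

theorem attachingMap_comp_assoc {X₁ X₂ Z : C} {f : X₁ ⟶ X₂} (c : AttachCells.{v} I.homFamily f)
    (i : c.ι) (g : X₂ ⟶ Z) :
    attachingMap c i ≫ f ≫ g = (c.π i).1.hom ≫ characteristicMap c i ≫ g := by
  rw [← Category.assoc, attachingMap_comp, Category.assoc]

theorem AttachCells.exists_desc {X₁ X₂ : C} {f : X₁ ⟶ X₂} (c : AttachCells.{v} I.homFamily f)
    {Z : C} (y : X₁ ⟶ Z) (y' : ∀ i, (c.π i).1.right ⟶ Z)
    (h : ∀ i, attachingMap c i ≫ y = (c.π i).1.hom ≫ y' i) :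
    ∃ q : X₂ ⟶ Z, f ≫ q = y ∧ ∀ i, characteristicMap c i ≫ q = y' i := by
  let q : c.cofan₂.pt ⟶ Z := Cofan.IsColimit.desc c.isColimit₂ y'
  have hq : ∀ i, c.cofan₂.inj i ≫ q = y' i := Cofan.IsColimit.fac c.isColimit₂ y'
  refine ⟨c.isPushout.desc y q ?_, c.isPushout.inl_desc _ _ _, fun i => ?_⟩
  · refine Cofan.IsColimit.hom_ext c.isColimit₁ _ _ fun i => ?_
    rw [AttachCells.hm_assoc, hq, ← Category.assoc]
    exact h i
  · rw [characteristicMap, Category.assoc, IsPushout.inr_desc, hq]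

theorem AttachCells.hom_ext' {X₁ X₂ : C} {f : X₁ ⟶ X₂} (c : AttachCells.{v} I.homFamily f)
    {Z : C} {φ φ' : X₂ ⟶ Z} (h₀ : f ≫ φ = f ≫ φ')
    (h : ∀ i, characteristicMap c i ≫ φ = characteristicMap c i ≫ φ') : φ = φ' :=
  c.hom_ext h₀ h

theorem exists_desc_of_isSuccLimit (F : J ⥤ C) [F.IsWellOrderContinuous] {j : J}
    (hj : Order.IsSuccLimit j) {Z : C} (y : ∀ i, i < j → (F.obj i ⟶ Z))
    (h : ∀ i i' (hi : i ≤ i') (hi' : i' < j),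
      F.map (homOfLE hi) ≫ y i' hi' = y i (hi.trans_lt hi')) :
    ∃ q : F.obj j ⟶ Z, ∀ i (hi : i < j), F.map (homOfLE hi.le) ≫ q = y i hi := by
  let s : Cocone ((Set.principalSegIio j).monotone.functor ⋙ F) :=
    Cocone.mk Z
      { app i := y i.1 i.2
        naturality i i' g := (h i.1 i'.1 (leOfHom g) i'.2).trans (Category.comp_id _).symm }
  exact ⟨(F.isColimitOfIsWellOrderContinuous j hj).desc s, fun i hi =>
    (F.isColimitOfIsWellOrderContinuous j hj).fac s ⟨i, hi⟩⟩

theorem hom_ext_of_isSuccLimit (F : J ⥤ C) [F.IsWellOrderContinuous] {j : J}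
    (hj : Order.IsSuccLimit j) {Z : C} {φ φ' : F.obj j ⟶ Z}
    (h : ∀ i (hi : i < j), F.map (homOfLE hi.le) ≫ φ = F.map (homOfLE hi.le) ≫ φ') : φ = φ' :=
  (F.isColimitOfIsWellOrderContinuous j hj).hom_ext fun i => h i.1 i.2

theorem map_incl {X Y : C} {f : X ⟶ Y} (c : TransfiniteCompositionOfShape J f) {i j : J}
    (h : i ⟶ j) : c.F.map h ≫ c.incl.app j = c.incl.app i :=
  (c.incl.naturality h).trans (Category.comp_id _)

theorem map_incl_assoc {X Y Z : C} {f : X ⟶ Y} (c : TransfiniteCompositionOfShape J f) {i j : J}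
    (h : i ⟶ j) (g : Y ⟶ Z) : c.F.map h ≫ c.incl.app j ≫ g = c.incl.app i ≫ g :=
  (Category.assoc _ _ _).symm.trans (congrArg (· ≫ g) (map_incl c h))

theorem isoBot_hom_comp {X Y : C} {f : X ⟶ Y} (c : TransfiniteCompositionOfShape J f) :
    c.isoBot.hom ≫ f = c.incl.app ⊥ := by
  rw [← Iso.eq_inv_comp]
  exact c.fac.symm

theorem isoBot_hom_comp_assoc {X Y Z : C} {f : X ⟶ Y} (c : TransfiniteCompositionOfShape J f)
    (g : Y ⟶ Z) : c.isoBot.hom ≫ f ≫ g = c.incl.app ⊥ ≫ g :=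
  (Category.assoc _ _ _).symm.trans (congrArg (· ≫ g) (isoBot_hom_comp c))

theorem exists_desc_total {X Y : C} {f : X ⟶ Y} (c : TransfiniteCompositionOfShape J f) {Z : C}
    (y : ∀ i, (c.F.obj i ⟶ Z)) (h : ∀ i i' (hi : i ≤ i'), c.F.map (homOfLE hi) ≫ y i' = y i) :
    ∃ q : Y ⟶ Z, ∀ i, c.incl.app i ≫ q = y i :=
  ⟨c.isColimit.desc (Cocone.mk Z
    { app := y, naturality := fun i i' g => (h i i' (leOfHom g)).trans (Category.comp_id _).symm }),
    c.isColimit.fac _⟩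

/-- A map `Y ⟶ T` out of a presented complex factors stagewise through an increasing family of
monomorphisms if its restrictions to the base and to the cells do. -/
theorem PresentedComplex.exists_stage_factor {X Y : C} {f : X ⟶ Y} (c : PresentedComplex I J f)
    (β : Y ⟶ T) (Z : J → C) (z : ∀ j, Z j ⟶ T) [∀ j, Mono (z j)]
    (hz : ∀ i j, i ≤ j → ∃ k : Z i ⟶ Z j, k ≫ z j = z i)
    (h₀ : ∃ x : X ⟶ Z ⊥, x ≫ z ⊥ = f ≫ β)
    (h : ∀ j hj, (∃ y : c.F.obj j ⟶ Z j, y ≫ z j = c.incl.app j ≫ β) → ∀ i, ∃ y : _ ⟶ Z (Order.succ j), y ≫ z (Order.succ j) =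
      characteristicMap (c.attachCells j hj) i ≫ c.incl.app (Order.succ j) ≫ β) (j : J) :
    ∃ y : c.F.obj j ⟶ Z j, y ≫ z j = c.incl.app j ≫ β := by
  induction j using SuccOrder.limitRecOn with
  | isMin j hj =>
    obtain rfl := hj.eq_bot
    obtain ⟨x, hx⟩ := h₀
    refine ⟨c.isoBot.hom ≫ x, ?_⟩
    rw [Category.assoc, hx, isoBot_hom_comp_assoc]
  | succ j hj ih =>
    obtain ⟨y, hy⟩ := ih
    obtain ⟨k, hk⟩ := hz _ _ (Order.le_succ j)
    choose y' hy' using h j hj ⟨y, hy⟩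
    obtain ⟨q, hq, hq'⟩ := AttachCells.exists_desc (c.attachCells j hj) (y ≫ k) y' fun i => by
      -- As `z` is a monomorphism, compatibility with the attaching maps can be checked after
      -- composing to `T`, where everything is a restriction of `β`.
      rw [← cancel_mono (z _)]
      simp only [Category.assoc, hk, hy, hy']
      rw [← attachingMap_comp_assoc, map_incl_assoc]
    refine ⟨q, AttachCells.hom_ext' (c.attachCells j hj) ?_ fun i => ?_⟩
    · rw [reassoc_of% hq, hk, hy, map_incl_assoc]
    · rw [reassoc_of% hq', hy']
  | isSuccLimit j hj ih =>
    choose y hy using ih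
    choose k hk using hz
    obtain ⟨q, hq⟩ := exists_desc_of_isSuccLimit c.F hj (fun i hi => y i hi ≫ k _ _ hi.le)
      fun i i' hi hi' => by
        rw [← cancel_mono (z j)]
        simp only [Category.assoc, hk, hy, map_incl_assoc]
    refine ⟨q, hom_ext_of_isSuccLimit c.F hj fun i hi => ?_⟩
    rw [reassoc_of% (hq i hi), hk, hy, map_incl_assoc]

/-- A map out of a presented complex factors through a monomorphism if its restrictions to the
base and to the cells do. -/
theorem PresentedComplex.exists_factor {X Y : C} {f : X ⟶ Y} (c : PresentedComplex I J f)
    (β : Y ⟶ T) {Z : C} (z : Z ⟶ T) [Mono z] (h₀ : ∃ x : X ⟶ Z, x ≫ z = f ≫ β)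
    (h : ∀ j hj i, ∃ y : _ ⟶ Z, y ≫ z =
      characteristicMap (c.attachCells j hj) i ≫ c.incl.app (Order.succ j) ≫ β) :
    ∃ y : Y ⟶ Z, y ≫ z = β := by
  have key := PresentedComplex.exists_stage_factor c β (fun _ => Z) (fun _ => z)
    (fun _ _ _ => ⟨𝟙 _, Category.id_comp _⟩) h₀ fun j hj _ => h j hj
  choose y hy using key
  obtain ⟨q, hq⟩ := exists_desc_total c.toTransfiniteCompositionOfShape y fun i i' hi => by
    rw [← cancel_mono z]
    simp only [Category.assoc, hy, map_incl_assoc]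
  refine ⟨q, c.isColimit.hom_ext fun j => ?_⟩
  exact (Category.assoc _ _ _).symm.trans ((congrArg (· ≫ z) (hq j)).trans (hy j))

variable [HasColimits C]

/-- A tower of objects over `T` in which, at every stage `j`, the cells `d j` are attached. -/
abbrev Tower (X₀ : Over T) (d : ∀ (_ : J) (X : Over T), CellData I X) :=
  StagedIteration X₀ (fun j X => (d j X).attach) (fun j X => (d j X).incl)

namespace Tower

variable {X₀ : Over T} {d : ∀ (_ : J) (X : Over T), CellData I X} (tw : Tower X₀ d)

/-- The total object of a tower. -/
def total : C := colimit (tw.F ⋙ Over.forget T)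

/-- The map to the total object of a tower. -/
def map : X₀.left ⟶ tw.total := tw.isoBot.inv.left ≫ colimit.ι (tw.F ⋙ Over.forget T) ⊥

/-- The map from the total object of a tower to the base. -/
def proj : tw.total ⟶ T :=
  colimit.desc (tw.F ⋙ Over.forget T) (Cocone.mk T { app j := (tw.F.obj j).hom })

/-- The presented complex given by a tower. -/
def complex : PresentedComplex I J tw.map where
  F := tw.F ⋙ Over.forget T
  isoBot := (Over.forget T).mapIso tw.isoBot
  isWellOrderContinuous := by
    have := tw.cont
    have := preservesWellOrderContinuousOfShape_of_preservesColimits (Over.forget T) J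
    infer_instance
  incl := (colimit.cocone (tw.F ⋙ Over.forget T)).ι
  isColimit := colimit.isColimit _
  attachCells j hj := (d j (tw.F.obj j)).attachCells.ofArrowIso
    (Arrow.isoMk (Iso.refl _) ((Over.forget T).mapIso (tw.isoSucc j hj).symm) (by
      have h := congrArg CommaMorphism.left (tw.map_succ j hj)
      exact (Category.id_comp _).trans h))

theorem incl_proj (j : J) : tw.complex.incl.app j ≫ tw.proj = (tw.F.obj j).hom :=
  colimit.ι_desc (F := tw.F ⋙ Over.forget T) (Cocone.mk T { app j := (tw.F.obj j).hom }) j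

theorem map_proj : tw.map ≫ tw.proj = X₀.hom := by
  refine (Category.assoc _ _ _).trans ?_
  refine (congrArg (tw.isoBot.inv.left ≫ ·) (tw.incl_proj ⊥)).trans ?_
  exact Over.w tw.isoBot.inv

theorem attachingMap_complex (j : J) (hj : ¬ IsMax j) (i : (d j (tw.F.obj j)).ι) :
    attachingMap (tw.complex.attachCells j hj) i = (d j (tw.F.obj j)).a i := by
  refine Eq.trans ?_ ((d j (tw.F.obj j)).attachingMap_attachCells i)
  exact congrArg (_ ≫ ·) (Category.comp_id _)

theorem characteristicMap_complex (j : J) (hj : ¬ IsMax j) (i : (d j (tw.F.obj j)).ι) :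
    characteristicMap (tw.complex.attachCells j hj) i ≫
      (tw.F.obj (Order.succ j)).hom = (d j (tw.F.obj j)).b i := by
  refine Eq.trans ?_ ((d j (tw.F.obj j)).characteristicMap_attachCells i)
  have h := Over.w (tw.isoSucc j hj).inv
  rw [← h]
  have aux : ∀ {A B D E G : C} (x : A ⟶ B) (y : B ⟶ D) (e : D ⟶ E) (w : E ⟶ G),
      (x ≫ (y ≫ e)) ≫ w = (x ≫ y) ≫ (e ≫ w) := by
    intros
    simp
  exact aux _ _ _ _

theorem characteristicMap_complex_proj (j : J) (hj : ¬ IsMax j) (i : (d j (tw.F.obj j)).ι) :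
    characteristicMap (tw.complex.attachCells j hj) i ≫
      tw.complex.incl.app (Order.succ j) ≫ tw.proj = (d j (tw.F.obj j)).b i := by
  rw [incl_proj]
  exact tw.characteristicMap_complex j hj i

end Tower

end Towers

end HirschhornModel

/-! ### Smallness bounds and extension along transfinite compositions. -/

namespace HirschhornModel

section Cardinals

theorem exists_cardinal_forall_le {ι : Type*} [Small.{v} ι] (κ : ι → Cardinal.{v}) :
    ∃ μ : Cardinal.{v}, Cardinal.aleph0 ≤ μ ∧ ∀ i, κ i ≤ μ := by
  have h : BddAbove (Set.range κ) := Cardinal.bddAbove_of_small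
  obtain ⟨μ, hμ⟩ := h
  exact ⟨max Cardinal.aleph0 μ, le_max_left _ _, fun i => (hμ ⟨i, rfl⟩).trans (le_max_right _ _)⟩

theorem exists_upper_bound {μ : Cardinal.{v}} (hμ : μ.IsRegular) {ι : Type v}
    (hι : Cardinal.mk ι < μ) (j : ι → μ.ord.ToType) : ∃ k, ∀ i, j i ≤ k := by
  have : Fact μ.IsRegular := ⟨hμ⟩
  have hι' : HasCardinalLT ι μ := by rwa [hasCardinalLT_iff_cardinal_mk_lt]
  exact ⟨IsCardinalFiltered.max j hι', fun i => leOfHom (IsCardinalFiltered.toMax j hι' i)⟩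

theorem isFiltered_toType {μ : Cardinal.{v}} (hμ : μ.IsRegular) : IsFiltered μ.ord.ToType := by
  have : Fact μ.IsRegular := ⟨hμ⟩
  exact isFiltered_of_isCardinalFiltered _ μ

/-- The least element of a regular cardinal. -/
@[reducible]
def orderBotToType {μ : Cardinal.{v}} (hμ : μ.IsRegular) : OrderBot μ.ord.ToType :=
  have := Cardinal.nonempty_ord_toType hμ.ne_zero
  WellFoundedLT.toOrderBot _

end Cardinals

section Smallness

variable {C : Type u} [Category.{v} C]

theorem exists_factor_of_preservesColimit {J : Type*} [Category* J] {F : J ⥤ C} {c : Cocone F}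
    (hc : IsColimit c) {W : C} [PreservesColimit F (coyoneda.obj (Opposite.op W))]
    (w : W ⟶ c.pt) : ∃ j, ∃ y : W ⟶ F.obj j, y ≫ c.ι.app j = w :=
  Types.jointly_surjective_of_isColimit (isColimitOfPreserves (coyoneda.obj (Opposite.op W)) hc) w

/-- When the legs are monomorphisms, two maps to a stage that agree in the colimit agree already, so
the injectivity half of the preservation is automatic. -/
theorem preservesColimit_of_exists_factor {J : Type v} [SmallCategory J] [IsFiltered J] {F : J ⥤ C}
    {c : Cocone F} (hc : IsColimit c) (hm : ∀ j, Mono (c.ι.app j)) {W : C}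
    (h : ∀ w : W ⟶ c.pt, ∃ j, ∃ y : W ⟶ F.obj j, y ≫ c.ι.app j = w) :
    PreservesColimit F (coyoneda.obj (Opposite.op W)) := by
  refine preservesColimit_of_preserves_colimit_cocone hc
    (Types.FilteredColimit.isColimitOf' _ _ (fun w => ?_) fun i x y hxy => ?_)
  · obtain ⟨j, y, hy⟩ := h w
    exact ⟨j, y, hy.symm⟩
  · exact ⟨i, 𝟙 i, by
      have := hm i
      have h' : x ≫ c.ι.app i = y ≫ c.ι.app i := hxy
      rw [(cancel_mono _).1 h']⟩

variable {I : MorphismProperty C}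

theorem relCells_le_llp_rlp (I : MorphismProperty C) : relCells I ≤ I.rlp.llp :=
  (MorphismProperty.le_retracts _).trans
    (MorphismProperty.retracts_transfiniteComposition_pushouts_coproducts_le_llp_rlp I)

theorem PresentedComplex.map_mem_relCells {J : Type v} [LinearOrder J] [OrderBot J] [SuccOrder J]
    [WellFoundedLT J] {X Y : C} {f : X ⟶ Y} (c : PresentedComplex I J f) (j : J)
    (hj : ¬ IsMax j) : relCells I (c.F.map (homOfLE (Order.le_succ j))) := by
  refine MorphismProperty.le_transfiniteCompositions _ _ ?_
  have h := (c.attachCells j hj).pushouts_coproducts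
  rwa [MorphismProperty.ofHoms_homFamily] at h

/-- A regular cardinal beyond which all the domains of the maps of `I` are small relative to
relative `I`-cell complexes. -/
theorem exists_smallness_bound [MorphismProperty.IsSmall.{v} I]
    (hI : ∀ ⦃A B : C⦄ (f : A ⟶ B), I f → IsSmallRelTo A (relCells I)) :
    ∃ κ : Cardinal.{v}, Cardinal.aleph0 ≤ κ ∧ ∀ μ : Cardinal.{v}, μ.IsRegular → κ ≤ μ →
      ∀ F : μ.ord.ToType ⥤ C, F.IsWellOrderContinuous →
        (∀ j, relCells I (F.map (homOfLE (Order.le_succ j)))) →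
        ∀ ⦃A B : C⦄ (f : A ⟶ B), I f → PreservesColimit F (coyoneda.obj (Opposite.op A)) := by
  choose κ hκ using fun f : I.toSet => hI f.1.hom f.2
  obtain ⟨μ, hμ, hμ'⟩ := exists_cardinal_forall_le κ
  exact ⟨μ, hμ, fun ν hν hμν F hF hF' A B f hf =>
    hκ ⟨Arrow.mk f, hf⟩ ν hν ((hμ' _).trans hμν) F hF hF'⟩

/-- A common bound `κ` for the small set of domains exists, and its successor is a regular cardinal,
which serves as the length of the small object argument. -/
theorem hasSmallObjectArgument [HasColimits C] [MorphismProperty.IsSmall.{v} I]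
    (hI : ∀ ⦃A B : C⦄ (f : A ⟶ B), I f → IsSmallRelTo A (relCells I)) :
    MorphismProperty.HasSmallObjectArgument.{v} I := by
  obtain ⟨κ, h₀, hκ⟩ := exists_smallness_bound hI
  have hμ : (Order.succ κ).IsRegular := Cardinal.isRegular_succ h₀
  refine ⟨⟨Order.succ κ, ⟨hμ⟩, orderBotToType hμ, ?_⟩⟩
  have : Fact (Order.succ κ).IsRegular := ⟨hμ⟩
  let := orderBotToType hμ
  have : NoMaxOrder (Order.succ κ).ord.ToType := Cardinal.noMaxOrder hμ.aleph0_le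
  exact
    { preservesColimit := fun i hi f hf => hκ _ hμ (Order.le_succ _) hf.F inferInstance
        (fun j => PresentedComplex.map_mem_relCells hf j (not_isMax j)) i hi }

end Smallness

section Extension

variable {C : Type u} [Category.{v} C] {J : Type v} [LinearOrder J] [OrderBot J] [SuccOrder J]
  [WellFoundedLT J]

/-- Extension of maps along a transfinite composition. -/
theorem exists_extension {X Y : C} {f : X ⟶ Y} (c : TransfiniteCompositionOfShape J f) {E : C}
    (Q : ∀ j, (c.F.obj j ⟶ E) → Prop)
    (restrict : ∀ i j (h : i ≤ j) e, Q j e → Q i (c.F.map (homOfLE h) ≫ e))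
    (step : ∀ j, ¬ IsMax j → ∀ e, Q j e →
      ∃ e', c.F.map (homOfLE (Order.le_succ j)) ≫ e' = e ∧ Q (Order.succ j) e')
    (limit : ∀ j, Order.IsSuccLimit j → ∀ e,
      (∀ i (h : i < j), Q i (c.F.map (homOfLE h.le) ≫ e)) → Q j e)
    (e₀ : c.F.obj ⊥ ⟶ E) (h₀ : Q ⊥ e₀) :
    ∃ q : Y ⟶ E, (∀ j, Q j (c.incl.app j ≫ q)) ∧ c.incl.app ⊥ ≫ q = e₀ := by
  -- The admissible partial extensions form an inverse system over `J`. Restriction is surjective at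
  -- successors by `step`, and at limits compatible families glue, so the projection from the full
  -- sections to the stage `⊥` is surjective.
  let P : Jᵒᵖ ⥤ Type v :=
    { obj j := {e : c.F.obj j.unop ⟶ E // Q j.unop e}
      map g := ↾fun e => ⟨c.F.map g.unop ≫ e.1, restrict _ _ (leOfHom g.unop) _ e.2⟩
      map_id j := by
        ext e
        exact (congrArg (· ≫ e.1) (c.F.map_id _)).trans (Category.id_comp _)
      map_comp g h := by
        ext e
        exact (congrArg (· ≫ e.1) (c.F.map_comp _ _)).trans (Category.assoc _ _ _) }
  have d : P.WellOrderInductionData := .ofExists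
    (fun j hj e => by
      obtain ⟨e', he', hQ⟩ := step j hj e.1 e.2
      exact ⟨⟨e', hQ⟩, Subtype.ext he'⟩)
    (fun j hj x => by
      have hx : ∀ i i' (hi : i ≤ i') (hi' : i' < j), c.F.map (homOfLE hi) ≫
          (x.1 (Opposite.op ⟨i', hi'⟩)).1 = (x.1 (Opposite.op ⟨i, hi.trans_lt hi'⟩)).1 := by
        intro i i' hi hi'
        have h := x.2 (Quiver.Hom.op (homOfLE hi :
          (⟨i, hi.trans_lt hi'⟩ : Set.Iio j) ⟶ ⟨i', hi'⟩))
        exact congrArg Subtype.val h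
      obtain ⟨q, hq⟩ := exists_desc_of_isSuccLimit c.F hj
        (fun i hi => (x.1 (Opposite.op ⟨i, hi⟩)).1) hx
      refine ⟨⟨q, limit j hj q fun i hi => ?_⟩, fun i hi => Subtype.ext (hq i hi)⟩
      rw [hq i hi]
      exact (x.1 (Opposite.op ⟨i, hi⟩)).2)
  obtain ⟨s, hs⟩ := d.surjective ⟨e₀, h₀⟩
  obtain ⟨q, hq⟩ := exists_desc_total c (fun j => (s.1 (Opposite.op j)).1) fun i i' hi =>
    congrArg Subtype.val (s.2 (homOfLE hi).op)
  refine ⟨q, fun j => ?_, ?_⟩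
  · rw [hq]
    exact (s.1 (Opposite.op j)).2
  · rw [hq]
    exact congrArg Subtype.val hs

end Extension

end HirschhornModel

/-! ### Accessible objects and maps to them from compact objects. -/

namespace HirschhornModel

section Accessibility

variable {C : Type u} [Category.{v} C]

/-- A family of monomorphisms with target `T`. -/
structure MonoFamily (T : C) where
  Λ : Type v
  obj : Λ → C
  map (a : Λ) : obj a ⟶ T
  mono (a : Λ) : Mono (map a)

attribute [instance] MonoFamily.mono

variable {T : C}

namespace MonoFamily

variable (Z : MonoFamily T)

/-- A map to `T` is good if it factors through a member of the family. -/
def Good {W : C} (w : W ⟶ T) : Prop := ∃ a, ∃ y : W ⟶ Z.obj a, y ≫ Z.map a = w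

/-- Every set of at most `γ` members of the family has an upper bound. -/
def Directed (γ : Cardinal.{v}) : Prop :=
  ∀ (ι : Type v), Cardinal.mk ι ≤ γ → ∀ a : ι → Z.Λ, ∃ b, ∀ i, ∃ y, y ≫ Z.map b = Z.map (a i)

variable {Z}

theorem Good.comp {W W' : C} (k : W' ⟶ W) {w : W ⟶ T} (h : Z.Good w) : Z.Good (k ≫ w) := by
  obtain ⟨a, y, rfl⟩ := h
  exact ⟨a, k ≫ y, Category.assoc _ _ _⟩

variable (Z) in
/-- The map `p` has liftings for the squares from `P` whose bottom map is good. -/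
def LiftsGood (P : MorphismProperty C) {E : C} (p : E ⟶ T) : Prop :=
  ∀ ⦃A B : C⦄ (g : A ⟶ B), P g → ∀ (a : A ⟶ E) (b : B ⟶ T), a ≫ p = g ≫ b → Z.Good b →
    ∃ l : B ⟶ E, g ≫ l = a ∧ l ≫ p = b

/-- Every map that factors through `Z.map i` is good, so the pullback of `p` along `Z.map i` has the
right lifting property against `I`, hence against its saturation. A square with good bottom map
factors through such a pullback. -/
theorem LiftsGood.llp_rlp [HasPullbacks C] {I : MorphismProperty C} {E : C} {p : E ⟶ T}
    (h : Z.LiftsGood I p) : Z.LiftsGood I.rlp.llp p := by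
  rintro A B g hg a _ hab ⟨i, y, rfl⟩
  have hp : I.rlp (pullback.snd p (Z.map i)) := by
    intro A' B' f hf
    refine ⟨fun {s t} sq => ?_⟩
    obtain ⟨l, hl, hl'⟩ := h f hf (s ≫ pullback.fst _ _) (t ≫ Z.map i)
      (by rw [Category.assoc, pullback.condition, sq.w_assoc]) ⟨i, t, rfl⟩
    refine ⟨⟨⟨pullback.lift l t hl', ?_, pullback.lift_snd _ _ _⟩⟩⟩
    apply pullback.hom_ext
    · rw [Category.assoc, pullback.lift_fst, hl]
    · rw [Category.assoc, pullback.lift_snd, sq.w]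
  have sq : CommSq (pullback.lift a (g ≫ y) (by simpa using hab)) g (pullback.snd p (Z.map i)) y :=
    ⟨pullback.lift_snd _ _ _⟩
  have := hg _ hp
  refine ⟨sq.lift ≫ pullback.fst _ _, ?_, ?_⟩
  · rw [sq.fac_left_assoc, pullback.lift_fst]
  · rw [Category.assoc, pullback.condition, sq.fac_right_assoc]

end MonoFamily

/-- The object `T` is built from `X` by attaching maps in `P` along maps that are good for `Z`,
as far as the existence of sections is concerned. -/
structure Accessible (P : MorphismProperty C) (Z : MonoFamily T) {X : C} (x : X ⟶ T) : Prop where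
  good : Z.Good x
  exists_section {E : C} (p : E ⟶ T) (hp : Z.LiftsGood P p) (e : X ⟶ E) (he : e ≫ p = x) :
    ∃ σ : T ⟶ E, σ ≫ p = 𝟙 T

/-- A section is built from partial sections by `exists_extension`. At limit stages, lying over the
inclusion is inherited from the earlier stages, so only the successor step has content. -/
theorem accessible_of_transfiniteComposition {J : Type v} [LinearOrder J] [OrderBot J]
    [SuccOrder J] [WellFoundedLT J] {P : MorphismProperty C} {Z : MonoFamily T} {X : C} {x : X ⟶ T}
    (hx : Z.Good x) (c : TransfiniteCompositionOfShape J x)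
    (step : ∀ j, ¬ IsMax j → ∀ (E : C) (p : E ⟶ T), Z.LiftsGood P p → ∀ e : c.F.obj j ⟶ E,
      e ≫ p = c.incl.app j → ∃ e' : c.F.obj (Order.succ j) ⟶ E,
        c.F.map (homOfLE (Order.le_succ j)) ≫ e' = e ∧ e' ≫ p = c.incl.app (Order.succ j)) :
    Accessible P Z x where
  good := hx
  exists_section {E} p hp e he := by
    obtain ⟨q, hq, -⟩ := exists_extension c (fun j e => e ≫ p = c.incl.app j)
      (fun i j h e hQ => by rw [Category.assoc, hQ, map_incl])
      (fun j hj e hQ => step j hj E p hp e hQ)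
      (fun j hj e hQ => hom_ext_of_isSuccLimit c.F hj fun i hi => by
        rw [← Category.assoc, hQ i hi, map_incl])
      (c.isoBot.hom ≫ e) (by rw [Category.assoc, he, isoBot_hom_comp])
    refine ⟨q, c.isColimit.hom_ext fun j => ?_⟩
    exact ((Category.assoc _ _ _).symm.trans (hq j)).trans (Category.comp_id _).symm

/-- The cells from `I` over `T` whose projection to `T` satisfies `G`. -/
def cellsOver (I : MorphismProperty C) [MorphismProperty.IsSmall.{v} I]
    (G : ∀ ⦃B : C⦄, (B ⟶ T) → Prop) (X : Over T) : CellData I X where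
  ι := Shrink.{v} {x : Σ f : I.toSet, (f.1.left ⟶ X.left) × (f.1.right ⟶ T) //
    x.2.1 ≫ X.hom = x.1.1.hom ≫ x.2.2 ∧ G x.2.2}
  π i := ((equivShrink _).symm i).1.1
  a i := ((equivShrink _).symm i).1.2.1
  b i := ((equivShrink _).symm i).1.2.2
  w i := ((equivShrink _).symm i).2.1

theorem cellsOver_good (I : MorphismProperty C) [MorphismProperty.IsSmall.{v} I]
    (G : ∀ ⦃B : C⦄, (B ⟶ T) → Prop) (X : Over T) (i : (cellsOver I G X).ι) :
    G ((cellsOver I G X).b i) :=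
  ((equivShrink _).symm i).2.2

section Tower

variable [HasColimits C] {I : MorphismProperty C} [MorphismProperty.IsSmall.{v} I]
  {J : Type v} [LinearOrder J] [OrderBot J] [SuccOrder J] [WellFoundedLT J]

/-- This is the small object argument: `a` factors through a stage `k`, and at stage `max j k` the
given square is one of the cells attached, so its characteristic map is the lift. Monotonicity of
`G` ensures that the cell is still admitted at this later stage. -/
theorem Tower.exists_lift [NoMaxOrder J] {G : J → ∀ ⦃B : C⦄, (B ⟶ T) → Prop}
    (hG : ∀ i j, i ≤ j → ∀ ⦃B : C⦄ (b : B ⟶ T), G i b → G j b) {X₀ : Over T}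
    (tw : Tower X₀ (fun j X => cellsOver I (G j) X))
    (hI : ∀ ⦃A B : C⦄ (f : A ⟶ B), I f → PreservesColimit tw.complex.F
      (coyoneda.obj (Opposite.op A)))
    {A B : C} (f : A ⟶ B) (hf : I f) (a : A ⟶ tw.total) (b : B ⟶ T) (j : J) (hb : G j b)
    (hab : a ≫ tw.proj = f ≫ b) : ∃ l : B ⟶ tw.total, f ≫ l = a ∧ l ≫ tw.proj = b := by
  have := hI f hf
  obtain ⟨k, a', ha'⟩ := exists_factor_of_preservesColimit tw.complex.isColimit a
  let m := max j k
  have key : ∀ x : {x : Σ f : I.toSet, (f.1.left ⟶ (tw.F.obj m).left) × (f.1.right ⟶ T) //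
      x.2.1 ≫ (tw.F.obj m).hom = x.1.1.hom ≫ x.2.2 ∧ G m x.2.2},
      ∃ l : x.1.1.1.right ⟶ tw.total, x.1.1.1.hom ≫ l = x.1.2.1 ≫ tw.complex.incl.app m ∧
        l ≫ tw.proj = x.1.2.2 := by
    intro x
    obtain ⟨i, rfl⟩ := (equivShrink _).symm.surjective x
    refine ⟨characteristicMap (tw.complex.attachCells m (not_isMax m)) i ≫
      tw.complex.incl.app (Order.succ m), ?_, ?_⟩
    · have h := attachingMap_comp (tw.complex.attachCells m (not_isMax m)) i
      rw [tw.attachingMap_complex m (not_isMax m) i] at h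
      refine (Category.assoc _ _ _).symm.trans ?_
      refine (congrArg (· ≫ tw.complex.incl.app (Order.succ m)) h.symm).trans ?_
      refine (Category.assoc _ _ _).trans ?_
      rw [map_incl]
      rfl
    · refine (Category.assoc _ _ _).trans ?_
      exact tw.characteristicMap_complex_proj m (not_isMax m) i
  have ha : (a' ≫ tw.complex.F.map (homOfLE (le_max_right j k))) ≫ tw.complex.incl.app m = a := by
    rw [Category.assoc, map_incl]
    exact ha'
  obtain ⟨l, hl, hl'⟩ := key ⟨⟨⟨Arrow.mk f, hf⟩,
    a' ≫ tw.complex.F.map (homOfLE (le_max_right j k)), b⟩, by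
      rw [← tw.incl_proj]
      refine (Category.assoc _ _ _).symm.trans ?_
      exact (congrArg (· ≫ tw.proj) ha).trans hab, hG _ _ (le_max_left _ _) _ hb⟩
  exact ⟨l, hl.trans ha, hl'⟩

end Tower

/-- The object `W` is compact relative to `I`, with bound `γ`. -/
def CompactWith (γ : Cardinal.{v}) (W : C) (I : MorphismProperty C) : Prop :=
  ∀ (J : Type v) [LinearOrder J] [OrderBot J] [SuccOrder J]
    [WellFoundedLT J] (X Y : C) (f : X ⟶ Y) (c : PresentedComplex I J f) (g : W ⟶ Y),
    ∃ (Z : C) (h : X ⟶ Z) (c' : PresentedComplex I J h) (i : Subcomplex c' c),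
      Cardinal.mk c'.Cells ≤ γ ∧ ∃ g' : W ⟶ Z, g' ≫ i.inclusion = g

theorem CompactWith.mono {γ γ' : Cardinal.{v}} (hγ : γ ≤ γ') {W : C} {I : MorphismProperty C}
    (h : CompactWith γ W I) : CompactWith γ' W I := by
  intro J _ _ _ _ X Y f c g
  obtain ⟨Z, h, c', i, hc, hg⟩ := h J X Y f c g
  exact ⟨Z, h, c', i, hc.trans hγ, hg⟩

theorem Subcomplex.incl_inclusion {I : MorphismProperty C} {J : Type v} [LinearOrder J] [OrderBot J]
    [SuccOrder J] [WellFoundedLT J] {X Y Z : C} {f : X ⟶ Y} {h : X ⟶ Z}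
    {c' : PresentedComplex I J h} {c : PresentedComplex I J f} (i : Subcomplex c' c) (j : J) :
    c'.incl.app j ≫ i.inclusion = i.seq.app j ≫ c.incl.app j :=
  c'.isColimit.fac _ j

theorem Subcomplex.comp_inclusion {I : MorphismProperty C} {J : Type v} [LinearOrder J]
    [OrderBot J] [SuccOrder J] [WellFoundedLT J] {X Y Z : C} {f : X ⟶ Y} {h : X ⟶ Z}
    {c' : PresentedComplex I J h} {c : PresentedComplex I J f} (i : Subcomplex c' c) :
    h ≫ i.inclusion = f := by
  have h₁ := i.incl_inclusion ⊥
  have h₂ := i.seq_bot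
  calc h ≫ i.inclusion = (c'.isoBot.inv ≫ c'.incl.app ⊥) ≫ i.inclusion := by
        congr 1
        exact c'.fac.symm
    _ = (c'.isoBot.inv ≫ i.seq.app ⊥) ≫ c.incl.app ⊥ := by
        refine (Category.assoc _ _ _).trans ?_
        refine (congrArg (c'.isoBot.inv ≫ ·) h₁).trans ?_
        exact (Category.assoc _ _ _).symm
    _ = f := by
        rw [h₂]
        exact c.fac

theorem Subcomplex.characteristicMap_inclusion {I : MorphismProperty C} {J : Type v} [LinearOrder J]
    [OrderBot J] [SuccOrder J] [WellFoundedLT J] {X Y Z : C} {f : X ⟶ Y} {h : X ⟶ Z}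
    {c' : PresentedComplex I J h} {c : PresentedComplex I J f} (i : Subcomplex c' c) (j : J)
    (hj : ¬ IsMax j) (k : (c'.attachCells j hj).ι) :
    characteristicMap (c'.attachCells j hj) k ≫ c'.incl.app (Order.succ j) ≫ i.inclusion =
      eqToHom (congrArg (fun e => e.1.right) (i.cell_type j hj k)) ≫
        characteristicMap (c.attachCells j hj) (i.cell j hj k) ≫ c.incl.app (Order.succ j) := by
  rw [i.incl_inclusion, ← Category.assoc, i.characteristic, Category.assoc]

/-- The base and each of the at most `γ` cells factor through members of the family, and
directedness gives one member `b` for all of them (the index `Option c.Cells` adds the base to the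
cells). The factorizations glue because `Z.map b` is a monomorphism. -/
theorem good_of_cells_good {I : MorphismProperty C} {γ : Cardinal.{v}} (hγ : Cardinal.aleph0 ≤ γ)
    {Z : MonoFamily T} (hZ : Z.Directed γ) {J : Type v} [LinearOrder J] [OrderBot J] [SuccOrder J]
    [WellFoundedLT J] {X Y : C} {f : X ⟶ Y} (c : PresentedComplex I J f)
    (hc : Cardinal.mk c.Cells ≤ γ) (β : Y ⟶ T) (h₀ : Z.Good (f ≫ β))
    (h : ∀ j hj i, Z.Good
      (characteristicMap (c.attachCells j hj) i ≫ c.incl.app (Order.succ j) ≫ β)) :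
    Z.Good β := by
  choose a y hy using fun k : c.Cells => h k.j k.hj k.k
  obtain ⟨a₀, y₀, hy₀⟩ := h₀
  obtain ⟨b, hb⟩ := hZ (Option c.Cells) (by
    rw [Cardinal.mk_option]
    exact Cardinal.add_le_of_le hγ hc (Cardinal.one_lt_aleph0.le.trans hγ))
    (fun k => k.elim a₀ a)
  have hn : ∃ k, k ≫ Z.map b = Z.map a₀ := hb none
  have hs : ∀ k, ∃ l, l ≫ Z.map b = Z.map (a k) := fun k => hb (some k)
  obtain ⟨q, hq⟩ := PresentedComplex.exists_factor c β (Z.map b)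
    (by
      obtain ⟨k, hk⟩ := hn
      exact ⟨y₀ ≫ k, by rw [Category.assoc, hk, hy₀]⟩)
    (fun j hj k => by
      obtain ⟨l, hl⟩ := hs ⟨j, hj, k⟩
      refine ⟨y ⟨j, hj, k⟩ ≫ l, ?_⟩
      rw [Category.assoc, hl]
      exact hy ⟨j, hj, k⟩)
  exact ⟨b, q, hq⟩

/-- A map from a compact object to an accessible object is good. -/
theorem good_of_compactWith [HasColimits C] [HasPullbacks C] {I : MorphismProperty C}
    [MorphismProperty.IsSmall.{v} I]
    (hI : ∀ ⦃A B : C⦄ (f : A ⟶ B), I f → IsSmallRelTo A (relCells I)) {γ : Cardinal.{v}}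
    (hγ : Cardinal.aleph0 ≤ γ) {Z : MonoFamily T} (hZ : Z.Directed γ) {X : C} {x : X ⟶ T}
    (hx : Accessible I.rlp.llp Z x) {W : C} (hW : CompactWith γ W I) (w : W ⟶ T) : Z.Good w := by
  obtain ⟨κ, h₀, hκ⟩ := exists_smallness_bound hI
  have hμ : (Order.succ κ).IsRegular := Cardinal.isRegular_succ h₀
  let := orderBotToType hμ
  have : NoMaxOrder (Order.succ κ).ord.ToType := Cardinal.noMaxOrder hμ.aleph0_le
  -- At every stage all cells of `I` over `T` with good projection are attached. The result is a
  -- presented complex over `T`, whether or not `T` is one itself.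
  obtain ⟨tw⟩ := nonempty_stagedIteration (J := (Order.succ κ).ord.ToType) (Over.mk x)
    (fun _ X => (cellsOver I (fun _ b => Z.Good b) X).attach)
    (fun _ X => (cellsOver I (fun _ b => Z.Good b) X).incl)
  let tw : Tower (Over.mk x) (fun _ X => cellsOver I (fun _ b => Z.Good b) X) := tw
  have hp : Z.LiftsGood I tw.proj := fun A B f hf a b hab hb =>
    tw.exists_lift (G := fun _ _ b => Z.Good b) (fun _ _ _ _ _ h => h)
      (fun A B f hf => hκ _ hμ (Order.le_succ _) tw.complex.F inferInstance
        (fun j => PresentedComplex.map_mem_relCells _ j (not_isMax j)) f hf) f hf a b ⊥ hb hab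
  -- Accessibility turns the liftings for good squares into a section, along which `w` is moved into
  -- the tower, where compactness of `W` applies.
  obtain ⟨σ, hσ⟩ := hx.exists_section tw.proj hp.llp_rlp tw.map tw.map_proj
  obtain ⟨Y, h, c', i, hc, g, hg⟩ := hW _ _ _ _ tw.complex (w ≫ σ)
  have hgood : ∀ j hj k, Z.Good (characteristicMap (c'.attachCells j hj) k ≫
      c'.incl.app (Order.succ j) ≫ i.inclusion ≫ tw.proj) := by
    intro j hj k
    have h₁ := i.characteristicMap_inclusion j hj k
    have h₂ := cellsOver_good I (fun _ b => Z.Good b) (tw.F.obj j) (i.cell j hj k)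
    rw [← tw.characteristicMap_complex_proj j hj (i.cell j hj k)] at h₂
    have h₃ := h₂.comp (eqToHom (congrArg (fun e => e.1.right) (i.cell_type j hj k)))
    have h₄ := congrArg (· ≫ tw.proj) h₁
    simp only [Category.assoc] at h₄
    rw [h₄]
    exact h₃
  have hβ : Z.Good (i.inclusion ≫ tw.proj) := good_of_cells_good hγ hZ c' hc _ (by
    rw [reassoc_of% i.comp_inclusion]
    exact tw.map_proj ▸ hx.good) hgood
  have hw : (g ≫ i.inclusion) ≫ tw.proj = w := by
    rw [hg, Category.assoc, hσ, Category.comp_id]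
  rw [← hw, Category.assoc]
  exact hβ.comp g

end Accessibility

end HirschhornModel

/-! ### Relative compactness and smallness for maps in the saturation. -/

namespace HirschhornModel

section Small

variable {C : Type u} [Category.{v} C] [HasColimits C] {I : MorphismProperty C}
  [MorphismProperty.IsSmall.{v} I]

theorem exists_compactness_bound {ι : Type*} [Small.{v} ι] (W : ι → C)
    (hW : ∀ i, IsCompactRelTo (W i) I) : ∃ γ : Cardinal.{v}, ∀ i, CompactWith γ (W i) I := by
  choose γ hγ using hW
  obtain ⟨δ, -, hδ⟩ := exists_cardinal_forall_le γ
  exact ⟨δ, fun i => CompactWith.mono (hδ i) (hγ i)⟩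

/-- Maps in the saturation of a cellular `I` are relatively compact. -/
theorem exists_good_of_comp_good
    (hI : ∀ ⦃A B : C⦄ (f : A ⟶ B), I f → IsSmallRelTo A (relCells I)) [HasPullbacks C]
    (hc : ∀ ⦃A B : C⦄ (f : A ⟶ B), I f → IsCompactRelTo B I)
    {A B : C} (g : A ⟶ B) (hg : I.rlp.llp g) :
    ∃ δ : Cardinal.{v}, ∀ γ, δ ≤ γ → ∀ {T : C} {Z : MonoFamily T}, Z.Directed γ →
      ∀ {X : C} {x : X ⟶ T}, Accessible I.rlp.llp Z x → ∀ b : B ⟶ T, Z.Good (g ≫ b) →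
        Z.Good b := by
  have := hasSmallObjectArgument hI
  obtain ⟨γ₀, hγ₀⟩ := exists_compactness_bound (fun f : I.toSet => f.1.right)
    fun f => hc f.1.hom f.2
  let κ := I.smallObjectκ
  have : Fact κ.IsRegular :=
    MorphismProperty.HasSmallObjectArgument.exists_cardinal.choose_spec.choose
  let c : PresentedComplex I κ.ord.ToType (SmallObject.ιObj I κ g) :=
    SmallObject.relativeCellComplexιObj I κ g
  -- A lift in this square is a section of `πObj`, so `b` is good once `πObj ≫ b` is; the source of
  -- the latter is a relative cell complex on `A`.
  have sq : CommSq (SmallObject.ιObj I κ g) g (SmallObject.πObj I κ g) (𝟙 B) :=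
    ⟨by rw [SmallObject.ιObj_πObj, Category.comp_id]⟩
  have := hg _ (SmallObject.rlp_πObj I κ g)
  -- The bound must exceed both the compactness bounds of the codomains of `I`, so that each cell is
  -- good, and the number of cells of the complex, so that the cells have a common member.
  refine ⟨max Cardinal.aleph0 (max γ₀ (Cardinal.mk c.Cells)), fun γ hγ T Z hZ X x hx b hb => ?_⟩
  have h₁ : Cardinal.aleph0 ≤ γ := (le_max_left _ _).trans hγ
  have h₂ := (le_max_right _ _).trans hγ
  have h := good_of_cells_good h₁ hZ c ((le_max_right _ _).trans h₂)
    (SmallObject.πObj I κ g ≫ b) (by rwa [SmallObject.ιObj_πObj_assoc]) (fun j hj i =>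
      good_of_compactWith hI h₁ hZ hx
        ((hγ₀ ((c.attachCells j hj).π i)).mono ((le_max_left _ _).trans h₂)) _)
  have h' := h.comp sq.lift
  rwa [sq.fac_right_assoc, Category.id_comp] at h'

/-- Maps from `W` to the colimit of a long enough continuous chain of maps in `P` factor through
the chain. -/
def ChainSmall (W : C) (P : MorphismProperty C) : Prop :=
  ∃ κ : Cardinal.{v}, ∀ μ : Cardinal.{v}, μ.IsRegular → κ ≤ μ →
    ∀ F : μ.ord.ToType ⥤ C, F.IsWellOrderContinuous →
      (∀ j, P (F.map (homOfLE (Order.le_succ j)))) →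
        ∀ (c : Cocone F), IsColimit c → ∀ w : W ⟶ c.pt, ∃ j, ∃ y : W ⟶ F.obj j, y ≫ c.ι.app j = w

section

variable {μ : Cardinal.{v}} (hμ : μ.IsRegular) (F : μ.ord.ToType ⥤ C) [F.IsWellOrderContinuous]
  (c : Cocone F) (hc : IsColimit c)

/-- A chain with its colimit, as a transfinite composition. -/
def chainComposition [OrderBot μ.ord.ToType] (P : MorphismProperty C)
    (hF : ∀ j, P (F.map (homOfLE (Order.le_succ j)))) :
    P.TransfiniteCompositionOfShape μ.ord.ToType (c.ι.app ⊥) where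
  F := F
  isoBot := Iso.refl _
  incl := c.ι
  isColimit := hc
  fac := Category.id_comp _
  map_mem j _ := hF j

include hμ hc in
theorem mono_of_chain (Q : MorphismProperty C)
    [MorphismProperty.IsStableUnderTransfiniteComposition.{v} Q]
    (hQ : Q ≤ MorphismProperty.monomorphisms C)
    (hF : ∀ j, Q (F.map (homOfLE (Order.le_succ j)))) (j : μ.ord.ToType) : Mono (c.ι.app j) := by
  let := orderBotToType hμ
  exact hQ _ ((chainComposition F c hc Q hF).mem_incl_app j)

/-- The family of the objects of a chain, over its colimit. -/
def chainFamily (hm : ∀ j, Mono (c.ι.app j)) : MonoFamily c.pt where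
  Λ := μ.ord.ToType
  obj := F.obj
  map := c.ι.app
  mono := hm

include hμ in
theorem chainFamily_directed (hm : ∀ j, Mono (c.ι.app j)) {γ : Cardinal.{v}} (hγ : γ < μ) :
    (chainFamily F c hm).Directed γ := by
  intro ι hι a
  obtain ⟨b, hb⟩ := exists_upper_bound hμ (hι.trans_lt hγ) a
  exact ⟨b, fun i => ⟨F.map (homOfLE (hb i)), c.w _⟩⟩

include hc in
-- The step from `F.obj j` to `F.obj (succ j)` is in `P`, and the leg at `succ j` is good because it
-- factors through the member `succ j` by the identity.
theorem chainFamily_accessible [OrderBot μ.ord.ToType] (hm : ∀ j, Mono (c.ι.app j))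
    (P : MorphismProperty C) (hF : ∀ j, P (F.map (homOfLE (Order.le_succ j)))) :
    Accessible P (chainFamily F c hm) (c.ι.app ⊥) := by
  refine accessible_of_transfiniteComposition ⟨(⊥ : μ.ord.ToType), 𝟙 _, Category.id_comp _⟩
    (chainComposition F c hc P hF).toTransfiniteCompositionOfShape
    fun j hj E p hp e he => ?_
  exact hp _ (hF j) e (c.ι.app (Order.succ j)) (he.trans (c.w _).symm)
    ⟨(Order.succ j : μ.ord.ToType), 𝟙 _, Category.id_comp _⟩

end

theorem ChainSmall.isSmallRelTo {W : C} {P : MorphismProperty C} (h : ChainSmall W P)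
    (Q : MorphismProperty C) [MorphismProperty.IsStableUnderTransfiniteComposition.{v} Q]
    (hQ : Q ≤ MorphismProperty.monomorphisms C) (hPQ : P ≤ Q) : IsSmallRelTo W P := by
  obtain ⟨κ, hκ⟩ := h
  refine ⟨κ, fun μ hμ hκμ F hF hF' => ?_⟩
  have := isFiltered_toType hμ
  exact preservesColimit_of_exists_factor (colimit.isColimit F)
    (mono_of_chain hμ F _ (colimit.isColimit F) Q hQ fun j => hPQ _ (hF' j))
    (hκ μ hμ hκμ F hF hF' _ (colimit.isColimit F))

/-- An object that is small relative to the relative `I`-cell complexes is small relative to all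
maps in the saturation of `I`, if these are monomorphisms. -/
theorem IsSmallRelTo.chainSmall
    (hI : ∀ ⦃A B : C⦄ (f : A ⟶ B), I f → IsSmallRelTo A (relCells I)) [HasPullbacks C]
    (hm : I.rlp.llp ≤ MorphismProperty.monomorphisms C) {W : C}
    (hW : IsSmallRelTo W (relCells I)) : ChainSmall W I.rlp.llp := by
  obtain ⟨κ, -, hκ⟩ := exists_smallness_bound hI
  obtain ⟨κ', hκ'⟩ := hW
  refine ⟨max κ κ', fun μ hμ hκμ F hF hF' c hc w => ?_⟩
  let := orderBotToType hμ
  have : NoMaxOrder μ.ord.ToType := Cardinal.noMaxOrder hμ.aleph0_le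
  have hmono : ∀ j, Mono (c.ι.app j) := mono_of_chain hμ F c hc I.rlp.llp hm hF'
  have hx := chainFamily_accessible F c hc hmono I.rlp.llp hF'
  -- The cells attached at stage `j` are those whose projection factors through `F.obj (succ j)`;
  -- this keeps each stage of the tower over the stage of the chain with the same index.
  let G : μ.ord.ToType → ∀ ⦃B : C⦄, (B ⟶ c.pt) → Prop :=
    fun j B b => ∃ y : B ⟶ F.obj (Order.succ j), y ≫ c.ι.app (Order.succ j) = b
  obtain ⟨tw⟩ := nonempty_stagedIteration (J := μ.ord.ToType) (Over.mk (c.ι.app ⊥))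
    (fun j X => (cellsOver I (G j) X).attach) (fun j X => (cellsOver I (G j) X).incl)
  let tw : Tower (Over.mk (c.ι.app ⊥)) (fun j X => cellsOver I (G j) X) := tw
  have hG : ∀ i j, i ≤ j → ∀ ⦃B : C⦄ (b : B ⟶ c.pt), G i b → G j b := by
    rintro i j hij B b ⟨y, rfl⟩
    exact ⟨y ≫ F.map (homOfLE (Order.succ_le_succ hij)), by rw [Category.assoc, c.w]⟩
  have hcells : ∀ j, relCells I (tw.complex.F.map (homOfLE (Order.le_succ j))) := fun j =>
    PresentedComplex.map_mem_relCells _ j (not_isMax j)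
  have hp : (chainFamily F c hmono).LiftsGood I tw.proj := by
    intro A B f hf a b hab hb
    obtain ⟨j, y, hy⟩ : ∃ j : μ.ord.ToType, ∃ y : B ⟶ F.obj j, y ≫ c.ι.app j = b := hb
    refine tw.exists_lift hG (fun A B f hf => hκ _ hμ ((le_max_left _ _).trans hκμ)
      tw.complex.F inferInstance hcells f hf) f hf a b j ?_ hab
    exact ⟨y ≫ F.map (homOfLE (Order.le_succ j)), by
      rw [Category.assoc, c.w]
      exact hy⟩
  obtain ⟨σ, hσ⟩ := hx.exists_section tw.proj hp.llp_rlp tw.map tw.map_proj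
  have := hκ' _ hμ ((le_max_right _ _).trans hκμ) tw.complex.F inferInstance hcells
  obtain ⟨j, y, hy⟩ := exists_factor_of_preservesColimit tw.complex.isColimit (w ≫ σ)
  -- Stage `j` of the tower maps to `F.obj j`, so a factorization of `w ≫ σ` through the tower
  -- yields one of `w` through the chain.
  obtain ⟨q, hq⟩ := PresentedComplex.exists_stage_factor tw.complex tw.proj F.obj c.ι.app
    (fun i j hij => ⟨F.map (homOfLE hij), c.w _⟩)
    ⟨𝟙 _, (Category.id_comp _).trans tw.map_proj.symm⟩
    (fun j hj _ i => by
      obtain ⟨y, hy⟩ := cellsOver_good I (G j) (tw.F.obj j) i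
      exact ⟨y, hy.trans (tw.characteristicMap_complex_proj j hj i).symm⟩) j
  refine ⟨j, y ≫ q, ?_⟩
  have h : (y ≫ tw.complex.incl.app j) ≫ tw.proj = w := by
    refine (congrArg (· ≫ tw.proj) hy).trans ?_
    rw [Category.assoc, hσ, Category.comp_id]
  rw [Category.assoc, hq, ← Category.assoc]
  exact h

end Small

end HirschhornModel

/-! ### Subcomplexes spanned by a set of cells. -/

namespace HirschhornModel

section Subcomplexes

variable {C : Type u} [Category.{v} C] {I : MorphismProperty C}
  {J : Type v} [LinearOrder J] [OrderBot J] [SuccOrder J] [WellFoundedLT J]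
  {X Y : C} {f : X ⟶ Y} (c : PresentedComplex I J f)

theorem PresentedComplex.incl_mem (j : J) : I.rlp.llp (c.incl.app j) :=
  relCells_le_llp_rlp I _
    (MorphismProperty.transfiniteCompositionsOfShape_le_transfiniteCompositions _ _ _
      ⟨(c.transfiniteCompositionOfShape.ici j).ofLE (by rw [MorphismProperty.ofHoms_homFamily])⟩)

variable (S : Set c.Cells)

/-- The cells in `S` at stage `j` whose attaching map factors through a given object over the total
object. -/
def subcomplexCells (j : J) (Z : Over Y) : CellData I Z where
  -- The set `S` is arbitrary: a cell of `S` whose attaching map does not factor through what has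
  -- been built is left out, so that every `S` spans a subcomplex.
  ι := {p : Σ h : PLift (¬ IsMax j), (c.attachCells j h.down).ι //
    (⟨j, p.1.down, p.2⟩ : c.Cells) ∈ S ∧
      ∃ y : _ ⟶ Z.left, y ≫ Z.hom = attachingMap (c.attachCells j p.1.down) p.2 ≫ c.incl.app j}
  π p := (c.attachCells j p.1.1.down).π p.1.2
  a p := p.2.2.choose
  b p := characteristicMap (c.attachCells j p.1.1.down) p.1.2 ≫ c.incl.app (Order.succ j)
  w p := by
    rw [p.2.2.choose_spec, ← attachingMap_comp_assoc, map_incl]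

variable [HasColimits C]

/-- The tower in which the cells in `S` are attached. -/
def subTower : Tower (Over.mk f) (subcomplexCells c S) :=
  (nonempty_stagedIteration _ _ _).some

/-- The stages of the tower of the cells in `S`, over the total object of `c`. -/
def subStage (j : J) : (subTower c S).complex.F.obj j ⟶ Y := ((subTower c S).F.obj j).hom

theorem incl_subTower_proj (j : J) :
    (subTower c S).complex.incl.app j ≫ (subTower c S).proj = subStage c S j :=
  (subTower c S).incl_proj j

theorem map_subStage {i j : J} (h : i ⟶ j) :
    (subTower c S).complex.F.map h ≫ subStage c S j = subStage c S i :=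
  Over.w ((subTower c S).F.map h)

variable (hm : I.rlp.llp ≤ MorphismProperty.monomorphisms C)

include hm in
theorem PresentedComplex.mono_incl (j : J) : Mono (c.incl.app j) := hm _ (c.incl_mem j)

include hm in
-- A cell of `S` enters the tower at the same stage as in `c`, so stage `j` of the tower lies over
-- stage `j` of `c`. The legs of `c` are monomorphisms, hence these factorizations will be
-- compatible without further choice.
theorem exists_subStage_factor (j : J) :
    ∃ s : (subTower c S).complex.F.obj j ⟶ c.F.obj j, s ≫ c.incl.app j = subStage c S j := by
  have := c.mono_incl hm
  obtain ⟨q, hq⟩ := PresentedComplex.exists_stage_factor (subTower c S).complex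
    (subTower c S).proj c.F.obj c.incl.app
    (fun i j hij => ⟨c.F.map (homOfLE hij), map_incl _ _⟩)
    ⟨c.isoBot.inv, by
      refine c.fac.trans ?_
      exact (subTower c S).map_proj.symm⟩
    (fun j hj _ i => ⟨characteristicMap (c.attachCells j hj) i.1.2,
      ((subTower c S).characteristicMap_complex_proj j hj i).symm⟩) j
  exact ⟨q, hq.trans (incl_subTower_proj c S j)⟩

/-- The map from a stage of the tower of the cells in `S` to the corresponding stage of `c`. -/
def subStageMap (j : J) : (subTower c S).complex.F.obj j ⟶ c.F.obj j :=
  (exists_subStage_factor c S hm j).choose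

theorem subStageMap_incl (j : J) : subStageMap c S hm j ≫ c.incl.app j = subStage c S j :=
  (exists_subStage_factor c S hm j).choose_spec

theorem subStageMap_map {i j : J} (h : i ⟶ j) :
    subStageMap c S hm i ≫ c.F.map h = (subTower c S).complex.F.map h ≫ subStageMap c S hm j := by
  have := c.mono_incl hm
  rw [← cancel_mono (c.incl.app j), Category.assoc, Category.assoc, map_incl, subStageMap_incl,
    subStageMap_incl, map_subStage]

theorem subStageMap_map_assoc {i j : J} (h : i ⟶ j) {Z : C} (g : c.F.obj j ⟶ Z) :
    subStageMap c S hm i ≫ c.F.map h ≫ g =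
      (subTower c S).complex.F.map h ≫ subStageMap c S hm j ≫ g := by
  rw [← Category.assoc, subStageMap_map, Category.assoc]

theorem subStageMap_attaching (j : J) (hj : ¬ IsMax j)
    (i : (subcomplexCells c S j ((subTower c S).F.obj j)).ι) :
    attachingMap ((subTower c S).complex.attachCells j hj) i ≫ subStageMap c S hm j =
      attachingMap (c.attachCells j hj) i.1.2 := by
  have := c.mono_incl hm
  refine (cancel_mono (c.incl.app j)).1 ((Category.assoc _ _ _).trans ?_)
  refine (congrArg (_ ≫ ·) (subStageMap_incl c S hm j)).trans ?_
  refine Eq.trans ?_ i.2.2.choose_spec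
  exact congrArg (· ≫ subStage c S j) ((subTower c S).attachingMap_complex j hj i)

theorem subStageMap_characteristic (j : J) (hj : ¬ IsMax j)
    (i : (subcomplexCells c S j ((subTower c S).F.obj j)).ι) :
    characteristicMap ((subTower c S).complex.attachCells j hj) i ≫
        subStageMap c S hm (Order.succ j) =
      characteristicMap (c.attachCells j hj) i.1.2 := by
  have := c.mono_incl hm
  refine (cancel_mono (c.incl.app _)).1 ((Category.assoc _ _ _).trans ?_)
  refine (congrArg (_ ≫ ·) (subStageMap_incl c S hm (Order.succ j))).trans ?_
  exact (subTower c S).characteristicMap_complex j hj i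

include hm in
/-- The tower of the cells in `S` is an inclusion in the saturation of `I`. -/
theorem subTower_proj_mem : I.rlp.llp (subTower c S).proj := by
  have := c.mono_incl hm
  intro E B p hp
  refine ⟨fun {u v} sq => ?_⟩
  let tw := subTower c S
  -- The lift is constructed over the stages of `c`; the partial lift at stage `j` is required to
  -- extend `u` from stage `j` of the tower.
  obtain ⟨q, hq, -⟩ := exists_extension c.toTransfiniteCompositionOfShape (E := E)
    (fun j e => subStageMap c S hm j ≫ e = tw.complex.incl.app j ≫ u ∧ e ≫ p = c.incl.app j ≫ v)
    (fun i j h e hQ => ⟨by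
      rw [subStageMap_map_assoc, hQ.1, map_incl_assoc], by
      rw [Category.assoc, hQ.2, map_incl_assoc]⟩)
    (fun j hj e hQ => by
      -- A cell of the tower receives the value prescribed by `u`; any other cell receives a lift
      -- against `p`. The prescribed value is expressed through an equation `i.1 = ⟨⟨hj⟩, k⟩`,
      -- because its domain depends on the cell.
      have key : ∀ k : (c.attachCells j hj).ι, ∃ y : ((c.attachCells j hj).π k).1.right ⟶ E,
          attachingMap (c.attachCells j hj) k ≫ e = ((c.attachCells j hj).π k).1.hom ≫ y ∧
          y ≫ p = characteristicMap (c.attachCells j hj) k ≫ c.incl.app (Order.succ j) ≫ v ∧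
          ∀ i : (subcomplexCells c S j (tw.F.obj j)).ι, ∀ hi : i.1 = ⟨⟨hj⟩, k⟩,
            characteristicMap (tw.complex.attachCells j hj) i ≫
              tw.complex.incl.app (Order.succ j) ≫ u =
              eqToHom (by
                change ((c.attachCells j hj).π i.1.2).1.right = _
                rw [hi]) ≫ y := by
        intro k
        by_cases hk : ∃ i : (subcomplexCells c S j (tw.F.obj j)).ι, i.1 = ⟨⟨hj⟩, k⟩
        · obtain ⟨⟨_, hi⟩, rfl⟩ := hk
          let i : (subcomplexCells c S j (tw.F.obj j)).ι := ⟨⟨⟨hj⟩, k⟩, hi⟩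
          refine ⟨characteristicMap (tw.complex.attachCells j hj) i ≫
              tw.complex.incl.app (Order.succ j) ≫ u, ?_, ?_, ?_⟩
          · have h₁ := subStageMap_attaching c S hm j hj i
            have h₂ := attachingMap_comp (tw.complex.attachCells j hj) i
            have h₃ := congrArg (· ≫ tw.complex.incl.app (Order.succ j) ≫ u) h₂
            have h₄ : attachingMap (tw.complex.attachCells j hj) i ≫
                tw.complex.incl.app j ≫ u = _ :=
              (congrArg (attachingMap (tw.complex.attachCells j hj) i ≫ ·)
                (map_incl_assoc tw.complex.toTransfiniteCompositionOfShape
                  (homOfLE (Order.le_succ j)) u).symm).trans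
                ((Category.assoc _ _ _).symm.trans h₃)
            refine (congrArg (· ≫ e) h₁.symm).trans ?_
            refine (Category.assoc _ _ _).trans ?_
            refine (congrArg (attachingMap (tw.complex.attachCells j hj) i ≫ ·) hQ.1).trans ?_
            exact h₄.trans (Category.assoc _ _ _)
          · have h₁ := tw.characteristicMap_complex_proj j hj i
            have h₂ := congrArg (· ≫ v) h₁
            have aux : ∀ {A₁ A₂ A₃ A₄ : C} (x : A₁ ⟶ A₂) (y : A₂ ⟶ A₃) {z : A₃ ⟶ E} {z' : A₃ ⟶ A₄}
                {z'' : A₄ ⟶ B}, z ≫ p = z' ≫ z'' → (x ≫ y ≫ z) ≫ p = (x ≫ y ≫ z') ≫ z'' := by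
              intro A₁ A₂ A₃ A₄ x y z z' z'' h
              simp [h]
            exact ((aux _ _ sq.w).trans h₂).trans (Category.assoc _ _ _)
          · intro i' hi'
            obtain rfl : i' = i := Subtype.ext hi'
            exact (Category.id_comp _).symm
        · have sq' : CommSq (attachingMap (c.attachCells j hj) k ≫ e)
              ((c.attachCells j hj).π k).1.hom p
              (characteristicMap (c.attachCells j hj) k ≫ c.incl.app (Order.succ j) ≫ v) :=
            ⟨by rw [Category.assoc, hQ.2, ← attachingMap_comp_assoc, map_incl_assoc]⟩
          have := hp _ ((c.attachCells j hj).π k).2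
          exact ⟨sq'.lift, sq'.fac_left.symm, sq'.fac_right, fun i hi => (hk ⟨i, hi⟩).elim⟩
      choose y hy₁ hy₂ hy₃ using key
      obtain ⟨e', he', he''⟩ := AttachCells.exists_desc (c.attachCells j hj) e y hy₁
      refine ⟨e', he', AttachCells.hom_ext' (tw.complex.attachCells j hj) ?_ fun i => ?_,
        AttachCells.hom_ext' (c.attachCells j hj) ?_ fun k => ?_⟩
      · rw [map_incl_assoc, ← hQ.1, ← he', subStageMap_map_assoc]
      · have h₁ := subStageMap_characteristic c S hm j hj i
        have h₂ := hy₃ i.1.2 i rfl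
        refine (Category.assoc _ _ _).symm.trans ?_
        refine (congrArg (· ≫ e') h₁).trans ?_
        refine (he'' i.1.2).trans ?_
        exact (h₂.trans (Category.id_comp _)).symm
      · rw [reassoc_of% he', hQ.2, map_incl_assoc]
      · rw [reassoc_of% (he'' k), hy₂])
    (fun j hj e hQ => ⟨hom_ext_of_isSuccLimit tw.complex.F hj fun i hi => by
        rw [map_incl_assoc, ← (hQ i hi).1, subStageMap_map_assoc],
      hom_ext_of_isSuccLimit c.F hj fun i hi => by
        rw [← Category.assoc, (hQ i hi).2, map_incl_assoc]⟩)
    (c.isoBot.hom ≫ tw.map ≫ u) (by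
      have h₀ : subStageMap c S hm ⊥ ≫ c.isoBot.hom = tw.complex.isoBot.hom := by
        rw [← cancel_mono c.isoBot.inv, Category.assoc, Iso.hom_inv_id, Category.comp_id,
          ← cancel_mono (c.incl.app ⊥), subStageMap_incl, Category.assoc]
        refine Eq.trans ?_ (congrArg (tw.complex.isoBot.hom ≫ ·) c.fac.symm)
        have h := isoBot_hom_comp tw.complex.toTransfiniteCompositionOfShape
        have h' := congrArg (· ≫ tw.proj) h
        refine Eq.trans ?_ ((h'.symm.trans (Category.assoc _ _ _)).trans ?_)
        · exact (incl_subTower_proj c S ⊥).symm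
        · exact congrArg (tw.complex.isoBot.hom ≫ ·) tw.map_proj
      refine ⟨?_, ?_⟩
      · rw [reassoc_of% h₀, isoBot_hom_comp_assoc]
      · rw [Category.assoc, Category.assoc, sq.w, ← isoBot_hom_comp_assoc]
        have h := tw.map_proj
        exact congrArg (c.isoBot.hom ≫ ·) ((Category.assoc _ _ _).symm.trans
          (congrArg (· ≫ v) h)))
  refine ⟨⟨⟨q, ?_, ?_⟩⟩⟩
  · refine tw.complex.isColimit.hom_ext fun j => ?_
    refine (Category.assoc _ _ _).symm.trans ?_
    refine (congrArg (· ≫ q) (incl_subTower_proj c S j)).trans ?_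
    refine (congrArg (· ≫ q) (subStageMap_incl c S hm j).symm).trans ?_
    exact (Category.assoc _ _ _).trans (hq j).1
  · refine c.isColimit.hom_ext fun j => ?_
    exact (Category.assoc _ _ _).symm.trans (hq j).2

include hm in
theorem subStage_mem (j : J) : I.rlp.llp (subStage c S j) := by
  rw [← incl_subTower_proj]
  exact MorphismProperty.comp_mem _ _ _ ((subTower c S).complex.incl_mem j)
    (subTower_proj_mem c S hm)

include hm in
theorem mono_subStage (j : J) : Mono (subStage c S j) := hm _ (subStage_mem c S hm j)

include hm in
/-- A cell in `S` whose attaching map factors through the stage `j` of the tower of `S`. -/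
theorem exists_characteristic_factor {j : J} (hj : ¬ IsMax j) (k : (c.attachCells j hj).ι)
    (hk : (⟨j, hj, k⟩ : c.Cells) ∈ S)
    (h : ∃ y, y ≫ subStage c S j = attachingMap (c.attachCells j hj) k ≫ c.incl.app j) :
    ∃ y, y ≫ subStage c S (Order.succ j) =
      characteristicMap (c.attachCells j hj) k ≫ c.incl.app (Order.succ j) :=
  ⟨characteristicMap ((subTower c S).complex.attachCells j hj)
      (⟨⟨⟨hj⟩, k⟩, hk, h⟩ : (subcomplexCells c S j ((subTower c S).F.obj j)).ι),
    (subTower c S).characteristicMap_complex j hj ⟨⟨⟨hj⟩, k⟩, hk, h⟩⟩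

include hm in
-- By induction on the stage: if stage `j` for `S` factors through stage `j` for `S'`, then the
-- attaching maps of the cells of the first tower factor there as well, so these cells are also
-- attached in the second.
theorem exists_subStage_mono {S S' : Set c.Cells} (hS : S ⊆ S') (j : J) :
    ∃ y, y ≫ subStage c S' j = subStage c S j := by
  have := mono_subStage c S' hm
  obtain ⟨q, hq⟩ := PresentedComplex.exists_stage_factor (subTower c S).complex
    (subTower c S).proj _ (subStage c S')
    (fun i j hij => ⟨(subTower c S').complex.F.map (homOfLE hij), map_subStage c S' _⟩)
    ⟨(subTower c S').isoBot.inv.left, by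
      refine Eq.trans ?_ (subTower c S).map_proj.symm
      exact Over.w (subTower c S').isoBot.inv⟩
    (fun j hj hy i => by
      obtain ⟨y, hy⟩ := hy
      rw [incl_subTower_proj] at hy
      obtain ⟨z, hz⟩ := exists_characteristic_factor c S' hm hj i.1.2 (hS i.2.1)
        ⟨i.2.2.choose ≫ y, by
          refine (Category.assoc _ _ _).trans ?_
          refine (congrArg (i.2.2.choose ≫ ·) hy).trans ?_
          exact i.2.2.choose_spec⟩
      exact ⟨z, hz.trans ((subTower c S).characteristicMap_complex_proj j hj i).symm⟩) j
  exact ⟨q, hq.trans (incl_subTower_proj c S j)⟩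

include hm in
theorem exists_subTower_proj_mono {S S' : Set c.Cells} (hS : S ⊆ S') :
    ∃ y, y ≫ (subTower c S').proj = (subTower c S).proj := by
  have : Mono (subTower c S').proj := hm _ (subTower_proj_mem c S' hm)
  choose y hy using exists_subStage_mono c hm hS
  have hy' : ∀ j, (y j ≫ (subTower c S').complex.incl.app j) ≫ (subTower c S').proj =
      subStage c S j := fun j => (Category.assoc _ _ _).trans
    ((congrArg (y j ≫ ·) (incl_subTower_proj c S' j)).trans (hy j))
  obtain ⟨q, hq⟩ := exists_desc_total (subTower c S).complex.toTransfiniteCompositionOfShape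
    (fun j => y j ≫ (subTower c S').complex.incl.app j) fun i i' hi => by
      refine (cancel_mono (subTower c S').proj).1 ((Category.assoc _ _ _).trans ?_)
      refine (congrArg (_ ≫ ·) (hy' i')).trans ?_
      exact (map_subStage c S _).trans (hy' i).symm
  refine ⟨q, (subTower c S).complex.isColimit.hom_ext fun j => ?_⟩
  refine (Category.assoc _ _ _).symm.trans ((congrArg (· ≫ _) (hq j)).trans ?_)
  exact (hy' j).trans (incl_subTower_proj c S j).symm

/-- The tower of the cells in `S` is a subcomplex. -/
def subcomplex : Subcomplex (subTower c S).complex c where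
  cell j hj i := i.1.2
  cell_injective j hj i i' h := Subtype.ext (Sigma.ext (Subsingleton.elim _ _) (heq_of_eq h))
  cell_type j hj i := rfl
  seq := { app j := subStageMap c S hm j, naturality i j h := (subStageMap_map c S hm h).symm }
  seq_bot := by
    have := c.mono_incl hm
    rw [← cancel_mono (c.incl.app ⊥), Category.assoc, subStageMap_incl]
    refine Eq.trans ?_ c.fac.symm
    exact Over.w (subTower c S).isoBot.inv
  attaching j hj i := (subStageMap_attaching c S hm j hj i).trans (Category.id_comp _).symm
  characteristic j hj i :=
    (subStageMap_characteristic c S hm j hj i).trans (Category.id_comp _).symm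

theorem subcomplex_inclusion : (subcomplex c S hm).inclusion = (subTower c S).proj := by
  refine (subTower c S).complex.isColimit.hom_ext fun j => ?_
  refine ((subcomplex c S hm).incl_inclusion j).trans ?_
  exact (subStageMap_incl c S hm j).trans (incl_subTower_proj c S j).symm

theorem mk_subTower_cells_le : Cardinal.mk (subTower c S).complex.Cells ≤ Cardinal.mk S := by
  refine Cardinal.mk_le_of_injective
    (f := fun k => (⟨⟨k.j, k.hj, k.k.1.2⟩, k.k.2.1⟩ : S)) ?_
  rintro ⟨j, hj, ⟨⟨⟨_⟩, k⟩, h⟩⟩ ⟨j', hj', ⟨⟨⟨_⟩, k'⟩, h'⟩⟩ e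
  have e := congrArg Subtype.val e
  obtain rfl : j = j' := congrArg RelativeCellComplex.Cells.j e
  obtain rfl : k = k' := eq_of_heq (RelativeCellComplex.Cells.mk.inj e).2
  rfl

end Subcomplexes

end HirschhornModel

/-! ### Compactness detected by colimit-preserving functors. -/

namespace HirschhornModel

section Evaluations

variable {C : Type u} [Category.{v} C] {I : MorphismProperty C}

/-- The image of a family of monomorphisms under a functor that keeps them monomorphisms. -/
def MonoFamily.mapFamily {T : C} (Z : MonoFamily T) {E : Type*} [Category.{v} E] (G : C ⥤ E)
    (h : ∀ a, Mono (G.map (Z.map a))) : MonoFamily (G.obj T) where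
  Λ := Z.Λ
  obj a := G.obj (Z.obj a)
  map a := G.map (Z.map a)
  mono := h

theorem MonoFamily.Good.mapFamily {T : C} {Z : MonoFamily T} {E : Type*} [Category.{v} E]
    {G : C ⥤ E} (h : ∀ a, Mono (G.map (Z.map a))) {W : C} {w : W ⟶ T} (hw : Z.Good w) :
    (Z.mapFamily G h).Good (G.map w) := by
  obtain ⟨a, y, rfl⟩ := hw
  exact ⟨a, G.map y, (G.map_comp _ _).symm⟩

theorem MonoFamily.Directed.mapFamily {T : C} {Z : MonoFamily T} {E : Type*} [Category.{v} E]
    {G : C ⥤ E} (h : ∀ a, Mono (G.map (Z.map a))) {γ : Cardinal.{v}} (hZ : Z.Directed γ) :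
    (Z.mapFamily G h).Directed γ := by
  intro ι hι a
  obtain ⟨b, hb⟩ := hZ ι hι a
  refine ⟨b, fun i => ?_⟩
  obtain ⟨y, hy⟩ := hb i
  exact ⟨G.map y, (G.map_comp _ _).symm.trans (congrArg G.map hy)⟩

section AttachCells

variable {E : Type*} [Category.{v} E] (G : C ⥤ E) [PreservesColimits G]
  {X₁ X₂ : C} {f : X₁ ⟶ X₂} (c : AttachCells.{v} I.homFamily f)

theorem AttachCells.hom_ext_map {Z : E} {φ φ' : G.obj X₂ ⟶ Z} (h₀ : G.map f ≫ φ = G.map f ≫ φ')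
    (h : ∀ i, G.map (characteristicMap c i) ≫ φ = G.map (characteristicMap c i) ≫ φ') :
    φ = φ' := by
  refine (c.isPushout.map G).hom_ext h₀ ?_
  refine Cofan.IsColimit.hom_ext
    (isColimitCofanMkObjOfIsColimit G _ c.cofan₂.inj c.isColimit₂) _ _ fun i => ?_
  have h' := h i
  simp only [characteristicMap, Functor.map_comp, Category.assoc] at h'
  exact h'

theorem AttachCells.exists_desc_map {Z : E} (y : G.obj X₁ ⟶ Z)
    (y' : ∀ i, G.obj (c.π i).1.right ⟶ Z)
    (h : ∀ i, G.map (attachingMap c i) ≫ y = G.map (c.π i).1.hom ≫ y' i) :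
    ∃ q : G.obj X₂ ⟶ Z, G.map f ≫ q = y ∧ ∀ i, G.map (characteristicMap c i) ≫ q = y' i := by
  have h₂ := isColimitCofanMkObjOfIsColimit G _ c.cofan₂.inj c.isColimit₂
  have h₁ := isColimitCofanMkObjOfIsColimit G _ c.cofan₁.inj c.isColimit₁
  let q : G.obj c.cofan₂.pt ⟶ Z := Cofan.IsColimit.desc h₂ y'
  have hq : ∀ i, G.map (c.cofan₂.inj i) ≫ q = y' i := Cofan.IsColimit.fac h₂ y'
  refine ⟨(c.isPushout.map G).desc y q ?_, (c.isPushout.map G).inl_desc _ _ _, fun i => ?_⟩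
  · refine Cofan.IsColimit.hom_ext h₁ _ _ fun i => ?_
    have e₁ : G.map (c.cofan₁.inj i) ≫ G.map c.g₁ ≫ y = G.map (c.π i).1.hom ≫ y' i := by
      rw [← h i, attachingMap, Functor.map_comp, Category.assoc]
    have e₂ : G.map (c.cofan₁.inj i) ≫ G.map c.m ≫ q = G.map (c.π i).1.hom ≫ y' i := by
      rw [← G.map_comp_assoc, c.hm, G.map_comp_assoc, hq]
      rfl
    exact e₁.trans e₂.symm
  · rw [characteristicMap, G.map_comp, Category.assoc, IsPushout.inr_desc, hq]

/-- This is the successor step for accessibility of the image of a cell complex under `G`. The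
images of the cells are in `P` and have good bottom maps, so they lift one by one; the lifts glue
because `G` preserves coproducts and pushouts. -/
theorem MonoFamily.LiftsGood.exists_extension {T : C} {Z : MonoFamily T}
    {hZ : ∀ a, Mono (G.map (Z.map a))} {P : MorphismProperty E}
    (hP : ∀ ⦃A B : C⦄ (g : A ⟶ B), I g → P (G.map g)) {t : X₂ ⟶ T}
    (ht : ∀ i, Z.Good (characteristicMap c i ≫ t)) {D : E} {p : D ⟶ G.obj T}
    (hp : (Z.mapFamily G hZ).LiftsGood P p) (e : G.obj X₁ ⟶ D) (he : e ≫ p = G.map (f ≫ t)) :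
    ∃ e' : G.obj X₂ ⟶ D, G.map f ≫ e' = e ∧ e' ≫ p = G.map t := by
  have key : ∀ i, ∃ y : G.obj (c.π i).1.right ⟶ D,
      G.map (c.π i).1.hom ≫ y = G.map (attachingMap c i) ≫ e ∧
        y ≫ p = G.map (characteristicMap c i ≫ t) := fun i =>
    hp _ (hP _ (c.π i).2) _ _ (by
      rw [Category.assoc, he, ← G.map_comp, ← G.map_comp, attachingMap_comp_assoc])
      ((ht i).mapFamily hZ)
  choose y hy hy' using key
  obtain ⟨q, hq, hq'⟩ := AttachCells.exists_desc_map G c e y fun i => (hy i).symm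
  refine ⟨q, hq, AttachCells.hom_ext_map G c ?_ fun i => ?_⟩
  · rw [reassoc_of% hq, he, G.map_comp]
  · rw [reassoc_of% hq' i, hy', G.map_comp]

end AttachCells

/-- The transfinite composition is truncated at `j₀`. Below `j₀` successors in `Set.Iic j₀` agree
with those in `J`. -/
theorem accessible_of_stage {J : Type v} [LinearOrder J] [OrderBot J] [SuccOrder J]
    [WellFoundedLT J] {X Y : C} {f : X ⟶ Y} (c : TransfiniteCompositionOfShape J f) (j₀ : J)
    {P : MorphismProperty C} {Z : MonoFamily (c.F.obj j₀)}
    (hx : Z.Good (c.F.map (homOfLE bot_le : ⊥ ⟶ j₀)))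
    (step : ∀ j (hj : j < j₀) (E : C) (p : E ⟶ c.F.obj j₀), Z.LiftsGood P p →
      ∀ e : c.F.obj j ⟶ E, e ≫ p = c.F.map (homOfLE hj.le) → ∃ e' : c.F.obj (Order.succ j) ⟶ E,
        c.F.map (homOfLE (Order.le_succ j)) ≫ e' = e ∧
          e' ≫ p = c.F.map (homOfLE (Order.succ_le_of_lt hj))) :
    Accessible P Z (c.F.map (homOfLE bot_le : ⊥ ⟶ j₀)) := by
  refine accessible_of_transfiniteComposition hx (c.iic j₀) fun j hj E p hp e he => ?_
  have hj' : j.1 < j₀ := by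
    rw [not_isMax_iff] at hj
    obtain ⟨i, hi⟩ := hj
    exact lt_of_lt_of_le hi i.2
  have aux : ∀ (m : Set.Iic j₀) (hm : m.1 = Order.succ j.1) (h : j.1 ≤ m.1),
      ∃ e' : c.F.obj m.1 ⟶ E, c.F.map (homOfLE h) ≫ e' = e ∧ e' ≫ p = c.F.map (homOfLE m.2) := by
    rintro ⟨_, hm'⟩ rfl h
    exact step j.1 hj' E p hp e he
  exact aux (Order.succ j) (Set.Iic.coe_succ_of_not_isMax hj) (Order.le_succ j)

variable {𝓢 : Type*} {E : 𝓢 → Type*} [∀ s, Category.{v} (E s)] (ev : ∀ s, C ⥤ E s)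
  (P : ∀ s, MorphismProperty (E s))

/-- Every map from `W` to an object that is accessible after all the functors `ev s` is good. -/
def Tested (γ : Cardinal.{v}) (W : C) : Prop :=
  ∀ (T : C) (Z : MonoFamily T) (hZ : ∀ s a, Mono ((ev s).map (Z.map a))), Z.Directed γ →
    (∀ s, ∃ (X : C) (x : X ⟶ T), Accessible (P s) (Z.mapFamily (ev s) (hZ s)) ((ev s).map x)) →
      ∀ w : W ⟶ T, Z.Good w

variable {J : Type v} [LinearOrder J] [OrderBot J] [SuccOrder J] [WellFoundedLT J]
  {X Y : C} {f : X ⟶ Y} (c : PresentedComplex I J f) [HasColimits C]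
  (hm : I.rlp.llp ≤ MorphismProperty.monomorphisms C) (γ : Cardinal.{v})

/-- The stages of the subcomplexes with at most `γ` cells, over a stage of the complex. -/
def stageFamily (j : J) : MonoFamily (c.F.obj j) where
  Λ := {S : Set c.Cells // Cardinal.mk S ≤ γ}
  obj S := (subTower c S.1).complex.F.obj j
  map S := subStageMap c S.1 hm j
  mono S :=
    have := mono_subStage c S.1 hm j
    mono_of_mono_fac (subStageMap_incl c S.1 hm j)

/-- The subcomplexes with at most `γ` cells. -/
def subcomplexFamily : MonoFamily Y where
  Λ := {S : Set c.Cells // Cardinal.mk S ≤ γ}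
  obj S := (subTower c S.1).total
  map S := (subTower c S.1).proj
  mono S := hm _ (subTower_proj_mem c S.1 hm)

variable {γ}

theorem exists_union (hγ : Cardinal.aleph0 ≤ γ) {α : Type v} {ι : Type v}
    (hι : Cardinal.mk ι ≤ γ) (a : ι → {S : Set α // Cardinal.mk S ≤ γ}) :
    ∃ b : {S : Set α // Cardinal.mk S ≤ γ}, ∀ i, (a i).1 ⊆ b.1 := by
  refine ⟨⟨⋃ i, (a i).1, ?_⟩, fun i => Set.subset_iUnion (fun i => (a i).1) i⟩
  refine (Cardinal.mk_iUnion_le_sum_mk).trans ?_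
  refine (Cardinal.sum_le_sum _ (fun _ => γ) fun i => (a i).2).trans ?_
  rw [Cardinal.sum_const']
  exact Cardinal.mul_le_of_le hγ hι le_rfl

theorem stageFamily_directed (hγ : Cardinal.aleph0 ≤ γ) (j : J) :
    (stageFamily c hm γ j).Directed γ := by
  intro ι hι a
  obtain ⟨b, hb⟩ := exists_union hγ hι a
  refine ⟨b, fun i => ?_⟩
  obtain ⟨y, hy⟩ := exists_subStage_mono c hm (hb i) j
  have := c.mono_incl hm j
  refine ⟨y, (cancel_mono (c.incl.app j)).1 ?_⟩
  exact (Category.assoc _ _ _).trans ((congrArg (y ≫ ·) (subStageMap_incl c _ hm j)).trans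
    (hy.trans (subStageMap_incl c _ hm j).symm))

theorem stageFamily_good {j : J} {S : Set c.Cells} (hS : Cardinal.mk S ≤ γ) {W : C}
    {w : W ⟶ c.F.obj j} {y : W ⟶ (subTower c S).complex.F.obj j}
    (hy : y ≫ subStage c S j = w ≫ c.incl.app j) : (stageFamily c hm γ j).Good w := by
  have := c.mono_incl hm j
  refine ⟨⟨S, hS⟩, y, (cancel_mono (c.incl.app j)).1 ?_⟩
  exact (Category.assoc _ _ _).trans ((congrArg (y ≫ ·) (subStageMap_incl c S hm j)).trans hy)

theorem subcomplexFamily_directed (hγ : Cardinal.aleph0 ≤ γ) :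
    (subcomplexFamily c hm γ).Directed γ := by
  intro ι hι a
  obtain ⟨b, hb⟩ := exists_union hγ hι a
  exact ⟨b, fun i => exists_subTower_proj_mono c hm (hb i)⟩

include hm in
-- Adjoining the cell itself to `S` costs one cell, which is harmless for infinite `γ`.
theorem exists_characteristic_factor_of_attaching (hγ : Cardinal.aleph0 ≤ γ) {j : J}
    (hj : ¬ IsMax j) (k : (c.attachCells j hj).ι)
    (h : ∃ S : Set c.Cells, Cardinal.mk S ≤ γ ∧
      ∃ y, y ≫ subStage c S j = attachingMap (c.attachCells j hj) k ≫ c.incl.app j) :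
    ∃ S : Set c.Cells, Cardinal.mk S ≤ γ ∧ ∃ y, y ≫ subStage c S (Order.succ j) =
      characteristicMap (c.attachCells j hj) k ≫ c.incl.app (Order.succ j) := by
  obtain ⟨S, hS, y, hy⟩ := h
  refine ⟨insert ⟨j, hj, k⟩ S, ?_, ?_⟩
  · exact Cardinal.mk_insert_le.trans
      (Cardinal.add_le_of_le hγ hS (Cardinal.one_lt_aleph0.le.trans hγ))
  · obtain ⟨z, hz⟩ := exists_subStage_mono c hm (Set.subset_insert ⟨j, hj, k⟩ S) j
    exact exists_characteristic_factor c _ hm hj k (Set.mem_insert _ _)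
      ⟨y ≫ z, by rw [Category.assoc, hz, hy]⟩

variable {ev P} [∀ s, PreservesColimits (ev s)]
  (hP : ∀ s ⦃A B : C⦄ (g : A ⟶ B), I g → P s ((ev s).map g))
  (hev : ∀ s ⦃A B : C⦄ (g : A ⟶ B), I.rlp.llp g → Mono ((ev s).map g))
  (hI : ∀ ⦃A B : C⦄ (g : A ⟶ B), I g → Tested ev P γ A)

include hm hP hev hI in
-- Well-founded induction on the stage. If the attaching maps below `j` factor through small
-- subcomplexes, so do the characteristic maps; hence each evaluation of stage `j` is accessible for
-- the small subcomplexes. The domain of a cell at stage `j` is tested, so its attaching map also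
-- factors.
theorem exists_attaching_factor (hγ : Cardinal.aleph0 ≤ γ) (j : J) :
    ∀ (hj : ¬ IsMax j) (k : (c.attachCells j hj).ι), ∃ S : Set c.Cells, Cardinal.mk S ≤ γ ∧
      ∃ y, y ≫ subStage c S j = attachingMap (c.attachCells j hj) k ≫ c.incl.app j := by
  induction j using WellFoundedLT.induction with
  | _ j ih =>
  intro hj k
  have hZ : ∀ s a, Mono ((ev s).map ((stageFamily c hm γ j).map a)) := by
    intro s a
    have := hev s _ (subStage_mem c a.1 hm j)
    have e : (ev s).map (subStageMap c a.1 hm j) ≫ (ev s).map (c.incl.app j) =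
        (ev s).map (subStage c a.1 j) := by rw [← Functor.map_comp, subStageMap_incl]
    have : Mono ((ev s).map (subStageMap c a.1 hm j) ≫ (ev s).map (c.incl.app j)) := by rwa [e]
    exact mono_of_mono ((ev s).map (subStageMap c a.1 hm j)) ((ev s).map (c.incl.app j))
  have hbot : (stageFamily c hm γ j).Good (c.F.map (homOfLE bot_le : ⊥ ⟶ j)) := by
    obtain ⟨x, hx⟩ : ∃ x : X ⟶ (subTower c ∅).complex.F.obj j, x ≫ subStage c ∅ j = f := by
      refine ⟨(subTower c ∅).isoBot.inv.left ≫ (subTower c ∅).complex.F.map (homOfLE bot_le),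
        (Category.assoc _ _ _).trans ?_⟩
      refine (congrArg (_ ≫ ·) (map_subStage c ∅ _)).trans ?_
      exact Over.w (subTower c ∅).isoBot.inv
    refine stageFamily_good c hm (S := ∅) (by simp) (y := c.isoBot.hom ≫ x) ?_
    rw [Category.assoc, hx, map_incl, isoBot_hom_comp]
  have hacc : ∀ s, Accessible (P s) ((stageFamily c hm γ j).mapFamily (ev s) (hZ s))
      ((ev s).map (c.F.map (homOfLE bot_le : ⊥ ⟶ j))) := by
    intro s
    have := preservesWellOrderContinuousOfShape_of_preservesColimits (ev s) J
    refine accessible_of_stage (c.toTransfiniteCompositionOfShape.map (ev s)) j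
      (hbot.mapFamily (hZ s)) fun i hi D p hp e he => ?_
    refine hp.exists_extension (ev s) (c.attachCells i (not_isMax_of_lt hi)) (hP s)
      (t := c.F.map (homOfLE (Order.succ_le_of_lt hi))) (fun k => ?_) e (he.trans ?_)
    · obtain ⟨S, hS, y, hy⟩ := exists_characteristic_factor_of_attaching c hm hγ _ k
        (ih i hi (not_isMax_of_lt hi) k)
      refine stageFamily_good c hm hS
        (y := y ≫ (subTower c S).complex.F.map (homOfLE (Order.succ_le_of_lt hi))) ?_
      rw [Category.assoc, map_subStage, hy, Category.assoc, map_incl]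
    · rw [← Functor.map_comp]
      rfl
  obtain ⟨S, y, hy⟩ := hI _ ((c.attachCells j hj).π k).2 _ (stageFamily c hm γ j) hZ
    (stageFamily_directed c hm hγ j) (fun s => ⟨_, _, hacc s⟩)
    (attachingMap (c.attachCells j hj) k)
  refine ⟨S.1, S.2, y, ?_⟩
  refine (congrArg (y ≫ ·) (subStageMap_incl c S.1 hm j).symm).trans ?_
  exact (Category.assoc _ _ _).symm.trans (congrArg (· ≫ c.incl.app j) hy)

include hm hP hev hI in
/-- If the domains of `I` are tested, then tested objects are compact relative to `I`. -/
theorem Tested.compactWith (hγ : Cardinal.aleph0 ≤ γ) {W : C} (hW : Tested ev P γ W) :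
    CompactWith γ W I := by
  intro J _ _ _ _ X Y f c g
  have hZ : ∀ s a, Mono ((ev s).map ((subcomplexFamily c hm γ).map a)) :=
    fun s a => hev s _ (subTower_proj_mem c a.1 hm)
  have hbot : (subcomplexFamily c hm γ).Good f :=
    ⟨⟨∅, by simp⟩, (subTower c ∅).map, (subTower c ∅).map_proj⟩
  have hacc : ∀ s, Accessible (P s) ((subcomplexFamily c hm γ).mapFamily (ev s) (hZ s))
      ((ev s).map f) := by
    intro s
    have := preservesWellOrderContinuousOfShape_of_preservesColimits (ev s) J
    refine accessible_of_transfiniteComposition (hbot.mapFamily (hZ s))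
      (c.toTransfiniteCompositionOfShape.map (ev s)) fun i hi D p hp e he => ?_
    -- Attaching maps factor through small subcomplexes by `exists_attaching_factor`, and adding one
    -- cell gives the characteristic maps.
    have hgood : ∀ k, (subcomplexFamily c hm γ).Good
        (characteristicMap (c.attachCells i hi) k ≫ c.incl.app (Order.succ i)) := by
      intro k
      obtain ⟨S, hS, y, hy⟩ := exists_characteristic_factor_of_attaching c hm hγ hi k
        (exists_attaching_factor c hm hP hev hI hγ i hi k)
      refine ⟨⟨S, hS⟩, y ≫ (subTower c S).complex.incl.app (Order.succ i), ?_⟩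
      refine (Category.assoc _ _ _).trans ?_
      exact (congrArg (y ≫ ·) (incl_subTower_proj c S _)).trans hy
    have h₁ : e ≫ p = (ev s).map (c.F.map (homOfLE (Order.le_succ i)) ≫
        c.incl.app (Order.succ i)) := by
      rw [map_incl]
      exact he.trans (Category.comp_id _)
    obtain ⟨e', he', he''⟩ := hp.exists_extension (ev s) (c.attachCells i hi) (hP s) hgood e h₁
    exact ⟨e', he', he''.trans (Category.comp_id _).symm⟩
  obtain ⟨S, y, hy⟩ := hW _ _ hZ (subcomplexFamily_directed c hm hγ)
    (fun s => ⟨_, _, hacc s⟩) g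
  refine ⟨_, _, _, subcomplex c S.1 hm, (mk_subTower_cells_le c S.1).trans S.2, y, ?_⟩
  rw [subcomplex_inclusion]
  exact hy

end Evaluations

end HirschhornModel

/-! ### Objectwise limits and colimits, and the universal property of free diagrams. -/

namespace DiagramModel

open HirschhornModel

variable {D : Type v} [SmallCategory D] {M : Pseudofunctor (LocallyDiscrete D) Cat.{v, u}}

theorem pushComp_id_left {s t : D} (a : s ⟶ t) (A : Fib M s) :
    (pushComp M (𝟙 s) a).hom.app A ≫ (push M a).map ((pushId M s).hom.app A) =
      eqToHom (by rw [Category.id_comp]; rfl) := by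
  have h := M.mapComp_id_left_hom_app a.toLoc A
  have e : M.map₂ (λ_ a.toLoc).hom = eqToHom (by rw [Category.id_comp]) := by
    rw [Strict.leftUnitor_eqToIso]
    simp [PrelaxFunctor.map₂_eqToHom]
  rw [e, Cat.Hom₂.eqToHom_toNatTrans, eqToHom_app] at h
  change (M.mapComp (𝟙 (LocallyDiscrete.mk s)) a.toLoc).hom.toNatTrans.app A ≫
    (M.map a.toLoc).toFunctor.map ((M.mapId ⟨s⟩).hom.toNatTrans.app A) = _
  rw [h, Category.assoc, ← Functor.map_comp, Cat.Hom.inv_hom_id_toNatTrans_app]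
  refine (congrArg (_ ≫ ·) ((M.map a.toLoc).toFunctor.map_id _)).trans ?_
  exact Category.comp_id _

variable (M) in
/-- The functor that evaluates a diagram at an object. -/
def evaluation (s : D) : MDiagram M ⥤ Fib M s where
  obj X := X.obj s
  map f := f.app s

section Limits

variable {K : Type*} [Category* K] (F : K ⥤ MDiagram M)

theorem naturality_app {X Y : MDiagram M} (f : X ⟶ Y) {s t : D} (a : s ⟶ t) :
    (push M a).map (f.app s) ≫ Y.map a = X.map a ≫ f.app t := MDiagram.Hom.naturality f a

theorem comp_app_eq {X Y Z : MDiagram M} {f : X ⟶ Y} {g : Y ⟶ Z} {h : X ⟶ Z} (e : f ≫ g = h)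
    (s : D) : f.app s ≫ g.app s = h.app s := by
  rw [← e]
  rfl

/-- A cone of diagrams is a limit cone if it is one objectwise. -/
def isLimitOfObjectwise {c : Cone F} (h : ∀ s, IsLimit ((evaluation M s).mapCone c)) :
    IsLimit c where
  lift t :=
    { app s := (h s).lift ((evaluation M s).mapCone t)
      naturality {s r} a := (h r).hom_ext fun k => by
        have h₁ := (h r).fac ((evaluation M r).mapCone t) k
        have h₂ := (h s).fac ((evaluation M s).mapCone t) k
        refine (Category.assoc _ _ _).trans ?_
        refine (congrArg (_ ≫ ·) (naturality_app (c.π.app k) a).symm).trans ?_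
        refine ((Category.assoc _ _ _).symm.trans
          (congrArg (· ≫ _) ((push M a).map_comp _ _).symm)).trans ?_
        refine (congrArg (fun x => (push M a).map x ≫ (F.obj k).map a) h₂).trans ?_
        refine (naturality_app (t.π.app k) a).trans ?_
        exact (congrArg (_ ≫ ·) h₁.symm).trans (Category.assoc _ _ _).symm }
  fac t k := MDiagram.hom_ext _ _ fun s => (h s).fac ((evaluation M s).mapCone t) k
  uniq t m hm := MDiagram.hom_ext _ _ fun s => (h s).uniq ((evaluation M s).mapCone t) _ fun k =>
    comp_app_eq (hm k) s

variable {F} in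
/-- A cocone of diagrams is a colimit cocone if it is one objectwise. -/
def isColimitOfObjectwise [∀ {s t : D} (a : s ⟶ t), (push M a).IsLeftAdjoint] {c : Cocone F}
    (h : ∀ s, IsColimit ((evaluation M s).mapCocone c)) : IsColimit c where
  desc t :=
    { app s := (h s).desc ((evaluation M s).mapCocone t)
      naturality {s r} a := by
        have : PreservesColimits (push M a) := (Adjunction.ofIsLeftAdjoint _).leftAdjoint_preservesColimits
        refine (isColimitOfPreserves (push M a) (h s)).hom_ext fun k => ?_
        have h₁ := (h r).fac ((evaluation M r).mapCocone t) k
        have h₂ := (h s).fac ((evaluation M s).mapCocone t) k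
        refine (Category.assoc _ _ _).symm.trans ?_
        refine (congrArg (· ≫ _) ((push M a).map_comp _ _).symm).trans ?_
        refine (congrArg (fun x => (push M a).map x ≫ t.pt.map a) h₂).trans ?_
        refine (naturality_app (t.ι.app k) a).trans ?_
        refine (congrArg ((F.obj k).map a ≫ ·) h₁.symm).trans ?_
        refine (Category.assoc _ _ _).symm.trans ?_
        refine (congrArg (· ≫ _) (naturality_app (c.ι.app k) a).symm).trans ?_
        exact Category.assoc _ _ _ }
  fac t k := MDiagram.hom_ext _ _ fun s => (h s).fac ((evaluation M s).mapCocone t) k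
  uniq t m hm := MDiagram.hom_ext _ _ fun s => (h s).uniq ((evaluation M s).mapCocone t) _ fun k =>
    comp_app_eq (hm k) s

section

variable [∀ s, HasLimitsOfShape K (Fib M s)]

/-- The limit of the values at an object. -/
def limitObj (s : D) : Fib M s := limit (F ⋙ evaluation M s)

/-- The projections of the limit of the values. -/
def limitProj (s : D) (k : K) : limitObj F s ⟶ (F.obj k).obj s := limit.π (F ⋙ evaluation M s) k

variable {F} in
theorem limitObj_hom_ext {s : D} {Z : Fib M s} {f g : Z ⟶ limitObj F s}
    (h : ∀ k, f ≫ limitProj F s k = g ≫ limitProj F s k) : f = g := limit.hom_ext h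

theorem limitProj_map (s : D) {k l : K} (g : k ⟶ l) :
    limitProj F s k ≫ (F.map g).app s = limitProj F s l := limit.w (F ⋙ evaluation M s) g

/-- The structure maps on the limits of the values. -/
def limitMap {s t : D} (a : s ⟶ t) : (push M a).obj (limitObj F s) ⟶ limitObj F t :=
  limit.lift (F ⋙ evaluation M t) (Cone.mk _
    { app k := (push M a).map (limitProj F s k) ≫ (F.obj k).map a
      naturality k l g := by
        have h := naturality_app (F.map g) a
        have h' : (push M a).map (limitProj F s l) ≫ (F.obj l).map a =
            ((push M a).map (limitProj F s k) ≫ (F.obj k).map a) ≫ (F.map g).app t := by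
          rw [Category.assoc, ← h, ← Functor.map_comp_assoc, limitProj_map]
        exact (Category.id_comp _).trans h' })

theorem limitMap_proj {s t : D} (a : s ⟶ t) (k : K) :
    limitMap F a ≫ limitProj F t k = (push M a).map (limitProj F s k) ≫ (F.obj k).map a :=
  limit.lift_π _ k

/-- The objectwise limit of a diagram of diagrams. -/
def objectwiseLimit : MDiagram M where
  obj := limitObj F
  map := limitMap F
  map_id s := limitObj_hom_ext fun k => by
    rw [limitMap_proj, (F.obj k).map_id, (pushId M s).hom.naturality]
    rfl
  map_comp {s t r} a b := limitObj_hom_ext fun k => by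
    rw [limitMap_proj, (F.obj k).map_comp, (pushComp M a b).hom.naturality_assoc, Category.assoc,
      Category.assoc, limitMap_proj, ← Functor.map_comp_assoc, limitMap_proj, Functor.map_comp,
      Category.assoc]
    rfl

/-- The limit cone on the objectwise limit. -/
def objectwiseLimitCone : Cone F where
  pt := objectwiseLimit F
  π :=
    { app k :=
        { app s := limitProj F s k
          naturality a := (limitMap_proj F a k).symm }
      naturality _ _ g := (Category.id_comp _).trans
        (MDiagram.hom_ext _ _ fun s => (limitProj_map F s g).symm) }

/-- The objectwise limit cone is objectwise a limit cone. -/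
def isLimitEvaluationObjectwiseLimitCone (s : D) :
    IsLimit ((evaluation M s).mapCone (objectwiseLimitCone F)) :=
  IsLimit.ofIsoLimit (limit.isLimit (F ⋙ evaluation M s))
    (Cone.ext (Iso.refl _) fun _ => (Category.id_comp _).symm)

/-- The structure maps of a diagram go out of `a_*`, so limits are objectwise for arbitrary functors
`a_*`, whereas the colimits below rely on `a_*` preserving colimits. -/
instance hasLimitsOfShape_mDiagram : HasLimitsOfShape K (MDiagram M) where
  has_limit F := ⟨⟨_, isLimitOfObjectwise F (isLimitEvaluationObjectwiseLimitCone F)⟩⟩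

instance preservesLimitsOfShape_evaluation (s : D) : PreservesLimitsOfShape K (evaluation M s) where
  preservesLimit {F} := preservesLimit_of_preserves_limit_cone
    (isLimitOfObjectwise F (isLimitEvaluationObjectwiseLimitCone F))
    (isLimitEvaluationObjectwiseLimitCone F s)

end

section

variable [∀ s, HasColimitsOfShape K (Fib M s)]

/-- The colimit of the values at an object. -/
def colimitObj (s : D) : Fib M s := colimit (F ⋙ evaluation M s)

/-- The inclusions into the colimit of the values. -/
def colimitIncl (s : D) (k : K) : (F.obj k).obj s ⟶ colimitObj F s :=
  colimit.ι (F ⋙ evaluation M s) k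

theorem map_colimitIncl (s : D) {k l : K} (g : k ⟶ l) :
    (F.map g).app s ≫ colimitIncl F s l = colimitIncl F s k := colimit.w (F ⋙ evaluation M s) g

variable [∀ {s t : D} (a : s ⟶ t), (push M a).IsLeftAdjoint]

/-- The functors `a_*` preserve the colimit of the values. -/
def isColimitPushColimitObj {s t : D} (a : s ⟶ t) :
    IsColimit ((push M a).mapCocone (colimit.cocone (F ⋙ evaluation M s))) :=
  isColimitOfPreserves (push M a) (colimit.isColimit (F ⋙ evaluation M s))

variable {F} in
theorem push_colimitObj_hom_ext {s t : D} {a : s ⟶ t} {Z : Fib M t}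
    {f g : (push M a).obj (colimitObj F s) ⟶ Z}
    (h : ∀ k, (push M a).map (colimitIncl F s k) ≫ f = (push M a).map (colimitIncl F s k) ≫ g) :
    f = g := (isColimitPushColimitObj F a).hom_ext h

/-- The structure maps on the colimits of the values. -/
def colimitMap {s t : D} (a : s ⟶ t) : (push M a).obj (colimitObj F s) ⟶ colimitObj F t :=
  (isColimitPushColimitObj F a).desc (Cocone.mk (colimitObj F t)
    { app k := (F.obj k).map a ≫ colimitIncl F t k
      naturality k l g := by
        have h : (push M a).map ((F.map g).app s) ≫ (F.obj l).map a ≫ colimitIncl F t l =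
            (F.obj k).map a ≫ colimitIncl F t k := by
          rw [← Category.assoc, naturality_app, Category.assoc, map_colimitIncl]
        exact h.trans (Category.comp_id _).symm })

theorem incl_colimitMap {s t : D} (a : s ⟶ t) (k : K) :
    (push M a).map (colimitIncl F s k) ≫ colimitMap F a = (F.obj k).map a ≫ colimitIncl F t k :=
  (isColimitPushColimitObj F a).fac _ k

/-- The objectwise colimit of a diagram of diagrams. -/
def objectwiseColimit : MDiagram M where
  obj := colimitObj F
  map := colimitMap F
  map_id s := push_colimitObj_hom_ext fun k => by
    rw [incl_colimitMap, (F.obj k).map_id, (pushId M s).hom.naturality]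
    rfl
  map_comp {s t r} a b := push_colimitObj_hom_ext fun k => by
    rw [incl_colimitMap, (F.obj k).map_comp, (pushComp M a b).hom.naturality_assoc,
      Functor.comp_map, ← Functor.map_comp_assoc, incl_colimitMap, Functor.map_comp]
    simp only [Category.assoc]
    rw [incl_colimitMap]

/-- The colimit cocone on the objectwise colimit. -/
def objectwiseColimitCocone : Cocone F where
  pt := objectwiseColimit F
  ι :=
    { app k :=
        { app s := colimitIncl F s k
          naturality a := incl_colimitMap F a k }
      naturality _ _ g := (MDiagram.hom_ext _ _ fun s =>
        (map_colimitIncl F s g).trans (Category.comp_id _).symm) }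

/-- The objectwise colimit cocone is objectwise a colimit cocone. -/
def isColimitEvaluationObjectwiseColimitCocone (s : D) :
    IsColimit ((evaluation M s).mapCocone (objectwiseColimitCocone F)) :=
  IsColimit.ofIsoColimit (colimit.isColimit (F ⋙ evaluation M s))
    (Cocone.ext (Iso.refl _) fun _ => Category.comp_id _)

instance hasColimitsOfShape_mDiagram : HasColimitsOfShape K (MDiagram M) where
  has_colimit F := ⟨⟨_, isColimitOfObjectwise (isColimitEvaluationObjectwiseColimitCocone F)⟩⟩

instance preservesColimitsOfShape_evaluation (s : D) :
    PreservesColimitsOfShape K (evaluation M s) where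
  preservesColimit {F} := preservesColimit_of_preserves_colimit_cocone
    (isColimitOfObjectwise (isColimitEvaluationObjectwiseColimitCocone F))
    (isColimitEvaluationObjectwiseColimitCocone F s)

end

end Limits

instance hasLimits_mDiagram [∀ s, HasLimits (Fib M s)] : HasLimits (MDiagram M) where

section Colimits

variable [∀ s, HasColimits (Fib M s)] [∀ {s t : D} (a : s ⟶ t), (push M a).IsLeftAdjoint]

instance hasColimits_mDiagram : HasColimits (MDiagram M) where

instance preservesColimits_evaluation (s : D) : PreservesColimits (evaluation M s) where

end Colimits

/-- Factorizations through monomorphisms are unique, so those found objectwise are automatically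
natural. This reduces factorization problems for diagrams to the categories `M(s)`. -/
theorem exists_factor_of_objectwise {Z W T : MDiagram M} (z : Z ⟶ T) (hz : ∀ s, Mono (z.app s))
    (w : W ⟶ T) (h : ∀ s, ∃ y, y ≫ z.app s = w.app s) : ∃ y : W ⟶ Z, y ≫ z = w := by
  choose y hy using h
  refine ⟨⟨y, fun {s t} a => ?_⟩, MDiagram.hom_ext _ _ hy⟩
  have := hz t
  rw [← cancel_mono (z.app t), Category.assoc, Category.assoc, hy, ← naturality_app,
    ← naturality_app, ← Functor.map_comp_assoc, hy]

theorem mono_of_objectwise {Z T : MDiagram M} (z : Z ⟶ T) (hz : ∀ s, Mono (z.app s)) : Mono z where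
  right_cancellation f g h := MDiagram.hom_ext _ _ fun s => by
    have := hz s
    exact (cancel_mono (z.app s)).1 (congrArg (fun k => MDiagram.Hom.app k s) h)

section Free

variable [∀ s, HasColimits (Fib M s)] [∀ {s t : D} (a : s ⟶ t), (push M a).IsLeftAdjoint]
  {s : D} {S : MapsFrom s} {A : Fib M s} {X : MDiagram M}

variable (S A) in
/-- The inclusion of a summand in a value of a generated diagram. -/
def summand {t : D} (a : s ⟶ t) (ha : S.mem a) : (push M a).obj A ⟶ (freeOn S A).obj t :=
  freeIncl M S A a ha

theorem push_summand_map {t r : D} (a : s ⟶ t) (b : t ⟶ r) (ha : S.mem a) :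
    (push M b).map (summand S A a ha) ≫ (freeOn S A).map b =
      (pushComp M a b).inv.app A ≫ summand S A (a ≫ b) (S.comp_mem a b ha) :=
  push_freeIncl_freeMap S A b a ha

theorem push_summand_map_assoc {t r : D} (a : s ⟶ t) (b : t ⟶ r) (ha : S.mem a) {Z : Fib M r}
    (g : (freeOn S A).obj r ⟶ Z) :
    (push M b).map (summand S A a ha) ≫ (freeOn S A).map b ≫ g =
      (pushComp M a b).inv.app A ≫ summand S A (a ≫ b) (S.comp_mem a b ha) ≫ g := by
  rw [← Category.assoc, push_summand_map, Category.assoc]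

theorem push_freeOn_hom_ext {t r : D} {b : t ⟶ r} {Z : Fib M r}
    {f g : (push M b).obj ((freeOn S A).obj t) ⟶ Z}
    (h : ∀ (a : s ⟶ t) (ha : S.mem a), (push M b).map (summand S A a ha) ≫ f =
      (push M b).map (summand S A a ha) ≫ g) : f = g :=
  push_freeObj_hom_ext h

theorem eqToHom_summand {t : D} {a a' : s ⟶ t} (h : a = a') (ha : S.mem a) (ha' : S.mem a') :
    eqToHom (by rw [h]) ≫ summand S A a' ha' = summand S A a ha :=
  eqToHom_freeIncl S A h ha ha' (by rw [h])

/-- The map out of a value of a generated diagram. -/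
def freeOnObjDesc {t : D} {Z : Fib M t} (x : ∀ a : s ⟶ t, S.mem a → ((push M a).obj A ⟶ Z)) :
    (freeOn S A).obj t ⟶ Z :=
  Limits.Sigma.desc fun a : {a : s ⟶ t // S.mem a} => x a.1 a.2

theorem summand_freeOnObjDesc {t : D} {Z : Fib M t}
    (x : ∀ a : s ⟶ t, S.mem a → ((push M a).obj A ⟶ Z)) (a : s ⟶ t) (ha : S.mem a) :
    summand S A a ha ≫ freeOnObjDesc x = x a ha :=
  Limits.Sigma.ι_desc _ (⟨a, ha⟩ : {a // S.mem a})

/-- The map out of a generated diagram given by a compatible family of maps. -/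
def freeOnDesc (x : ∀ (t : D) (a : s ⟶ t), S.mem a → ((push M a).obj A ⟶ X.obj t))
    (hx : ∀ {t r : D} (a : s ⟶ t) (b : t ⟶ r) (ha : S.mem a),
      x r (a ≫ b) (S.comp_mem a b ha) =
        (pushComp M a b).hom.app A ≫ (push M b).map (x t a ha) ≫ X.map b) : freeOn S A ⟶ X where
  app t := freeOnObjDesc (x t)
  naturality {t r} b := push_freeOn_hom_ext fun a ha => by
    rw [← Functor.map_comp_assoc, summand_freeOnObjDesc, push_summand_map_assoc,
      summand_freeOnObjDesc, hx, Iso.inv_hom_id_app_assoc]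

theorem summand_freeOnDesc (x : ∀ (t : D) (a : s ⟶ t), S.mem a → ((push M a).obj A ⟶ X.obj t))
    (hx : ∀ {t r : D} (a : s ⟶ t) (b : t ⟶ r) (ha : S.mem a),
      x r (a ≫ b) (S.comp_mem a b ha) =
        (pushComp M a b).hom.app A ≫ (push M b).map (x t a ha) ≫ X.map b) {t : D} (a : s ⟶ t)
    (ha : S.mem a) : summand S A a ha ≫ (freeOnDesc x hx).app t = x t a ha :=
  summand_freeOnObjDesc _ _ _

theorem freeOn_hom_ext {f g : freeOn S A ⟶ X}
    (h : ∀ {t : D} (a : s ⟶ t) (ha : S.mem a),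
      summand S A a ha ≫ f.app t = summand S A a ha ≫ g.app t) : f = g :=
  MDiagram.hom_ext _ _ fun _ => freeObj_hom_ext h

/-- The components of a map out of a generated diagram are compatible. -/
theorem summand_comp (f : freeOn S A ⟶ X) {t r : D} (a : s ⟶ t) (b : t ⟶ r) (ha : S.mem a) :
    summand S A (a ≫ b) (S.comp_mem a b ha) ≫ f.app r =
      (pushComp M a b).hom.app A ≫ (push M b).map (summand S A a ha ≫ f.app t) ≫ X.map b := by
  rw [Functor.map_comp, Category.assoc, naturality_app, push_summand_map_assoc,
    Iso.hom_inv_id_app_assoc]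

theorem summand_freeOnMap {B : Fib M s} (f : A ⟶ B) {t : D} (a : s ⟶ t) (ha : S.mem a) :
    summand S A a ha ≫ (freeOnMap S f).app t = (push M a).map f ≫ summand S B a ha :=
  freeIncl_freeObjMap S f a ha

/-- The inclusion of a summand in a value of a free diagram. -/
def freeSummand (A : Fib M s) {t : D} (a : s ⟶ t) : (push M a).obj A ⟶ (free s A).obj t :=
  freeIncl M (MapsFrom.all s) A a (MapsFrom.mem_all a)

theorem push_freeSummand_map {t r : D} (a : s ⟶ t) (b : t ⟶ r) :
    (push M b).map (freeSummand A a) ≫ (free s A).map b =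
      (pushComp M a b).inv.app A ≫ freeSummand A (a ≫ b) :=
  push_freeIncl_freeMap (MapsFrom.all s) A b a (MapsFrom.mem_all a)

/-- The inclusion of the generator of a free diagram. -/
def freeUnit (s : D) (A : Fib M s) : A ⟶ (free s A).obj s :=
  (pushId M s).inv.app A ≫ freeSummand A (𝟙 s)

theorem push_comp_map (x : A ⟶ X.obj s) {t r : D} (a : s ⟶ t) (b : t ⟶ r) :
    (push M (a ≫ b)).map x ≫ X.map (a ≫ b) =
      (pushComp M a b).hom.app A ≫ (push M b).map ((push M a).map x ≫ X.map a) ≫ X.map b := by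
  rw [X.map_comp, (pushComp M a b).hom.naturality_assoc, Functor.map_comp, Category.assoc]
  rfl

/-- The map out of a free diagram given by a map out of the generator. -/
def freeDesc (x : A ⟶ X.obj s) : free s A ⟶ X :=
  freeOnDesc (fun _ a _ => (push M a).map x ≫ X.map a) fun a b _ => push_comp_map x a b

theorem freeSummand_freeDesc (x : A ⟶ X.obj s) {t : D} (a : s ⟶ t) :
    freeSummand A a ≫ (freeDesc x).app t = (push M a).map x ≫ X.map a :=
  summand_freeOnDesc (S := MapsFrom.all s) (fun _ a _ => (push M a).map x ≫ X.map a)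
    (fun a b _ => push_comp_map x a b) a (MapsFrom.mem_all a)

theorem freeUnit_freeDesc (x : A ⟶ X.obj s) : freeUnit s A ≫ (freeDesc x).app s = x := by
  rw [freeUnit, Category.assoc, freeSummand_freeDesc, X.map_id, (pushId M s).hom.naturality,
    Iso.inv_hom_id_app_assoc]
  rfl

theorem freeUnit_freeDesc_assoc (x : A ⟶ X.obj s) {Z : Fib M s} (g : X.obj s ⟶ Z) :
    freeUnit s A ≫ (freeDesc x).app s ≫ g = x ≫ g := by
  rw [← Category.assoc, freeUnit_freeDesc]

/-- Every summand of a free diagram is the image of the generator under a structure map; this gives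
the uniqueness in the universal property. It is the left unit coherence of `a_*`. -/
theorem push_freeUnit_map {t : D} (a : s ⟶ t) :
    (push M a).map (freeUnit s A) ≫ (free s A).map a = freeSummand A a := by
  have h' := pushComp_id_left a A
  have h'' : eqToHom (by rw [Category.id_comp]) ≫ freeSummand A (𝟙 s ≫ a) = freeSummand A a :=
    eqToHom_summand (S := MapsFrom.all s) (Category.id_comp a).symm (MapsFrom.mem_all a)
      (MapsFrom.mem_all _)
  rw [freeUnit, Functor.map_comp, Category.assoc, push_freeSummand_map]
  have e : (push M a).map ((pushId M s).inv.app A) ≫ (pushComp M (𝟙 s) a).inv.app A =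
      eqToHom (by rw [Category.id_comp]; rfl) := by
    have h₁ : ((pushComp M (𝟙 s) a).hom.app A ≫ (push M a).map ((pushId M s).hom.app A)) ≫
        (push M a).map ((pushId M s).inv.app A) ≫ (pushComp M (𝟙 s) a).inv.app A = 𝟙 _ := by
      rw [Category.assoc, ← Functor.map_comp_assoc, Iso.hom_inv_id_app, CategoryTheory.Functor.map_id]
      refine (congrArg (_ ≫ ·) (Category.id_comp _)).trans ?_
      exact Iso.hom_inv_id_app _ _
    rw [h', eqToHom_comp_iff] at h₁
    exact h₁.trans (Category.comp_id _)
  rw [← Category.assoc, e]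
  exact h''

theorem free_hom_ext {f g : free s A ⟶ X} (h : freeUnit s A ≫ f.app s = freeUnit s A ≫ g.app s) :
    f = g := by
  have key : ∀ (φ : free s A ⟶ X) {t : D} (a : s ⟶ t), freeSummand A a ≫ φ.app t =
      (push M a).map (freeUnit s A ≫ φ.app s) ≫ X.map a := by
    intro φ t a
    rw [← push_freeUnit_map, Functor.map_comp, Category.assoc, Category.assoc, naturality_app]
  exact freeOn_hom_ext (S := MapsFrom.all s) fun {t} a _ => (key f a).trans
    ((congrArg (fun x => (push M a).map x ≫ X.map a) h).trans (key g a).symm)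

theorem freeSummand_freeHom {B : Fib M s} (f : A ⟶ B) {t : D} (a : s ⟶ t) :
    freeSummand A a ≫ (freeHom s f).app t = (push M a).map f ≫ freeSummand B a :=
  freeIncl_freeObjMap (MapsFrom.all s) f a (MapsFrom.mem_all a)

theorem freeUnit_freeHom {B : Fib M s} (f : A ⟶ B) :
    freeUnit s A ≫ (freeHom s f).app s = f ≫ freeUnit s B := by
  have h := (pushId M s).inv.naturality_assoc f (freeSummand B (𝟙 s))
  rw [freeUnit, Category.assoc, freeSummand_freeHom, freeUnit, ← h]
  rfl

theorem freeUnit_freeHom_assoc {B Z : Fib M s} (f : A ⟶ B) (g : (free s B).obj s ⟶ Z) :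
    freeUnit s A ≫ (freeHom s f).app s ≫ g = f ≫ freeUnit s B ≫ g := by
  rw [← Category.assoc, freeUnit_freeHom, Category.assoc]

theorem freeHom_comp_freeDesc {B : Fib M s} (f : A ⟶ B) (x : B ⟶ X.obj s) :
    freeHom s f ≫ freeDesc x = freeDesc (f ≫ x) :=
  free_hom_ext (by
    rw [freeUnit_freeDesc, MDiagram.comp_app, freeUnit_freeHom_assoc, freeUnit_freeDesc])

theorem freeDesc_comp {Y : MDiagram M} (x : A ⟶ X.obj s) (f : X ⟶ Y) :
    freeDesc x ≫ f = freeDesc (x ≫ f.app s) :=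
  free_hom_ext (by
    rw [freeUnit_freeDesc, MDiagram.comp_app, freeUnit_freeDesc_assoc])

theorem freeDesc_freeUnit (f : free s A ⟶ X) : freeDesc (freeUnit s A ≫ f.app s) = f :=
  free_hom_ext (freeUnit_freeDesc _)

/-- Lifting against a map of free diagrams. -/
theorem hasLiftingProperty_freeHom_iff {B : Fib M s} (f : A ⟶ B) {Y : MDiagram M} (p : X ⟶ Y) :
    HasLiftingProperty (freeHom s f) p ↔ HasLiftingProperty f (p.app s) := by
  refine ⟨fun h => ⟨fun {x y} sq => ?_⟩, fun h => ⟨fun {x y} sq => ?_⟩⟩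
  · have sq' : CommSq (freeDesc x) (freeHom s f) p (freeDesc y) :=
      ⟨by rw [freeDesc_comp, freeHom_comp_freeDesc, sq.w]⟩
    refine ⟨⟨⟨freeUnit s B ≫ sq'.lift.app s, ?_, ?_⟩⟩⟩
    · rw [← freeUnit_freeHom_assoc, comp_app_eq sq'.fac_left, freeUnit_freeDesc]
    · rw [Category.assoc, comp_app_eq sq'.fac_right, freeUnit_freeDesc]
  · have sq' : CommSq (freeUnit s A ≫ x.app s) f (p.app s) (freeUnit s B ≫ y.app s) :=
      ⟨by rw [Category.assoc, comp_app_eq sq.w, ← freeUnit_freeHom_assoc, MDiagram.comp_app]⟩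
    refine ⟨⟨⟨freeDesc sq'.lift, ?_, ?_⟩⟩⟩
    · rw [freeHom_comp_freeDesc, sq'.fac_left, freeDesc_freeUnit]
    · rw [freeDesc_comp, sq'.fac_right, freeDesc_freeUnit]

theorem rlp_freeGenerators_iff (I : ∀ s, MorphismProperty (Fib M s)) {Y : MDiagram M} (p : X ⟶ Y) :
    (freeGenerators I).rlp p ↔ ∀ s, (I s).rlp (p.app s) := by
  constructor
  · intro h s A B f hf
    exact (hasLiftingProperty_freeHom_iff f p).1 (h _ (.mk s f hf))
  · rintro h _ _ _ ⟨s, f, hf⟩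
    exact (hasLiftingProperty_freeHom_iff f p).2 (h s f hf)

end Free

end DiagramModel

/-! ### Saturated classes, the recognition theorem and objectwise classes. -/

namespace HirschhornModel

section InverseImage

variable {C : Type*} [Category.{v} C] {E : Type*} [Category.{v} E] (G : C ⥤ E)
  [PreservesColimits G] (W : MorphismProperty E)

theorem isStableUnderCoproducts_inverseImage [MorphismProperty.IsStableUnderCoproducts.{v} W] :
    MorphismProperty.IsStableUnderCoproducts.{v} (W.inverseImage G) where
  isStableUnderCoproductsOfShape K :=
    { condition := fun X₁ X₂ c₁ c₂ h₁ h₂ f hf φ hφ =>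
        MorphismProperty.IsStableUnderColimitsOfShape.condition (W := W) (J := Discrete K)
          (X₁ ⋙ G) (X₂ ⋙ G) (G.mapCocone c₁) (G.mapCocone c₂) (isColimitOfPreserves G h₁)
          (isColimitOfPreserves G h₂) (Functor.whiskerRight f G) hf (G.map φ) fun j =>
            (G.map_comp _ _).symm.trans ((congrArg G.map (hφ j)).trans (G.map_comp _ _)) }

theorem isStableUnderCobaseChange_inverseImage [W.IsStableUnderCobaseChange] :
    (W.inverseImage G).IsStableUnderCobaseChange where
  of_isPushout sq h := W.of_isPushout (sq.map G) h

theorem isStableUnderTransfiniteComposition_inverseImage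
    [MorphismProperty.IsStableUnderTransfiniteComposition.{v} W] :
    MorphismProperty.IsStableUnderTransfiniteComposition.{v} (W.inverseImage G) where
  isStableUnderTransfiniteCompositionOfShape J _ _ _ _ := ⟨fun _ _ f h => by
    have := preservesWellOrderContinuousOfShape_of_preservesColimits G J
    exact W.transfiniteCompositionsOfShape_le J _
      (MorphismProperty.transfiniteCompositionsOfShape_map_of_preserves J G f h)⟩

variable {W}

/-- As `G` preserves colimits, the inverse image of `W` is closed under the same operations as `W`:
coproducts, cobase change and transfinite composition. -/
theorem relCells_le_inverseImage [MorphismProperty.IsStableUnderCoproducts.{v} W] [W.IsStableUnderCobaseChange]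
    [MorphismProperty.IsStableUnderTransfiniteComposition.{v} W] {K : MorphismProperty C}
    (hK : K ≤ W.inverseImage G) : relCells K ≤ W.inverseImage G := by
  have := isStableUnderCoproducts_inverseImage G W
  have := isStableUnderTransfiniteComposition_inverseImage G W
  rw [relCells, MorphismProperty.transfiniteCompositions_le_iff]
  refine (MorphismProperty.isStableUnderCobaseChange_iff_pushouts_le.1
    (isStableUnderCobaseChange_inverseImage G W)).trans' ?_
  exact MorphismProperty.pushouts_monotone (MorphismProperty.coproducts_le_iff.2 hK)

theorem llp_rlp_le_inverseImage [HasColimits C] [MorphismProperty.IsStableUnderCoproducts.{v} W]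
    [W.IsStableUnderCobaseChange] [MorphismProperty.IsStableUnderTransfiniteComposition.{v} W]
    [W.IsStableUnderRetracts] {K : MorphismProperty C}
    [MorphismProperty.HasSmallObjectArgument.{v} K] (hK : K ≤ W.inverseImage G) :
    K.rlp.llp ≤ W.inverseImage G := by
  rw [MorphismProperty.llp_rlp_of_hasSmallObjectArgument]
  exact (MorphismProperty.retracts_monotone (relCells_le_inverseImage G hK)).trans
    (MorphismProperty.retracts_le _)

end InverseImage

section Recognition

variable {C : Type u} [Category.{v} C]

/-- Kan's recognition theorem. -/
theorem exists_modelCategory [HasLimits C] [HasColimits C] (W I J : MorphismProperty C)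
    [W.HasTwoOutOfThreeProperty] [MorphismProperty.HasSmallObjectArgument.{v} I]
    [MorphismProperty.HasSmallObjectArgument.{v} J] (hIJ : I.rlp = J.rlp ⊓ W)
    (hJ : J.rlp.llp ≤ W) :
    ∃ _ : ModelCategory C, weakEquivalences C = W ∧ cofibrations C = I.rlp.llp ∧
      fibrations C = J.rlp ∧ trivialFibrations C = I.rlp ∧ IsBicompleteFunctorial C := by
  let : CategoryWithFibrations C := ⟨J.rlp⟩
  let : CategoryWithCofibrations C := ⟨I.rlp.llp⟩
  let : CategoryWithWeakEquivalences C := ⟨W⟩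
  have hW : (weakEquivalences C).HasTwoOutOfThreeProperty := ‹W.HasTwoOutOfThreeProperty›
  have h₁ : trivialFibrations C = I.rlp := hIJ.symm
  have h₂ : trivialCofibrations C = J.rlp.llp := by
    refine le_antisymm ?_ (le_inf ?_ hJ)
    -- Retract argument: in the factorization of `f` by `J`, the second factor is in `W` by two out
    -- of three, hence in `I.rlp`. So `f` lifts against it and is a retract of the first factor.
    · rintro X Y f ⟨hf, hf'⟩
      let d := MorphismProperty.factorizationData J.rlp.llp J.rlp f
      have hp : I.rlp d.p := by
        rw [hIJ]
        refine ⟨d.hp, W.of_precomp d.i d.p (hJ _ d.hi) ?_⟩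
        rw [d.fac]
        exact hf'
      have sq : CommSq d.i f d.p (𝟙 Y) := ⟨by simp⟩
      have := hf _ hp
      have r : RetractArrow f d.i :=
        { i := Arrow.homMk (𝟙 _) sq.lift (by simp)
          r := Arrow.homMk (𝟙 _) d.p (by simp) }
      exact MorphismProperty.of_retract r d.hi
    · exact MorphismProperty.antitone_llp (by
        rw [hIJ]
        exact inf_le_left)
  have w₁ : MorphismProperty.IsWeakFactorizationSystem (cofibrations C) (trivialFibrations C) := by
    rw [h₁]
    exact MorphismProperty.IsWeakFactorizationSystem.mk' I.rlp.llp I.rlp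
      fun i p hi hp => hi p hp
  have w₂ : MorphismProperty.IsWeakFactorizationSystem (trivialCofibrations C) (fibrations C) := by
    rw [h₂]
    exact MorphismProperty.IsWeakFactorizationSystem.mk' J.rlp.llp J.rlp
      fun i p hi hp => hi p hp
  let m : ModelCategory C := ModelCategory.mk' C
  refine ⟨m, rfl, rfl, rfl, h₁, inferInstance, inferInstance, ?_, ?_⟩
  · have h : MorphismProperty.HasFunctorialFactorization I.rlp.llp I.rlp := inferInstance
    have h' := congrArg (MorphismProperty.HasFunctorialFactorization I.rlp.llp) h₁
    exact h'.mpr h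
  · have : MorphismProperty.HasFunctorialFactorization J.rlp.llp J.rlp := inferInstance
    rw [← h₂] at this
    exact this

end Recognition

end HirschhornModel

namespace DiagramModel

open HirschhornModel

variable {D : Type v} [SmallCategory D] {M : Pseudofunctor (LocallyDiscrete D) Cat.{v, u}}

/-- The maps of diagrams that are objectwise in given classes. -/
def objectwise (P : ∀ s, MorphismProperty (Fib M s)) : MorphismProperty (MDiagram M) :=
  fun _ _ f => ∀ s, P s (f.app s)

theorem objectwise_hasTwoOutOfThreeProperty (P : ∀ s, MorphismProperty (Fib M s))
    [∀ s, (P s).HasTwoOutOfThreeProperty] : (objectwise P).HasTwoOutOfThreeProperty where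
  comp_mem _ _ hf hg s := (P s).comp_mem _ _ (hf s) (hg s)
  of_postcomp f g hg hfg s := (P s).of_postcomp (f.app s) (g.app s) (hg s) (hfg s)
  of_precomp f g hf hfg s := (P s).of_precomp (f.app s) (g.app s) (hf s) (hfg s)

theorem objectwise_le {P Q : ∀ s, MorphismProperty (Fib M s)} (h : ∀ s, P s ≤ Q s) :
    objectwise P ≤ objectwise Q := fun _ _ _ hf s => h s _ (hf s)

section

variable [∀ s, HasColimits (Fib M s)] [∀ {s t : D} (a : s ⟶ t), (push M a).IsLeftAdjoint]
  {P : ∀ s, MorphismProperty (Fib M s)} [∀ s, MorphismProperty.IsStableUnderCoproducts.{v} (P s)]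
  [∀ s, (P s).IsStableUnderCobaseChange]
  [∀ s, MorphismProperty.IsStableUnderTransfiniteComposition.{v} (P s)]

theorem relCells_le_objectwise {K : MorphismProperty (MDiagram M)} (hK : K ≤ objectwise P) :
    relCells K ≤ objectwise P := fun _ _ f hf s =>
  relCells_le_inverseImage (W := P s) (evaluation M s) (fun _ _ f hf => hK f hf s) f hf

theorem llp_rlp_le_objectwise [∀ s, (P s).IsStableUnderRetracts] {K : MorphismProperty (MDiagram M)}
    [MorphismProperty.HasSmallObjectArgument.{v} K] (hK : K ≤ objectwise P) :
    K.rlp.llp ≤ objectwise P := fun _ _ f hf s =>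
  llp_rlp_le_inverseImage (W := P s) (evaluation M s) (fun _ _ f hf => hK f hf s) f hf

end

end DiagramModel

/-! ### Smallness and compactness of diagrams. -/

namespace DiagramModel

open HirschhornModel

variable {D : Type v} [SmallCategory D] {M : Pseudofunctor (LocallyDiscrete D) Cat.{v, u}}
  [∀ s, HasColimits (Fib M s)] [∀ {s t : D} (a : s ⟶ t), (push M a).IsLeftAdjoint]

/-- A map out of `free s A` is a map out of `A` at `s`, and evaluation at `s` preserves the colimit
of the chain. -/
theorem chainSmall_free {P : ∀ s, MorphismProperty (Fib M s)} {R : MorphismProperty (MDiagram M)}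
    (hR : R ≤ objectwise P) {s : D} {A : Fib M s} (h : ChainSmall A (P s)) :
    ChainSmall (free s A) R := by
  obtain ⟨κ, hκ⟩ := h
  refine ⟨κ, fun μ hμ hκμ F hF hF' c hc w => ?_⟩
  have := preservesWellOrderContinuousOfShape_of_preservesColimits (evaluation M s) μ.ord.ToType
  obtain ⟨j, y, hy⟩ : ∃ j : μ.ord.ToType, ∃ y : A ⟶ (F.obj j).obj s,
      y ≫ (c.ι.app j).app s = freeUnit s A ≫ w.app s := hκ μ hμ hκμ (F ⋙ evaluation M s) inferInstance (fun j => hR _ (hF' j) s)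
    _ (isColimitOfPreserves (evaluation M s) hc) (freeUnit s A ≫ w.app s)
  refine ⟨j, freeDesc y, free_hom_ext ?_⟩
  rw [MDiagram.comp_app, freeUnit_freeDesc_assoc, hy]

theorem tested_free {I : ∀ s, MorphismProperty (Fib M s)} [∀ s, MorphismProperty.IsSmall.{v} (I s)]
    [∀ s, HasPullbacks (Fib M s)]
    (hI : ∀ s ⦃A B : Fib M s⦄ (f : A ⟶ B), I s f → IsSmallRelTo A (relCells (I s)))
    {γ : Cardinal.{v}} (hγ : Cardinal.aleph0 ≤ γ) {s : D} {A : Fib M s}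
    (hA : CompactWith γ A (I s)) :
    Tested (evaluation M) (fun t => (I t).rlp.llp) γ (free s A) := by
  intro T Z hZ hZ' hacc w
  obtain ⟨X, x, hx⟩ := hacc s
  obtain ⟨a, y, hy⟩ : ∃ a : Z.Λ, ∃ y : A ⟶ (Z.obj a).obj s,
      y ≫ (Z.map a).app s = freeUnit s A ≫ w.app s := good_of_compactWith (hI s) hγ (hZ'.mapFamily (hZ s)) hx hA
    (freeUnit s A ≫ w.app s)
  refine ⟨a, freeDesc y, free_hom_ext ?_⟩
  rw [MDiagram.comp_app, freeUnit_freeDesc_assoc, hy]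

theorem isStableUnderTransfiniteComposition_objectwise (P : ∀ s, MorphismProperty (Fib M s))
    [∀ s, MorphismProperty.IsStableUnderTransfiniteComposition.{v} (P s)] :
    MorphismProperty.IsStableUnderTransfiniteComposition.{v} (objectwise P) where
  isStableUnderTransfiniteCompositionOfShape J _ _ _ _ := ⟨fun _ _ f hf s => by
    have := isStableUnderTransfiniteComposition_inverseImage (evaluation M s) (P s)
    refine MorphismProperty.transfiniteCompositionsOfShape_le
      (W := (P s).inverseImage (evaluation M s)) J f ?_
    exact MorphismProperty.transfiniteCompositionsOfShape_monotone J
      (fun _ _ _ h => h s) _ hf⟩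

variable {I : ∀ s, MorphismProperty (Fib M s)} [∀ s, MorphismProperty.IsSmall.{v} (I s)]
  [∀ s, HasPullbacks (Fib M s)]
  (hI : ∀ s ⦃A B : Fib M s⦄ (f : A ⟶ B), I s f → IsSmallRelTo A (relCells (I s)))
  (hc : ∀ s ⦃A B : Fib M s⦄ (f : A ⟶ B), I s f → IsCompactRelTo B (I s))

include hI hc in
-- The bound dominates those at all objects of `D`, and also the cardinality of `D`, so that choices
-- made at each object have an upper bound in a directed family.
theorem exists_objectwise_bound {W V : MDiagram M} (g : W ⟶ V)
    (hg : objectwise (fun t => (I t).rlp.llp) g) :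
    ∃ δ : Cardinal.{v}, Cardinal.mk D ≤ δ ∧ ∀ γ, δ ≤ γ → ∀ (t : D) {T : Fib M t}
      {Z : MonoFamily T}, Z.Directed γ → ∀ {X : Fib M t} {x : X ⟶ T},
        Accessible (I t).rlp.llp Z x → ∀ b : V.obj t ⟶ T, Z.Good (g.app t ≫ b) → Z.Good b := by
  choose δ hδ using fun t => exists_good_of_comp_good (hI t) (hc t) (g.app t) (hg t)
  obtain ⟨κ, -, hκ⟩ := exists_cardinal_forall_le δ
  exact ⟨max (Cardinal.mk D) κ, le_max_left _ _, fun γ hγ t => hδ t γ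
    ((hκ t).trans ((le_max_right _ _).trans hγ))⟩

/-- The object `Y` is tested for all large enough cardinals. -/
def EventuallyTested (I : ∀ s, MorphismProperty (Fib M s)) (Y : MDiagram M) : Prop :=
  ∃ γ₀ : Cardinal.{v}, ∀ γ, γ₀ ≤ γ → Tested (evaluation M) (fun t => (I t).rlp.llp) γ Y

include hI in
theorem eventuallyTested_free {s : D} {A : Fib M s} (hA : IsCompactRelTo A (I s)) :
    EventuallyTested I (free s A) := by
  obtain ⟨γ₀, hγ₀⟩ := hA
  exact ⟨max Cardinal.aleph0 γ₀, fun γ hγ => tested_free hI ((le_max_left _ _).trans hγ)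
    (CompactWith.mono ((le_max_right _ _).trans hγ) hγ₀)⟩

include hI hc in
-- If `g ≫ w` is good, relative compactness of `g.app t` makes each `w.app t` good, with a member
-- depending on `t`. There are at most `γ` objects, so one member serves for all, and the objectwise
-- factorizations assemble.
theorem EventuallyTested.of_objectwise {W V : MDiagram M} (g : W ⟶ V)
    (hg : objectwise (fun t => (I t).rlp.llp) g) (hW : EventuallyTested I W) :
    EventuallyTested I V := by
  obtain ⟨δ, hD, hδ⟩ := exists_objectwise_bound hI hc g hg
  obtain ⟨γ₀, hγ₀⟩ := hW
  refine ⟨max δ γ₀, fun γ hγ T Z hZ hZ' hacc w => ?_⟩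
  have hδγ := (le_max_left _ _).trans hγ
  have hgood := hγ₀ γ ((le_max_right _ _).trans hγ) T Z hZ hZ' hacc (g ≫ w)
  have key : ∀ t, (Z.mapFamily (evaluation M t) (hZ t)).Good (w.app t) := by
    intro t
    obtain ⟨X, x, hx⟩ := hacc t
    exact hδ γ hδγ t (hZ'.mapFamily (hZ t)) hx (w.app t)
      (hgood.mapFamily (G := evaluation M t) (hZ t))
  have key' : ∀ t, ∃ a : Z.Λ, ∃ y : V.obj t ⟶ (Z.obj a).obj t, y ≫ (Z.map a).app t = w.app t := key
  choose a y hy using key'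
  obtain ⟨b, hb⟩ := hZ' D (hD.trans hδγ) a
  refine ⟨b, exists_factor_of_objectwise (Z.map b) (fun s => hZ s b) w fun t => ?_⟩
  obtain ⟨k, hk⟩ := hb t
  exact ⟨y t ≫ k.app t, by rw [Category.assoc, comp_app_eq hk, hy]⟩

include hI hc in
theorem chainSmall_of_objectwise (hm : ∀ s, (I s).rlp.llp ≤ MorphismProperty.monomorphisms _)
    {R : MorphismProperty (MDiagram M)} (hR : R ≤ objectwise (fun t => (I t).rlp.llp))
    {W V : MDiagram M} (g : W ⟶ V) (hg : objectwise (fun t => (I t).rlp.llp) g)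
    (hW : ChainSmall W R) : ChainSmall V R := by
  obtain ⟨δ, hD, hδ⟩ := exists_objectwise_bound hI hc g hg
  obtain ⟨κ, hκ⟩ := hW
  -- The successor makes the bound strict, `δ < μ`, so that families of at most `δ` stages of the
  -- chain are bounded. The stages then play the role of the small subobjects.
  refine ⟨max (Order.succ δ) κ, fun μ hμ hκμ F hF hF' c hc w => ?_⟩
  have hδμ : δ < μ := (Order.lt_succ δ).trans_le ((le_max_left _ _).trans hκμ)
  obtain ⟨j, y, hy⟩ := hκ μ hμ ((le_max_right _ _).trans hκμ) F hF hF' c hc (g ≫ w)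
  let := orderBotToType hμ
  have key : ∀ t, ∃ j : μ.ord.ToType, ∃ y : V.obj t ⟶ (F.obj j).obj t,
      y ≫ (c.ι.app j).app t = w.app t := by
    intro t
    have := preservesWellOrderContinuousOfShape_of_preservesColimits (evaluation M t) μ.ord.ToType
    have hct := isColimitOfPreserves (evaluation M t) hc
    have hmt := mono_of_chain hμ (F ⋙ evaluation M t) _ hct (I t).rlp.llp (hm t)
      fun j => hR _ (hF' j) t
    have hdir := chainFamily_directed hμ (F ⋙ evaluation M t) _ hmt hδμ
    have hacc := chainFamily_accessible (F ⋙ evaluation M t) _ hct hmt (I t).rlp.llp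
      fun j => hR _ (hF' j) t
    exact hδ δ le_rfl t hdir hacc (w.app t) ⟨j, y.app t, comp_app_eq hy t⟩
  choose j' y' hy' using key
  obtain ⟨b, hb⟩ := exists_upper_bound hμ (hD.trans_lt hδμ) j'
  have hmono : ∀ t, Mono ((c.ι.app b).app t) := by
    intro t
    have := preservesWellOrderContinuousOfShape_of_preservesColimits (evaluation M t) μ.ord.ToType
    exact mono_of_chain hμ (F ⋙ evaluation M t) _ (isColimitOfPreserves (evaluation M t) hc)
      (I t).rlp.llp (hm t) (fun j => hR _ (hF' j) t) b
  refine ⟨b, exists_factor_of_objectwise _ hmono w fun t => ?_⟩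
  exact ⟨y' t ≫ (F.map (homOfLE (hb t))).app t, by
    rw [Category.assoc, comp_app_eq (c.w (homOfLE (hb t))), hy']⟩

theorem isSmallRelTo_of_chainSmall {P : ∀ s, MorphismProperty (Fib M s)}
    (hm : ∀ s, (P s).rlp.llp ≤ MorphismProperty.monomorphisms _)
    {K : MorphismProperty (MDiagram M)} (hK : K ≤ objectwise (fun t => (P t).rlp.llp))
    {W : MDiagram M} (hW : ChainSmall W (relCells K)) : IsSmallRelTo W (relCells K) := by
  have := isStableUnderTransfiniteComposition_objectwise (M := M) (fun t => (P t).rlp.llp)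
  exact hW.isSmallRelTo _ (fun _ _ f hf => mono_of_objectwise f fun s => hm s _ (hf s))
    (relCells_le_objectwise hK)

include hI hc in
/-- Tested domains and codomains of a set of maps that are objectwise in the saturation of `I`
are compact. -/
theorem isCompactRelTo_of_eventuallyTested
    (hm : ∀ s, (I s).rlp.llp ≤ MorphismProperty.monomorphisms _)
    {K : MorphismProperty (MDiagram M)} [MorphismProperty.IsSmall.{v} K]
    [MorphismProperty.HasSmallObjectArgument.{v} K]
    (hK : K ≤ objectwise (fun t => (I t).rlp.llp))
    (hdom : ∀ ⦃X Y : MDiagram M⦄ (f : X ⟶ Y), K f → EventuallyTested I X)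
    {W : MDiagram M} (hW : EventuallyTested I W) : IsCompactRelTo W K := by
  choose γ hγ using fun f : K.toSet => hdom f.1.hom f.2
  obtain ⟨δ, hδ, hδ'⟩ := exists_cardinal_forall_le γ
  obtain ⟨γ', hγ'⟩ := hW
  have hK' : K.rlp.llp ≤ objectwise (fun t => (I t).rlp.llp) := llp_rlp_le_objectwise hK
  exact ⟨max δ γ', Tested.compactWith
    (fun _ _ f hf => mono_of_objectwise f fun s => hm s _ (hK' _ hf s))
    (fun s _ _ f hf => hK _ hf s) (fun s _ _ f hf => hm s _ (hK' _ hf s))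
    (fun _ _ f hf => hγ ⟨Arrow.mk f, hf⟩ _ ((hδ' _).trans (le_max_left _ _)))
    (hδ.trans (le_max_left _ _)) (hγ' _ (le_max_right _ _))⟩

end DiagramModel

/-! ### Effective monomorphisms and the existence theorem for general generators. -/

namespace HirschhornModel

section ModelCategory

variable {C : Type u} [Category.{v} C] [ModelCategory C]

theorem IsCofibrantlyGeneratedBy.cofibrations_eq {I J : MorphismProperty C}
    (h : IsCofibrantlyGeneratedBy I J) : cofibrations C = I.rlp.llp := by
  rw [← h.trivialFibrations_eq]
  exact (MorphismProperty.llp_eq_of_wfs _ _).symm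

theorem IsCofibrantlyGeneratedBy.trivialCofibrations_eq {I J : MorphismProperty C}
    (h : IsCofibrantlyGeneratedBy I J) : trivialCofibrations C = J.rlp.llp := by
  rw [← h.fibrations_eq]
  exact (MorphismProperty.llp_eq_of_wfs _ _).symm

end ModelCategory

section EffectiveMono

variable {C : Type u} [Category.{v} C] [HasPushouts C] {A B : C} {f : A ⟶ B}

theorem IsEffectiveMono.mono (h : IsEffectiveMono f) : Mono f :=
  mono_of_isLimit_fork h.some

theorem IsEffectiveMono.exists_factor (h : IsEffectiveMono f) {P : C} {i j : B ⟶ P}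
    (sq : IsPushout f f i j) {W : C} (w : W ⟶ B) (hw : w ≫ i = w ≫ j) : ∃ y, y ≫ f = w := by
  have hw' : w ≫ pushout.inl f f = w ≫ pushout.inr f f := by
    rw [← sq.inl_isoPushout_hom, ← sq.inr_isoPushout_hom, ← Category.assoc, hw, Category.assoc]
  exact ⟨Fork.IsLimit.lift h.some w hw', Fork.IsLimit.lift_ι h.some⟩

theorem isEffectiveMono_of_exists_factor (hf : Mono f)
    (h : ∀ ⦃W : C⦄ (w : W ⟶ B), w ≫ pushout.inl f f = w ≫ pushout.inr f f → ∃ y, y ≫ f = w) :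
    IsEffectiveMono f :=
  ⟨Fork.IsLimit.mk _ (fun s => (h s.ι s.condition).choose)
    (fun s => (h s.ι s.condition).choose_spec)
    fun s _ hm => (cancel_mono f).1 (hm.trans (h s.ι s.condition).choose_spec.symm)⟩

end EffectiveMono

end HirschhornModel

namespace DiagramModel

open HirschhornModel

variable {D : Type v} [SmallCategory D]

section

variable {M : Pseudofunctor (LocallyDiscrete D) Cat.{v, u}} [∀ s, HasColimits (Fib M s)]
  [∀ {s t : D} (a : s ⟶ t), (push M a).IsLeftAdjoint]

/-- Evaluation preserves the pushout, so a map that equalizes the two inclusions factors objectwise,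
and such factorizations assemble. -/
theorem isEffectiveMono_of_objectwise {X Y : MDiagram M} (f : X ⟶ Y)
    (hf : ∀ s, IsEffectiveMono (f.app s)) : IsEffectiveMono f := by
  refine isEffectiveMono_of_exists_factor (mono_of_objectwise f fun s => (hf s).mono) fun W w hw => ?_
  refine exists_factor_of_objectwise f (fun s => (hf s).mono) w fun s => ?_
  exact (hf s).exists_factor ((IsPushout.of_hasPushout f f).map (evaluation M s)) (w.app s)
    (congrArg (fun k => MDiagram.Hom.app k s) hw)

end

variable (M : Pseudofunctor (LocallyDiscrete D) Cat.{v, u}) [∀ s, ModelCategory (Fib M s)]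
  [IsDiagramOfModelCategories M]

instance hasLimits_fib (s : D) : HasLimits (Fib M s) :=
  (IsDiagramOfModelCategories.isBicompleteFunctorial (M := M) s).hasLimits

/-- A construction of sets of maps of diagrams from sets of maps of all the `M(s)`, with the
properties needed to generate a model structure with objectwise weak equivalences. -/
structure IsGeneratorConstruction
    (K : (∀ s, MorphismProperty (Fib M s)) → MorphismProperty (MDiagram M)) : Prop where
  isSmall (I) : (∀ s, MorphismProperty.IsSmall.{v} (I s)) → MorphismProperty.IsSmall.{v} (K I)
  cofibrations (I) : (∀ s, I s ≤ cofibrations (Fib M s)) →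
    K I ≤ objectwise fun s => cofibrations (Fib M s)
  trivialCofibrations (I) : (∀ s, I s ≤ trivialCofibrations (Fib M s)) →
    K I ≤ objectwise fun s => trivialCofibrations (Fib M s)
  rlp_le (I J : ∀ s, MorphismProperty (Fib M s)) : (∀ s, IsCofibrantlyGeneratedBy (I s) (J s)) →
    (K J).rlp ≤ objectwise fun s => fibrations (Fib M s)
  rlp_congr (I I') : (∀ s, (I s).rlp = (I' s).rlp) → (K I).rlp = (K I').rlp
  exists_free (I) : (∀ s, I s ≤ HomotopicalAlgebra.cofibrations (Fib M s)) →
    ∀ ⦃X Y : MDiagram M⦄ (f : X ⟶ Y), K I f → ∃ (s : D) (A B : Fib M s) (f₀ : A ⟶ B), I s f₀ ∧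
      (∃ g : free s A ⟶ X, objectwise (fun s => HomotopicalAlgebra.cofibrations (Fib M s)) g) ∧
      ∃ g : free s B ⟶ Y, objectwise (fun s => HomotopicalAlgebra.cofibrations (Fib M s)) g
  rlp_eq (I J) : (∀ s, IsCofibrantlyGeneratedBy (I s) (J s)) →
    MorphismProperty.HasSmallObjectArgument.{v} (K I) →
    MorphismProperty.HasSmallObjectArgument.{v} (K J) →
      (K I).rlp = (K J).rlp ⊓ objectwise fun s => weakEquivalences (Fib M s)

variable {M}

/-- The chosen `I`, `J` come from cellularity and carry all arguments by relative compactness.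
Smallness is proved for arbitrary generating sets as well, since the final clause ranges over them.
-/
theorem exists_modelCategory_of_generators
    {K : (∀ s, MorphismProperty (Fib M s)) → MorphismProperty (MDiagram M)}
    (hK : IsGeneratorConstruction M K) (hproper : ∀ s, IsProper (Fib M s))
    (hcellular : ∀ s, IsCellular (Fib M s)) :
    ∃ I J : ∀ s, MorphismProperty (Fib M s), (∀ s, IsCofibrantlyGeneratedBy (I s) (J s)) ∧
      MorphismProperty.HasSmallObjectArgument.{v} (K I) ∧
      ∃ _ : ModelCategory (MDiagram M),
        weakEquivalences (MDiagram M) = (objectwise fun s => weakEquivalences (Fib M s)) ∧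
        cofibrations (MDiagram M) = (K I).rlp.llp ∧ fibrations (MDiagram M) = (K J).rlp ∧
        IsBicompleteFunctorial (MDiagram M) ∧ IsProper (MDiagram M) ∧ IsCellular (MDiagram M) ∧
        ∀ I J : ∀ s : D, MorphismProperty (Fib M s),
          (∀ s : D, IsCofibrantlyGeneratedBy (I s) (J s)) →
            IsCofibrantlyGeneratedBy (K I) (K J) := by
  choose I J hgen hcomp hJI heff using hcellular
  have hcof : (fun s => cofibrations (Fib M s)) = fun s => (I s).rlp.llp :=
    funext fun s => (hgen s).cofibrations_eq
  have hm' : ∀ s, cofibrations (Fib M s) ≤ MorphismProperty.monomorphisms (Fib M s) :=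
    fun s _ _ f hf => (heff s f hf).mono
  have hm : ∀ s, (I s).rlp.llp ≤ MorphismProperty.monomorphisms (Fib M s) := fun s => by
    rw [← (hgen s).cofibrations_eq]
    exact hm' s
  have htc : ∀ s, trivialCofibrations (Fib M s) ≤ cofibrations (Fib M s) :=
    fun s => trivialCofibrations_sub_cofibrations _
  have := fun s => (hgen s).small_I
  have hI := fun s => (hgen s).domain_I
  have hc := fun s (A B : Fib M s) (f : A ⟶ B) (hf : I s f) => (hcomp s f hf).2
  -- smallness of the domains
  have small : ∀ (G L : ∀ s, MorphismProperty (Fib M s)),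
      (∀ s, G s ≤ cofibrations (Fib M s)) → (∀ s, (L s).rlp.llp ≤ cofibrations (Fib M s)) →
      (∀ s ⦃A B : Fib M s⦄ (f : A ⟶ B), G s f → ChainSmall A (L s).rlp.llp) →
      ∀ K' : MorphismProperty (MDiagram M), (K' ≤ objectwise fun s => (L s).rlp.llp) →
      ∀ ⦃X Y : MDiagram M⦄ (f : X ⟶ Y), K G f → IsSmallRelTo X (relCells K') := by
    intro G L hG hL hsmall K' hK' X Y f hf
    obtain ⟨s, A, B, f₀, hf₀, ⟨g, hg⟩, -⟩ := hK.exists_free G hG f hf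
    have hR : relCells K' ≤ objectwise fun s => (L s).rlp.llp := relCells_le_objectwise hK'
    refine isSmallRelTo_of_chainSmall (fun s => (hL s).trans (hm' s)) hK' ?_
    rw [hcof] at hg
    -- The passage along the objectwise cofibration `g` uses the compactness of the cellular `I`;
    -- the sets `G` and `L` need not satisfy any compactness.
    refine chainSmall_of_objectwise hI hc hm (hR.trans (objectwise_le fun s => ?_)) g hg
      (chainSmall_free hR (hsmall s f₀ hf₀))
    rw [← (hgen s).cofibrations_eq]
    exact hL s
  have gens : ∀ (I J : ∀ s, MorphismProperty (Fib M s)),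
      (∀ s, IsCofibrantlyGeneratedBy (I s) (J s)) →
      (K I ≤ objectwise fun s => (I s).rlp.llp) ∧ (K J ≤ objectwise fun s => (J s).rlp.llp) := by
    intro I J h
    have h₁ : (fun s => cofibrations (Fib M s)) = fun s => (I s).rlp.llp :=
      funext fun s => (h s).cofibrations_eq
    have h₂ : (fun s => trivialCofibrations (Fib M s)) = fun s => (J s).rlp.llp :=
      funext fun s => (h s).trivialCofibrations_eq
    constructor
    · rw [← h₁]
      refine hK.cofibrations I fun s => ?_
      rw [(h s).cofibrations_eq]
      exact MorphismProperty.le_llp_rlp _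
    · rw [← h₂]
      refine hK.trivialCofibrations J fun s => ?_
      rw [(h s).trivialCofibrations_eq]
      exact MorphismProperty.le_llp_rlp _
  have domains : ∀ (I J : ∀ s, MorphismProperty (Fib M s)),
      (∀ s, IsCofibrantlyGeneratedBy (I s) (J s)) →
      (∀ ⦃X Y : MDiagram M⦄ (f : X ⟶ Y), K I f → IsSmallRelTo X (relCells (K I))) ∧
      (∀ ⦃X Y : MDiagram M⦄ (f : X ⟶ Y), K J f → IsSmallRelTo X (relCells (K J))) := by
    intro I J h
    have hI' : ∀ s, (I s).rlp.llp ≤ cofibrations (Fib M s) :=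
      fun s => (h s).cofibrations_eq.ge
    have hJ' : ∀ s, (J s).rlp.llp ≤ cofibrations (Fib M s) :=
      fun s => (h s).trivialCofibrations_eq.ge.trans (htc s)
    have := fun s => (h s).small_I
    have := fun s => (h s).small_J
    exact ⟨small I I (fun s => (MorphismProperty.le_llp_rlp _).trans (hI' s)) hI'
      (fun s A B f hf => ((h s).domain_I f hf).chainSmall (h s).domain_I
        ((hI' s).trans (hm' s))) _ (gens I J h).1,
      small J J (fun s => (MorphismProperty.le_llp_rlp _).trans (hJ' s)) hJ'
      (fun s A B f hf => ((h s).domain_J f hf).chainSmall (h s).domain_J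
        ((hJ' s).trans (hm' s))) _ (gens I J h).2⟩
  have := hK.isSmall I fun s => (hgen s).small_I
  have := hK.isSmall J fun s => (hgen s).small_J
  have soI := hasSmallObjectArgument (domains I J hgen).1
  have soJ := hasSmallObjectArgument (domains I J hgen).2
  have hIJ := hK.rlp_eq I J hgen soI soJ
  have hW := objectwise_hasTwoOutOfThreeProperty (M := M) fun s => weakEquivalences (Fib M s)
  have hcofI : (K I).rlp.llp ≤ objectwise fun s => cofibrations (Fib M s) := by
    rw [hcof]
    exact llp_rlp_le_objectwise (gens I J hgen).1
  have htcofJ : (K J).rlp.llp ≤ objectwise fun s => weakEquivalences (Fib M s) :=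
    (llp_rlp_le_objectwise (gens I J hgen).2).trans (objectwise_le fun s => by
      rw [← (hgen s).trivialCofibrations_eq]
      exact trivialCofibrations_sub_weakEquivalences _)
  have hfibJ : (K J).rlp ≤ objectwise fun s => fibrations (Fib M s) := hK.rlp_le I J hgen
  obtain ⟨m, hw, hcf, hfb, htf, hbi⟩ :=
    exists_modelCategory (objectwise fun s => weakEquivalences (Fib M s)) (K I) (K J) hIJ htcofJ
  -- In each `M(s)` other generating sets have the same right lifting classes as the cellular ones,
  -- and `rlp_congr` carries this over to diagrams.
  have hgenK : ∀ I J : ∀ s : D, MorphismProperty (Fib M s),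
      (∀ s : D, IsCofibrantlyGeneratedBy (I s) (J s)) →
        IsCofibrantlyGeneratedBy (K I) (K J) := by
    intro I' J' h
    exact
      { small_I := hK.isSmall I' fun s => (h s).small_I
        small_J := hK.isSmall J' fun s => (h s).small_J
        domain_I := (domains I' J' h).1
        domain_J := (domains I' J' h).2
        trivialFibrations_eq := by
          rw [htf]
          exact hK.rlp_congr _ _ fun s => by
            rw [← (hgen s).trivialFibrations_eq, ← (h s).trivialFibrations_eq]
        fibrations_eq := by
          rw [hfb]
          exact hK.rlp_congr _ _ fun s => by
            rw [← (hgen s).fibrations_eq, ← (h s).fibrations_eq] }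
  have tested : ∀ ⦃X Y : MDiagram M⦄ (f : X ⟶ Y), K I f →
      EventuallyTested I X ∧ EventuallyTested I Y := by
    intro X Y f hf
    obtain ⟨s, A, B, f₀, hf₀, ⟨g, hg⟩, g', hg'⟩ := hK.exists_free I (fun s => by
      rw [(hgen s).cofibrations_eq]
      exact MorphismProperty.le_llp_rlp _) f hf
    rw [hcof] at hg hg'
    exact ⟨(eventuallyTested_free hI (hcomp s f₀ hf₀).1).of_objectwise hI hc g hg,
      (eventuallyTested_free hI (hcomp s f₀ hf₀).2).of_objectwise hI hc g' hg'⟩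
  refine ⟨I, J, hgen, soI, m, hw, hcf, hfb, hbi, ⟨?_, ?_⟩, ⟨K I, K J, hgenK I J hgen, ?_, ?_, ?_⟩,
    hgenK⟩
  · intro A B X Y w i j w' sq h₁ h₂
    rw [hw] at h₁ ⊢
    rw [hcf] at h₂
    exact fun s => (hproper s).left _ _ _ _ (sq.map (evaluation M s)) (h₁ s) (hcofI _ h₂ s)
  · intro A B X Y w' q p w sq h₁ h₂
    rw [hw] at h₁ ⊢
    rw [hfb] at h₂
    exact fun s => (hproper s).right _ _ _ _ (sq.map (evaluation M s)) (h₁ s) (hfibJ _ h₂ s)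
  · exact fun X Y f hf =>
      ⟨isCompactRelTo_of_eventuallyTested hI hc hm (gens I J hgen).1
        (fun _ _ f hf => (tested f hf).1) (tested f hf).1,
      isCompactRelTo_of_eventuallyTested hI hc hm (gens I J hgen).1
        (fun _ _ f hf => (tested f hf).1) (tested f hf).2⟩
  · refine small J I (fun s => ?_) (fun s => (hgen s).cofibrations_eq.ge) (fun s A B f hf => ?_) _
      (gens I J hgen).1
    · refine le_trans ?_ (htc s)
      rw [(hgen s).trivialCofibrations_eq]
      exact MorphismProperty.le_llp_rlp _
    · exact (hJI s f hf).chainSmall (hI s) (hm s)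
  · intro X Y f hf
    rw [hcf] at hf
    exact isEffectiveMono_of_objectwise f fun s => heff s _ (hcofI _ hf s)

end DiagramModel

/-! ### The projective case. -/

namespace DiagramModel

open HirschhornModel

variable {D : Type v} [SmallCategory D] {M : Pseudofunctor (LocallyDiscrete D) Cat.{v, u}}

/-- The value at `t` is the coproduct of the maps `a_* f`, so a lift is chosen on each summand. -/
theorem objectwise_freeOnMap [∀ s, HasColimits (Fib M s)]
    [∀ {s t : D} (a : s ⟶ t), (push M a).IsLeftAdjoint] (P : ∀ s, MorphismProperty (Fib M s))
    {s : D} (S : MapsFrom s) {A B : Fib M s} (f : A ⟶ B)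
    (hf : ∀ {t : D} (a : s ⟶ t), (P t).rlp.llp ((push M a).map f)) :
    objectwise (fun t => (P t).rlp.llp) (freeOnMap S f) := fun t X Y p hp => by
  refine ⟨fun {x y} sq => ?_⟩
  have sq' : ∀ (a : s ⟶ t) (ha : S.mem a), CommSq (summand S A a ha ≫ x) ((push M a).map f) p
      (summand S B a ha ≫ y) := fun a ha =>
    ⟨by rw [Category.assoc, sq.w, ← Category.assoc, summand_freeOnMap, Category.assoc]⟩
  have := fun a => hf a p hp
  refine ⟨⟨⟨freeOnObjDesc fun a ha => (sq' a ha).lift, ?_, ?_⟩⟩⟩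
  · refine freeObj_hom_ext fun a ha => ?_
    have h₁ := congrArg (· ≫ freeOnObjDesc fun a ha => (sq' a ha).lift) (summand_freeOnMap f a ha)
    refine (Category.assoc _ _ _).symm.trans (h₁.trans ?_)
    refine (Category.assoc _ _ _).trans ?_
    rw [summand_freeOnObjDesc]
    exact (sq' a ha).fac_left
  · refine freeObj_hom_ext fun a ha => ?_
    refine (Category.assoc _ _ _).symm.trans ?_
    refine (congrArg (· ≫ p) (summand_freeOnObjDesc _ a ha)).trans ?_
    exact (sq' a ha).fac_right

section ModelCategory

variable [∀ s, ModelCategory (Fib M s)] [IsDiagramOfModelCategories M]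

theorem cofibrations_eq_llp_rlp (s : D) :
    cofibrations (Fib M s) = (cofibrations (Fib M s)).rlp.llp := by
  rw [MorphismProperty.rlp_eq_of_wfs (cofibrations (Fib M s)) (trivialFibrations (Fib M s)),
    MorphismProperty.llp_eq_of_wfs (cofibrations (Fib M s)) (trivialFibrations (Fib M s))]

theorem trivialCofibrations_eq_llp_rlp (s : D) :
    trivialCofibrations (Fib M s) = (trivialCofibrations (Fib M s)).rlp.llp := by
  rw [MorphismProperty.rlp_eq_of_wfs (trivialCofibrations (Fib M s)) (fibrations (Fib M s)),
    MorphismProperty.llp_eq_of_wfs (trivialCofibrations (Fib M s)) (fibrations (Fib M s))]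

theorem objectwise_cofibrations_freeOnMap {s : D} (S : MapsFrom s) {A B : Fib M s} (f : A ⟶ B)
    (hf : cofibrations (Fib M s) f) :
    objectwise (fun t => cofibrations (Fib M t)) (freeOnMap S f) := by
  have h := objectwise_freeOnMap (fun t => cofibrations (Fib M t)) S f fun {t} a => by
    rw [← cofibrations_eq_llp_rlp]
    exact IsDiagramOfModelCategories.map_cofibration a f hf
  intro t
  rw [cofibrations_eq_llp_rlp]
  exact h t

theorem objectwise_trivialCofibrations_freeOnMap {s : D} (S : MapsFrom s) {A B : Fib M s}
    (f : A ⟶ B) (hf : trivialCofibrations (Fib M s) f) :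
    objectwise (fun t => trivialCofibrations (Fib M t)) (freeOnMap S f) := by
  have h := objectwise_freeOnMap (fun t => trivialCofibrations (Fib M t)) S f fun {t} a => by
    rw [← trivialCofibrations_eq_llp_rlp]
    exact IsDiagramOfModelCategories.map_trivialCofibration a f hf
  intro t
  rw [trivialCofibrations_eq_llp_rlp]
  exact h t

theorem objectwise_cofibrations_id (X : MDiagram M) :
    objectwise (fun t => cofibrations (Fib M t)) (𝟙 X) :=
  fun t => (cofibrations (Fib M t)).id_mem (X.obj t)

theorem isSmall_freeGenerators (I : ∀ s, MorphismProperty (Fib M s))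
    (hI : ∀ s, MorphismProperty.IsSmall.{v} (I s)) :
    MorphismProperty.IsSmall.{v} (freeGenerators I) where
  small_toSet := by
    have := hI
    refine small_of_surjective (α := Σ s, (I s).toSet)
      (f := fun x => ⟨Arrow.mk (freeHom x.1 x.2.1.hom), ⟨x.1, x.2.1.hom, x.2.2⟩⟩) ?_
    rintro ⟨⟨X, Y, g⟩, hg⟩
    obtain ⟨s, f, hf⟩ : freeGenerators I g := hg
    exact ⟨⟨s, Arrow.mk f, hf⟩, rfl⟩

/-- Right lifting against free maps is objectwise by adjunction, so `rlp_eq` is the description of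
trivial fibrations in each `M(s)`. Domains and codomains are themselves free, so identities serve in
`exists_free`. -/
theorem isGeneratorConstruction_freeGenerators : IsGeneratorConstruction M freeGenerators where
  isSmall := isSmall_freeGenerators
  cofibrations := by
    rintro I hI _ _ _ ⟨s, f, hf⟩
    exact objectwise_cofibrations_freeOnMap _ f (hI s f hf)
  trivialCofibrations := by
    rintro I hI _ _ _ ⟨s, f, hf⟩
    exact objectwise_trivialCofibrations_freeOnMap _ f (hI s f hf)
  rlp_le I J h _ _ p hp s := (h s).fibrations_eq.ge _ ((rlp_freeGenerators_iff J p).1 hp s)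
  rlp_congr I I' h := by
    ext X Y p
    rw [rlp_freeGenerators_iff, rlp_freeGenerators_iff]
    simp only [h]
  exists_free := by
    rintro I - _ _ _ ⟨s, f, hf⟩
    exact ⟨s, _, _, f, hf, ⟨_, objectwise_cofibrations_id _⟩, ⟨_, objectwise_cofibrations_id _⟩⟩
  rlp_eq I J h _ _ := by
    ext X Y p
    refine (rlp_freeGenerators_iff I p).trans (Iff.trans ?_
      (and_congr_left' (rlp_freeGenerators_iff J p)).symm)
    rw [objectwise, ← forall_and]
    refine forall_congr' fun s => ?_
    rw [← (h s).trivialFibrations_eq, ← (h s).fibrations_eq]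
    exact Iff.rfl

end ModelCategory

end DiagramModel

/-! ### Compatible families by recursion, and representability by left adjoints. -/

theorem WellFounded.exists_compatible_family {ι : Type*} {r : ι → ι → Prop} (wf : WellFounded r)
    {α : ι → Type*} (C : ∀ i j, r j i → α i → α j → Prop)
    (step : ∀ i (f : ∀ j, r j i → α j),
      (∀ j k (hj : r j i) (hk : r k i) (h : r k j), C j k h (f j hj) (f k hk)) →
        ∃ a, ∀ j (hj : r j i), C i j hj a (f j hj)) :
    ∃ f : ∀ i, α i, ∀ i j (h : r j i), C i j h (f i) (f j) := by
  classical
  -- A next value exists only if the earlier choices are compatible, which the recursion cannot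
  -- know. Hence it takes values in `Option`, and an induction proves existence and compatibility
  -- together.
  let step' : ∀ i, (∀ j, r j i → Option (α j)) → Option (α i) := fun i f =>
    if h : ∃ a, ∀ j (hj : r j i) b, f j hj = some b → C i j hj a b then some h.choose else none
  let F : ∀ i, Option (α i) := wf.fix step'
  have hF : ∀ i, F i = step' i fun j _ => F j := fun i => wf.fix_eq step' i
  have key : ∀ i, (∃ a, F i = some a) ∧
      ∀ j (h : r j i) a b, F i = some a → F j = some b → C i j h a b := by
    intro i
    induction i using wf.induction with
    | h i ih =>
      choose f hf using fun j (hj : r j i) => (ih j hj).1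
      have h : ∃ a, ∀ j (hj : r j i) b, F j = some b → C i j hj a b := by
        obtain ⟨a, ha⟩ := step i f fun j k hj hk h =>
          (ih j hj).2 k h _ _ (hf j hj) (hf k hk)
        refine ⟨a, fun j hj b hb => ?_⟩
        obtain rfl : f j hj = b := Option.some.inj ((hf j hj).symm.trans hb)
        exact ha j hj
      have hi : F i = some h.choose := (hF i).trans (dif_pos h)
      refine ⟨⟨_, hi⟩, fun j hj a b ha hb => ?_⟩
      obtain rfl : h.choose = a := Option.some.inj (hi.symm.trans ha)
      exact h.choose_spec j hj b hb
  choose f hf using fun i => (key i).1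
  exact ⟨f, fun i j h => (key i).2 j h _ _ (hf i) (hf j)⟩

section Equalizer

variable {C : Type u} [Category.{v} C] [HasLimits C]

/-- Maps that equalize families of maps under left adjoints are represented. -/
theorem exists_mono_of_leftAdjoints {ι : Type v} {E : ι → Type u} [∀ k, Category.{v} (E k)]
    (L : ∀ k, C ⥤ E k) [∀ k, (L k).IsLeftAdjoint] {T : C} {Z : ∀ k, E k}
    (x y : ∀ k, (L k).obj T ⟶ Z k) :
    ∃ (R : C) (e : R ⟶ T), Mono e ∧ (∀ k, (L k).map e ≫ x k = (L k).map e ≫ y k) ∧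
      ∀ ⦃B : C⦄ (h : B ⟶ T), (∀ k, (L k).map h ≫ x k = (L k).map h ≫ y k) → ∃ l, l ≫ e = h := by
  let adj := fun k => Adjunction.ofIsLeftAdjoint (L k)
  -- Transposing along the adjunctions turns all the conditions into one equality of maps into a
  -- product in `C`.
  let P : C := ∏ᶜ fun k => (L k).rightAdjoint.obj (Z k)
  let x' : T ⟶ P := Pi.lift fun k => (adj k).homEquiv _ _ (x k)
  let y' : T ⟶ P := Pi.lift fun k => (adj k).homEquiv _ _ (y k)
  have key : ∀ ⦃B : C⦄ (h : B ⟶ T),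
      (∀ k, (L k).map h ≫ x k = (L k).map h ≫ y k) ↔ h ≫ x' = h ≫ y' := by
    intro B h
    have h₁ : ∀ k (z : (L k).obj T ⟶ Z k), h ≫ (adj k).homEquiv _ _ z =
        (adj k).homEquiv _ _ ((L k).map h ≫ z) :=
      fun k z => ((adj k).homEquiv_naturality_left h z).symm
    constructor
    · intro hk
      refine Pi.hom_ext _ _ fun k => ?_
      simp only [x', y', Category.assoc, Pi.lift_π, h₁, hk]
    · intro hk k
      have h₂ := congrArg (· ≫ Pi.π _ k) hk
      simp only [x', y', Category.assoc, Pi.lift_π, h₁] at h₂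
      exact ((adj k).homEquiv _ _).injective h₂
  exact ⟨equalizer x' y', equalizer.ι x' y', inferInstance, (key _).2 (equalizer.condition x' y'),
    fun B h hh => ⟨equalizer.lift h ((key h).1 hh), equalizer.lift_ι _ _⟩⟩

/-- Families of maps out of the images of an object under left adjoints are represented. -/
theorem exists_product_of_leftAdjoints {ι : Type v} {E : ι → Type u} [∀ k, Category.{v} (E k)]
    (L : ∀ k, C ⥤ E k) [∀ k, (L k).IsLeftAdjoint] (Z : ∀ k, E k) :
    ∃ (T : C) (x : ∀ k, (L k).obj T ⟶ Z k),
      ∀ ⦃B : C⦄ (y : ∀ k, (L k).obj B ⟶ Z k), ∃! h : B ⟶ T, ∀ k, (L k).map h ≫ x k = y k := by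
  let adj := fun k => Adjunction.ofIsLeftAdjoint (L k)
  let P : C := ∏ᶜ fun k => (L k).rightAdjoint.obj (Z k)
  have h₁ : ∀ k ⦃B : C⦄ (h : B ⟶ P) (y : (L k).obj B ⟶ Z k),
      (L k).map h ≫ ((adj k).homEquiv _ _).symm (Pi.π _ k) = y ↔
        h ≫ Pi.π _ k = (adj k).homEquiv _ _ y := by
    intro k B h y
    rw [← (adj k).homEquiv_naturality_left_symm, Equiv.symm_apply_eq]
  refine ⟨P, fun k => ((adj k).homEquiv _ _).symm (Pi.π _ k), fun B y =>
    ⟨Pi.lift fun k => (adj k).homEquiv _ _ (y k), fun k => (h₁ k _ _).2 (Pi.lift_π _ _),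
      fun h hh => Pi.hom_ext _ _ fun k => ?_⟩⟩
  rw [Pi.lift_π]
  exact (h₁ k h (y k)).1 (hh k)

end Equalizer

namespace DiagramModel

open HirschhornModel

variable {D : Type v} [SmallCategory D] {M : Pseudofunctor (LocallyDiscrete D) Cat.{v, u}}
  [∀ s, HasColimits (Fib M s)] [∀ {s t : D} (a : s ⟶ t), (push M a).IsLeftAdjoint]

theorem freeOnMap_comp {s : D} (S : MapsFrom s) {A B C : Fib M s} (f : A ⟶ B) (g : B ⟶ C) :
    freeOnMap S (f ≫ g) = freeOnMap S f ≫ freeOnMap S g :=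
  freeOn_hom_ext fun a ha => by
    rw [summand_freeOnMap, MDiagram.comp_app, ← Category.assoc, summand_freeOnMap, Category.assoc,
      summand_freeOnMap, Functor.map_comp, Category.assoc]

/-- The generated diagrams are the values of a left adjoint. -/
theorem exists_represents_freeOn [∀ s, HasLimits (Fib M s)] {s : D} (S : MapsFrom s)
    (X : MDiagram M) :
    ∃ (R : Fib M s) (ev : freeOn S R ⟶ X),
      ∀ ⦃B : Fib M s⦄ (x : freeOn S B ⟶ X), ∃! h : B ⟶ R, freeOnMap S h ≫ ev = x := by
  -- `T` classifies arbitrary families of maps `a_* B ⟶ X(t)`; the subobject `R` below is where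
  -- these are compatible with the structure maps of `X`, that is, form a map of diagrams.
  obtain ⟨T, x, hx⟩ := exists_product_of_leftAdjoints
    (ι := Σ t, {a : s ⟶ t // S.mem a}) (fun k => push M k.2.1) fun k => X.obj k.1
  obtain ⟨R, e, he, he', hR⟩ := exists_mono_of_leftAdjoints
    (ι := Σ k : (Σ t, {a : s ⟶ t // S.mem a}), Σ r, k.1 ⟶ r) (fun k => push M (k.1.2.1 ≫ k.2.2))
    (fun k => x ⟨k.2.1, k.1.2.1 ≫ k.2.2, S.comp_mem _ _ k.1.2.2⟩)
    fun k => (pushComp M k.1.2.1 k.2.2).hom.app T ≫ (push M k.2.2).map (x k.1) ≫ X.map k.2.2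
  have nat : ∀ {B : Fib M s} (h : B ⟶ T) {t r : D} (a : s ⟶ t) (b : t ⟶ r) (ha : S.mem a),
      (push M (a ≫ b)).map h ≫ (pushComp M a b).hom.app T ≫
        (push M b).map (x ⟨t, a, ha⟩) ≫ X.map b = (pushComp M a b).hom.app B ≫
        (push M b).map ((push M a).map h ≫ x ⟨t, a, ha⟩) ≫ X.map b := by
    intro B h t r a b ha
    rw [(pushComp M a b).hom.naturality_assoc, Functor.map_comp, Category.assoc]
    rfl
  refine ⟨R, freeOnDesc (fun t a ha => (push M a).map e ≫ x ⟨t, a, ha⟩) fun {t r} a b ha =>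
    (he' ⟨⟨t, a, ha⟩, r, b⟩).trans (nat e a b ha), fun B y => ?_⟩
  have fac : ∀ (l : B ⟶ R) {t : D} (a : s ⟶ t) (ha : S.mem a),
      summand S B a ha ≫ (freeOnMap S l ≫ freeOnDesc
        (fun t a ha => (push M a).map e ≫ x ⟨t, a, ha⟩) fun {t r} a b ha =>
          (he' ⟨⟨t, a, ha⟩, r, b⟩).trans (nat e a b ha)).app t =
        (push M a).map (l ≫ e) ≫ x ⟨t, a, ha⟩ := by
    intro l t a ha
    rw [MDiagram.comp_app, ← Category.assoc, summand_freeOnMap, Category.assoc,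
      summand_freeOnDesc, Functor.map_comp, Category.assoc]
  obtain ⟨h, hh, huniq⟩ := hx fun k => summand S B k.2.1 k.2.2 ≫ y.app k.1
  obtain ⟨l, hl⟩ := hR h fun k => by
    obtain ⟨⟨t, a, ha⟩, r, b⟩ := k
    refine (hh ⟨r, a ≫ b, _⟩).trans ((summand_comp y a b ha).trans ?_)
    exact (congrArg (fun z => (pushComp M a b).hom.app B ≫ (push M b).map z ≫ X.map b)
      (hh ⟨t, a, ha⟩)).symm.trans (nat h a b ha).symm
  refine ⟨l, freeOn_hom_ext fun {t} a ha => (fac l a ha).trans ?_, fun l' hl' =>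
    (cancel_mono e).1 ?_⟩
  · rw [hl]
    exact hh ⟨t, a, ha⟩
  · rw [hl]
    refine huniq _ fun k => ?_
    refine (fac l' k.2.1 k.2.2).symm.trans ?_
    exact congrArg (fun z => summand S B k.2.1 k.2.2 ≫ MDiagram.Hom.app z k.1) hl'

end DiagramModel

/-! ### Relative matching objects and lifting against corner maps. -/

namespace DiagramModel

open HirschhornModel

variable {D : Type v} [SmallCategory D] {M : Pseudofunctor (LocallyDiscrete D) Cat.{v, u}}
  [∀ s, HasColimits (Fib M s)] [∀ {s t : D} (a : s ⟶ t), (push M a).IsLeftAdjoint]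

/-- The inclusion of the diagram generated along `S` into the free diagram. -/
def freeOnToFree {s : D} (S : MapsFrom s) (A : Fib M s) : freeOn S A ⟶ free s A :=
  freeOnToAll S A

theorem summand_freeOnToFree {s : D} (S : MapsFrom s) (A : Fib M s) {t : D} (a : s ⟶ t)
    (ha : S.mem a) : summand S A a ha ≫ (freeOnToFree S A).app t = freeSummand A a :=
  freeIncl_freeObjToAll S A a ha

theorem summand_freeOnToFree_assoc {s : D} (S : MapsFrom s) (A : Fib M s) {t : D} (a : s ⟶ t)
    (ha : S.mem a) {Z : Fib M t} (g : (free s A).obj t ⟶ Z) :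
    summand S A a ha ≫ (freeOnToFree S A).app t ≫ g = freeSummand A a ≫ g := by
  rw [← Category.assoc, summand_freeOnToFree]

/-- The map from the diagram generated along `S` given by a map out of the generator. -/
def freeOnToAllDesc {s : D} (S : MapsFrom s) {A : Fib M s} {X : MDiagram M} (x : A ⟶ X.obj s) :
    freeOn S A ⟶ X := freeOnToFree S A ≫ freeDesc x

theorem summand_freeOnToAllDesc {s : D} (S : MapsFrom s) {A : Fib M s} {X : MDiagram M}
    (x : A ⟶ X.obj s) {t : D} (a : s ⟶ t) (ha : S.mem a) :
    summand S A a ha ≫ (freeOnToAllDesc S x).app t = (push M a).map x ≫ X.map a := by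
  rw [freeOnToAllDesc, MDiagram.comp_app, summand_freeOnToFree_assoc, freeSummand_freeDesc]

theorem freeOnToAllDesc_comp {s : D} (S : MapsFrom s) {A : Fib M s} {X Y : MDiagram M}
    (x : A ⟶ X.obj s) (f : X ⟶ Y) :
    freeOnToAllDesc S x ≫ f = freeOnToAllDesc S (x ≫ f.app s) := by
  rw [freeOnToAllDesc, Category.assoc, freeDesc_comp, freeOnToAllDesc]

theorem freeOnMap_freeOnToAllDesc {s : D} (S : MapsFrom s) {A B : Fib M s} {X : MDiagram M}
    (f : A ⟶ B) (x : B ⟶ X.obj s) :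
    freeOnMap S f ≫ freeOnToAllDesc S x = freeOnToAllDesc S (f ≫ x) :=
  freeOn_hom_ext fun a ha => by
    rw [MDiagram.comp_app, ← Category.assoc, summand_freeOnMap, Category.assoc,
      summand_freeOnToAllDesc, summand_freeOnToAllDesc, Functor.map_comp, Category.assoc]

/-- A relative matching object of `p : X ⟶ Y`: it represents the maps `B ⟶ Y(s)` with a lift to
`X` of the induced map on the diagram generated along `S`. -/
structure RelativeMatching {s : D} (S : MapsFrom s) {X Y : MDiagram M} (p : X ⟶ Y) where
  obj : Fib M s
  proj : obj ⟶ Y.obj s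
  desc : freeOn S obj ⟶ X
  w : desc ≫ p = freeOnToAllDesc S proj
  exists_lift : ∀ ⦃B : Fib M s⦄ (y : B ⟶ Y.obj s) (x : freeOn S B ⟶ X),
    x ≫ p = freeOnToAllDesc S y → ∃ h : B ⟶ obj, h ≫ proj = y ∧ freeOnMap S h ≫ desc = x
  hom_ext : ∀ ⦃B : Fib M s⦄ (h h' : B ⟶ obj), h ≫ proj = h' ≫ proj →
    freeOnMap S h ≫ desc = freeOnMap S h' ≫ desc → h = h'

/-- With `R` and `R'` representing the maps from generated diagrams to `X` and `Y`, the relative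
matching object is the pullback of `Y(s)` and `R` over `R'`. -/
theorem nonempty_relativeMatching [∀ s, HasLimits (Fib M s)] {s : D} (S : MapsFrom s)
    {X Y : MDiagram M} (p : X ⟶ Y) : Nonempty (RelativeMatching S p) := by
  obtain ⟨R, ev, hR⟩ := exists_represents_freeOn S X
  obtain ⟨R', ev', hR'⟩ := exists_represents_freeOn S Y
  obtain ⟨α, hα, -⟩ := hR' (freeOnToAllDesc S (𝟙 (Y.obj s)))
  obtain ⟨β, hβ, -⟩ := hR' (ev ≫ p)
  have hα' : ∀ {B : Fib M s} (y : B ⟶ Y.obj s),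
      freeOnMap S (y ≫ α) ≫ ev' = freeOnToAllDesc S y := by
    intro B y
    rw [freeOnMap_comp, Category.assoc, hα, freeOnMap_freeOnToAllDesc, Category.comp_id]
  have hβ' : ∀ {B : Fib M s} (h : B ⟶ R),
      freeOnMap S (h ≫ β) ≫ ev' = (freeOnMap S h ≫ ev) ≫ p := by
    intro B h
    rw [freeOnMap_comp, Category.assoc, hβ, Category.assoc]
  refine ⟨
    { obj := pullback α β
      proj := pullback.fst α β
      desc := freeOnMap S (pullback.snd α β) ≫ ev
      w := by rw [← hβ', ← pullback.condition, hα']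
      exists_lift := fun B y x h => ?_
      hom_ext := fun B h h' h₁ h₂ => pullback.hom_ext h₁ ?_ }⟩
  · obtain ⟨k, hk, -⟩ := hR x
    have w : y ≫ α = k ≫ β := (hR' (x ≫ p)).unique ((hα' y).trans h.symm) (by rw [hβ', hk])
    refine ⟨pullback.lift y k w, pullback.lift_fst _ _ _, ?_⟩
    rw [← Category.assoc, ← freeOnMap_comp, pullback.lift_snd, hk]
  · refine (hR (freeOnMap S h ≫ freeOnMap S (pullback.snd α β) ≫ ev)).unique ?_ ?_
    · rw [freeOnMap_comp, Category.assoc]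
    · rw [freeOnMap_comp, Category.assoc, h₂]

namespace RelativeMatching

variable {s : D} {S : MapsFrom s} {X Y : MDiagram M} {p : X ⟶ Y} (T : RelativeMatching S p)

theorem exists_matchingMap : ∃ m : X.obj s ⟶ T.obj, m ≫ T.proj = p.app s ∧
    freeOnMap S m ≫ T.desc = freeOnToAllDesc S (𝟙 (X.obj s)) :=
  T.exists_lift _ _ (by rw [freeOnToAllDesc_comp, Category.id_comp])

/-- The relative matching map. -/
def matchingMap : X.obj s ⟶ T.obj := T.exists_matchingMap.choose

theorem matchingMap_proj : T.matchingMap ≫ T.proj = p.app s := T.exists_matchingMap.choose_spec.1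

theorem freeOnMap_matchingMap_desc {B : Fib M s} (x : B ⟶ X.obj s) :
    freeOnMap S (x ≫ T.matchingMap) ≫ T.desc = freeOnToAllDesc S x := by
  have h : freeOnMap S T.matchingMap ≫ T.desc = _ := T.exists_matchingMap.choose_spec.2
  rw [freeOnMap_comp, Category.assoc, h, freeOnMap_freeOnToAllDesc, Category.comp_id]

end RelativeMatching

/-- The chosen relative matching object. -/
def relativeMatching [∀ s, HasLimits (Fib M s)] {s : D} (S : MapsFrom s)
    {X Y : MDiagram M} (p : X ⟶ Y) : RelativeMatching S p := (nonempty_relativeMatching S p).some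

variable (hD : IsInverseCategory D)

theorem inl_boundaryCorner {s : D} {A B : Fib M s} (f : A ⟶ B) :
    pushout.inl (boundaryIncl hD s A) (boundaryHom hD s f) ≫ boundaryCorner hD s f =
      freeHom s f := pushout.inl_desc _ _ _

theorem inl_boundaryCorner_assoc {s : D} {A B : Fib M s} (f : A ⟶ B) {Z : MDiagram M}
    (g : free s B ⟶ Z) :
    pushout.inl (boundaryIncl hD s A) (boundaryHom hD s f) ≫ boundaryCorner hD s f ≫ g =
      freeHom s f ≫ g := pushout.inl_desc_assoc _ _ _ _

theorem inr_boundaryCorner {s : D} {A B : Fib M s} (f : A ⟶ B) :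
    pushout.inr (boundaryIncl hD s A) (boundaryHom hD s f) ≫ boundaryCorner hD s f =
      boundaryIncl hD s B := pushout.inr_desc _ _ _

theorem inr_boundaryCorner_assoc {s : D} {A B : Fib M s} (f : A ⟶ B) {Z : MDiagram M}
    (g : free s B ⟶ Z) :
    pushout.inr (boundaryIncl hD s A) (boundaryHom hD s f) ≫ boundaryCorner hD s f ≫ g =
      boundaryIncl hD s B ≫ g := pushout.inr_desc_assoc _ _ _ _

/-- Lifting against a corner map of free diagrams. -/
theorem hasLiftingProperty_boundaryCorner_iff {s : D} {A B : Fib M s} (f : A ⟶ B)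
    {X Y : MDiagram M} (p : X ⟶ Y) (T : RelativeMatching (MapsFrom.boundary hD s) p) :
    HasLiftingProperty (boundaryCorner hD s f) p ↔ HasLiftingProperty f T.matchingMap := by
  -- A map `C ⟶ T.obj` is a map `C ⟶ Y(s)` together with a map from the boundary of `C` to `X` over
  -- it; `c` extracts the second part, and the listed properties are all that the transposition of
  -- squares uses.
  obtain ⟨c, hcf, hcm, hcp, hce, hc⟩ : ∃ c : ∀ {C : Fib M s}, (C ⟶ T.obj) → (boundary hD s C ⟶ X),
      (∀ y : B ⟶ T.obj, boundaryHom hD s f ≫ c y = c (f ≫ y)) ∧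
      (∀ {C : Fib M s} (x : C ⟶ X.obj s),
        c (x ≫ T.matchingMap) = boundaryIncl hD s C ≫ freeDesc x) ∧
      (∀ {C : Fib M s} (y : C ⟶ T.obj),
        c y ≫ p = boundaryIncl hD s C ≫ freeDesc (y ≫ T.proj)) ∧
      (∀ {C : Fib M s} (y y' : C ⟶ T.obj), y ≫ T.proj = y' ≫ T.proj → c y = c y' → y = y') ∧
      ∀ {C : Fib M s} (y : C ⟶ Y.obj s) (x : boundary hD s C ⟶ X),
        x ≫ p = boundaryIncl hD s C ≫ freeDesc y → ∃ h : C ⟶ T.obj, h ≫ T.proj = y ∧ c h = x := by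
    refine ⟨fun y => freeOnMap (MapsFrom.boundary hD s) y ≫ T.desc, fun y => ?_,
      T.freeOnMap_matchingMap_desc, fun y => ?_, fun y y' => T.hom_ext y y',
      fun y x => T.exists_lift y x⟩
    · exact (Category.assoc _ _ _).symm.trans (congrArg (· ≫ T.desc) (freeOnMap_comp _ f y).symm)
    · refine (Category.assoc _ _ _).trans ((congrArg (_ ≫ ·) T.w).trans ?_)
      exact freeOnMap_freeOnToAllDesc _ y T.proj
  refine ⟨fun h => ⟨fun {x y} sq => ?_⟩, fun h => ⟨fun {x y} sq => ?_⟩⟩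
  · have w : boundaryIncl hD s A ≫ freeDesc x = boundaryHom hD s f ≫ c y := by
      rw [← hcm, hcf, sq.w]
    have sq' : CommSq (pushout.desc (freeDesc x) (c y) w) (boundaryCorner hD s f) p
        (freeDesc (y ≫ T.proj)) := by
      refine ⟨pushout.hom_ext ?_ ?_⟩
      · rw [pushout.inl_desc_assoc, inl_boundaryCorner_assoc, freeDesc_comp,
          freeHom_comp_freeDesc, ← sq.w_assoc, T.matchingMap_proj]
      · rw [pushout.inr_desc_assoc, inr_boundaryCorner_assoc, hcp]
    have h₁ : freeHom s f ≫ sq'.lift = freeDesc x := by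
      have h₁ := congrArg (pushout.inl _ _ ≫ ·) sq'.fac_left
      rwa [pushout.inl_desc, inl_boundaryCorner_assoc] at h₁
    have h₂ : boundaryIncl hD s B ≫ sq'.lift = c y := by
      have h₂ := congrArg (pushout.inr _ _ ≫ ·) sq'.fac_left
      rwa [pushout.inr_desc, inr_boundaryCorner_assoc] at h₂
    refine ⟨⟨⟨freeUnit s B ≫ sq'.lift.app s, ?_, hce _ _ ?_ ?_⟩⟩⟩
    · rw [← freeUnit_freeHom_assoc, comp_app_eq h₁, freeUnit_freeDesc]
    · rw [Category.assoc, Category.assoc, T.matchingMap_proj, comp_app_eq sq'.fac_right,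
        freeUnit_freeDesc]
    · rw [hcm, freeDesc_freeUnit, h₂]
  · have hl : freeHom s f ≫ y = (pushout.inl _ _ ≫ x) ≫ p := by
      rw [Category.assoc, sq.w, inl_boundaryCorner_assoc]
    have hr : boundaryIncl hD s B ≫ y = (pushout.inr _ _ ≫ x) ≫ p := by
      rw [Category.assoc, sq.w, inr_boundaryCorner_assoc]
    obtain ⟨k, hk, hk'⟩ := hc (freeUnit s B ≫ y.app s)
      (pushout.inr (boundaryIncl hD s A) (boundaryHom hD s f) ≫ x)
      (by rw [freeDesc_freeUnit, hr])
    have sq' : CommSq (freeUnit s A ≫ MDiagram.Hom.app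
        (pushout.inl (boundaryIncl hD s A) (boundaryHom hD s f) ≫ x) s) f T.matchingMap k := by
      refine ⟨hce _ _ ?_ ?_⟩
      · rw [Category.assoc, Category.assoc, T.matchingMap_proj, Category.assoc, hk,
          comp_app_eq hl.symm, ← freeUnit_freeHom_assoc, MDiagram.comp_app]
      · rw [hcm, freeDesc_freeUnit, ← hcf, hk', pushout.condition_assoc]
    refine ⟨⟨⟨freeDesc sq'.lift, pushout.hom_ext ?_ ?_, ?_⟩⟩⟩
    · rw [inl_boundaryCorner_assoc, freeHom_comp_freeDesc, sq'.fac_left,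
        freeDesc_freeUnit]
    · rw [inr_boundaryCorner_assoc, ← hk', ← hcm, sq'.fac_right]
    · rw [freeDesc_comp, ← T.matchingMap_proj, sq'.fac_right_assoc, hk, freeDesc_freeUnit]

theorem rlp_cornerGenerators_iff [∀ s, HasLimits (Fib M s)] (I : ∀ s, MorphismProperty (Fib M s))
    {X Y : MDiagram M} (p : X ⟶ Y) : (cornerGenerators hD I).rlp p ↔
      ∀ s, (I s).rlp (relativeMatching (MapsFrom.boundary hD s) p).matchingMap := by
  constructor
  · intro h s A B f hf
    exact (hasLiftingProperty_boundaryCorner_iff hD f p _).1 (h _ (.mk s f hf))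
  · rintro h _ _ _ ⟨s, f, hf⟩
    exact (hasLiftingProperty_boundaryCorner_iff hD f p _).2 (h s f hf)

/-- In an inverse category the relation "there is a map from `s` to `t` and `t ≠ s`" is
well-founded. -/
theorem wellFounded_of_isInverseCategory {D : Type v} [SmallCategory D]
    (hD : IsInverseCategory D) :
    WellFounded fun t s : D => s ≠ t ∧ Nonempty (s ⟶ t) := by
  obtain ⟨d, hd⟩ := hD
  refine Subrelation.wf (r := InvImage (· < ·) fun s => d.obj (Opposite.op s)) ?_
    (InvImage.wf _ Ordinal.lt_wf)
  rintro t s ⟨h, ⟨a⟩⟩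
  rcases hd a.op with ⟨h', -⟩ | h'
  · exact absurd (Opposite.op_injective h').symm h
  · exact h'

/-- Maps whose relative matching maps have a right lifting property lift against the maps that
objectwise have the corresponding left lifting property. -/
theorem hasLiftingProperty_of_objectwise [Quiver.IsThin D] [∀ s, HasLimits (Fib M s)]
    {I : ∀ s, MorphismProperty (Fib M s)} {A B X Y : MDiagram M} (g : A ⟶ B)
    (hg : objectwise (fun s => (I s).rlp.llp) g) (p : X ⟶ Y)
    (hp : (cornerGenerators hD I).rlp p) : HasLiftingProperty g p := by
  rw [rlp_cornerGenerators_iff] at hp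
  refine ⟨fun {x y} sq => ?_⟩
  -- The lift at `s` is constructed after those at the targets `t ≠ s` of maps from `s`, and is
  -- required to be compatible with them. Since `D` is thin, the chosen map `h.2.some` is the only
  -- one.
  obtain ⟨l, hl⟩ := (wellFounded_of_isInverseCategory hD).exists_compatible_family
    (α := fun s => {l : B.obj s ⟶ X.obj s // g.app s ≫ l = x.app s ∧ l ≫ p.app s = y.app s})
    (fun s t h l l' => (push M h.2.some).map l.1 ≫ X.map h.2.some = B.map h.2.some ≫ l'.1) (by
      intro s l hl
      let T := relativeMatching (MapsFrom.boundary hD s) p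
      obtain ⟨L, hLl, hLx, hLy⟩ : ∃ L : ∀ (t : D) (a : s ⟶ t),
          (MapsFrom.boundary hD s).mem a → (B.obj t ⟶ X.obj t),
          (∀ t a ha, L t a ha = (l t ⟨ha, ⟨a⟩⟩).1) ∧ (∀ t a ha, g.app t ≫ L t a ha = x.app t) ∧
          ∀ t a ha, L t a ha ≫ p.app t = y.app t :=
        ⟨fun t a ha => (l t ⟨ha, ⟨a⟩⟩).1, fun _ _ _ => rfl, fun t a ha => (l t ⟨ha, ⟨a⟩⟩).2.1,
          fun t a ha => (l t ⟨ha, ⟨a⟩⟩).2.2⟩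
      -- The lifts already constructed combine with the structure maps of `B` to a map from the
      -- boundary on `B(s)` to `X`.
      obtain ⟨x', hx'⟩ : ∃ x' : freeOn (MapsFrom.boundary hD s) (B.obj s) ⟶ X,
          ∀ {t : D} (a : s ⟶ t) (ha : (MapsFrom.boundary hD s).mem a),
            summand _ _ a ha ≫ x'.app t = B.map a ≫ L t a ha := by
        refine ⟨freeOnDesc (fun t a ha => B.map a ≫ L t a ha) fun {t r} a b ha => ?_,
          fun a ha => summand_freeOnDesc _ _ a ha⟩
        · rw [hLl, hLl]
          rw [B.map_comp, Functor.map_comp]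
          simp only [Category.assoc]
          refine congrArg (fun z => _ ≫ _ ≫ z) ?_
          -- The recursion relates only distinct objects; for `t = r` thinness forces `b` to be the
          -- identity.
          by_cases htr : t = r
          · subst htr
            obtain rfl : b = 𝟙 t := Subsingleton.elim _ _
            rw [B.map_id, X.map_id, (pushId M t).hom.naturality]
            rfl
          · obtain h := hl t r ⟨ha, ⟨a⟩⟩ ⟨(MapsFrom.boundary hD s).comp_mem a b ha, ⟨a ≫ b⟩⟩
              ⟨htr, ⟨b⟩⟩
            rw [Subsingleton.elim (Nonempty.some _) b] at h
            exact h.symm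
      obtain ⟨k, hk, hk'⟩ := T.exists_lift (y.app s) x' (freeOn_hom_ext fun {t} a ha => by
        rw [summand_freeOnToAllDesc, MDiagram.comp_app, ← Category.assoc, hx', Category.assoc,
          hLy, naturality_app])
      -- A lift against the matching map is a lift at `s` that is also compatible with all the
      -- earlier ones.
      have sq' : CommSq (x.app s) (g.app s) T.matchingMap k := by
        refine ⟨T.hom_ext _ _ ?_ ?_⟩
        · rw [Category.assoc, Category.assoc, T.matchingMap_proj, hk, comp_app_eq sq.w,
            MDiagram.comp_app]
        · rw [T.freeOnMap_matchingMap_desc, freeOnMap_comp, Category.assoc, hk']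
          refine freeOn_hom_ext fun {t} a ha => ?_
          rw [summand_freeOnToAllDesc, MDiagram.comp_app, ← Category.assoc, summand_freeOnMap,
            Category.assoc, hx', naturality_app, ← hLx t a ha, ← Category.assoc, ← naturality_app, Category.assoc]
      have := hg s _ (hp s)
      refine ⟨⟨sq'.lift, sq'.fac_left, ?_⟩, ?_⟩
      · rw [← T.matchingMap_proj, sq'.fac_right_assoc, hk]
      · rintro t ⟨ht, ⟨a⟩⟩
        rw [Subsingleton.elim (Nonempty.some _) a]
        have h := T.freeOnMap_matchingMap_desc sq'.lift
        rw [sq'.fac_right, hk'] at h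
        have h' := congrArg (fun z => summand _ _ a ht ≫ MDiagram.Hom.app z t) h
        refine (summand_freeOnToAllDesc _ _ a ht).symm.trans (h'.symm.trans ((hx' a ht).trans ?_))
        exact congrArg (B.map a ≫ ·) (hLl t a ht))
  refine ⟨⟨⟨⟨fun s => (l s).1, fun {s t} a => ?_⟩, MDiagram.hom_ext _ _ fun s => (l s).2.1,
    MDiagram.hom_ext _ _ fun s => (l s).2.2⟩⟩⟩
  by_cases hst : s = t
  · subst hst
    obtain rfl : a = 𝟙 s := Subsingleton.elim _ _
    rw [B.map_id, X.map_id, (pushId M s).hom.naturality]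
    rfl
  · have h := hl s t ⟨hst, ⟨a⟩⟩
    rw [Subsingleton.elim (Nonempty.some _) a] at h
    exact h

end DiagramModel

/-! ### The injective case: corner maps and objectwise cofibrations. -/

namespace DiagramModel

open HirschhornModel

variable {D : Type v} [SmallCategory D] {M : Pseudofunctor (LocallyDiscrete D) Cat.{v, u}}
  [∀ s, HasColimits (Fib M s)] [∀ {s t : D} (a : s ⟶ t), (push M a).IsLeftAdjoint]

theorem isIso_app_freeOnToAll {s : D} (S : MapsFrom s) (A : Fib M s) {t : D}
    (h : ∀ a : s ⟶ t, S.mem a) : IsIso ((freeOnToAll S A).app t) := by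
  refine ⟨freeOnObjDesc (S := MapsFrom.all s) fun a _ => summand S A a (h a),
    freeObj_hom_ext fun a ha => ?_, freeObj_hom_ext fun a ha => ?_⟩
  · refine (Category.assoc _ _ _).symm.trans ?_
    refine (congrArg (· ≫ _) (freeIncl_freeObjToAll S A a ha)).trans ?_
    exact (summand_freeOnObjDesc (S := MapsFrom.all s) (fun a _ => summand S A a (h a)) a
      (MapsFrom.mem_all a)).trans (Category.comp_id _).symm
  · refine (Category.assoc _ _ _).symm.trans ?_
    refine (congrArg (· ≫ _) (summand_freeOnObjDesc (S := MapsFrom.all s)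
      (fun a _ => summand S A a (h a)) a (MapsFrom.mem_all a))).trans ?_
    exact (freeIncl_freeObjToAll S A a (h a)).trans (Category.comp_id _).symm

theorem isIso_app_freeOnMap {s : D} (S : MapsFrom s) {A B : Fib M s} (f : A ⟶ B) {t : D}
    (h : ∀ a : s ⟶ t, ¬ S.mem a) : IsIso ((freeOnMap S f).app t) :=
  isIso_of_isInitial (nonempty_isInitial_freeObj S A h).some (nonempty_isInitial_freeObj S B h).some
    _

variable (hD : IsInverseCategory D)

/-- The corner map is objectwise an isomorphism or isomorphic to a map of free diagrams. -/
theorem objectwise_boundaryCorner (P : ∀ s, MorphismProperty (Fib M s))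
    [∀ s, (P s).RespectsIso] [∀ s, (P s).ContainsIdentities] {s : D} {A B : Fib M s} (f : A ⟶ B)
    (hf : objectwise P (freeHom s f)) : objectwise P (boundaryCorner hD s f) := by
  intro t
  have sq := (IsPushout.of_hasPushout (boundaryIncl hD s A) (boundaryHom hD s f)).map
    (evaluation M t)
  by_cases hst : s = t
  -- At `s` the boundaries are initial, so the corner map is isomorphic to the map of free diagrams.
  · subst hst
    have : IsIso ((evaluation M s).map (boundaryHom hD s f)) :=
      isIso_app_freeOnMap _ f fun _ h => h rfl
    have := sq.isIso_inl_of_isIso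
    have h := hf s
    rw [← comp_app_eq (inl_boundaryCorner hD f)] at h
    exact ((P s).cancel_left_of_respectsIso ((evaluation M s).map (pushout.inl _ _)) _).1 h
  -- Away from `s` the boundary inclusions are isomorphisms, hence so is the corner map.
  · have : ∀ C : Fib M s, IsIso ((boundaryIncl hD s C).app t) := fun C =>
      isIso_app_freeOnToAll _ C fun _ => hst
    have : IsIso ((evaluation M t).map (boundaryIncl hD s A)) := this A
    have := sq.isIso_inr_of_isIso
    have h := (P t).of_isIso ((boundaryIncl hD s B).app t)
    rw [← comp_app_eq (inr_boundaryCorner hD f)] at h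
    exact ((P t).cancel_left_of_respectsIso ((evaluation M t).map (pushout.inr _ _)) _).1 h

theorem isSmall_cornerGenerators (I : ∀ s, MorphismProperty (Fib M s))
    (hI : ∀ s, MorphismProperty.IsSmall.{v} (I s)) :
    MorphismProperty.IsSmall.{v} (cornerGenerators hD I) where
  small_toSet := by
    have := hI
    refine small_of_surjective (α := Σ s, (I s).toSet)
      (f := fun x => ⟨Arrow.mk (boundaryCorner hD x.1 x.2.1.hom), ⟨x.1, x.2.1.hom, x.2.2⟩⟩) ?_
    rintro ⟨⟨X, Y, g⟩, hg⟩
    obtain ⟨s, f, hf⟩ : cornerGenerators hD I g := hg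
    exact ⟨⟨s, Arrow.mk f, hf⟩, rfl⟩

end DiagramModel

namespace DiagramModel

open HirschhornModel

variable {D : Type v} [SmallCategory D] {M : Pseudofunctor (LocallyDiscrete D) Cat.{v, u}}
  [∀ s, ModelCategory (Fib M s)] [IsDiagramOfModelCategories M] (hD : IsInverseCategory D)

theorem cornerGenerators_le_cofibrations {I : ∀ s, MorphismProperty (Fib M s)}
    (hI : ∀ s, I s ≤ cofibrations (Fib M s)) :
    cornerGenerators hD I ≤ objectwise fun s => cofibrations (Fib M s) := by
  rintro _ _ _ ⟨s, f, hf⟩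
  exact objectwise_boundaryCorner hD _ f (objectwise_cofibrations_freeOnMap _ f (hI s f hf))

theorem cornerGenerators_le_trivialCofibrations {I : ∀ s, MorphismProperty (Fib M s)}
    (hI : ∀ s, I s ≤ trivialCofibrations (Fib M s)) :
    cornerGenerators hD I ≤ objectwise fun s => trivialCofibrations (Fib M s) := by
  rintro _ _ _ ⟨s, f, hf⟩
  exact objectwise_boundaryCorner hD _ f (objectwise_trivialCofibrations_freeOnMap _ f (hI s f hf))

variable [Quiver.IsThin D]

/-- The maps with the right lifting property against the corner maps. -/
theorem rlp_cornerGenerators_eq {I : ∀ s, MorphismProperty (Fib M s)}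
    (h : cornerGenerators hD I ≤ objectwise fun s => (I s).rlp.llp) :
    (cornerGenerators hD I).rlp = (objectwise fun s => (I s).rlp.llp).rlp :=
  le_antisymm (fun _ _ p hp _ _ g hg => hasLiftingProperty_of_objectwise hD g hg p hp)
    (MorphismProperty.antitone_rlp h)

variable {I J : ∀ s, MorphismProperty (Fib M s)}

theorem rlp_cornerGenerators_cofibrations
    (h : ∀ s, IsCofibrantlyGeneratedBy (I s) (J s)) :
    (cornerGenerators hD I).rlp = (objectwise fun s => cofibrations (Fib M s)).rlp := by
  rw [rlp_cornerGenerators_eq]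
  · exact congrArg (fun P => (objectwise P).rlp) (funext fun s => (h s).cofibrations_eq.symm)
  · exact (cornerGenerators_le_cofibrations hD fun s => (h s).cofibrations_eq ▸
      MorphismProperty.le_llp_rlp _).trans (objectwise_le fun s => (h s).cofibrations_eq.le)

theorem rlp_cornerGenerators_trivialCofibrations
    (h : ∀ s, IsCofibrantlyGeneratedBy (I s) (J s)) :
    (cornerGenerators hD J).rlp = (objectwise fun s => trivialCofibrations (Fib M s)).rlp := by
  rw [rlp_cornerGenerators_eq]
  · exact congrArg (fun P => (objectwise P).rlp) (funext fun s => (h s).trivialCofibrations_eq.symm)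
  · exact (cornerGenerators_le_trivialCofibrations hD fun s => (h s).trivialCofibrations_eq ▸
      MorphismProperty.le_llp_rlp _).trans (objectwise_le fun s => (h s).trivialCofibrations_eq.le)

/-- For a cofibration `f` in `M(s)`, the map `freeHom s f` is an objectwise cofibration because the
functors `a_*` are left Quillen. Thus `p` lifts against it, and by adjunction `p.app s` lifts
against `f`. -/
theorem rlp_cornerGenerators_le_trivialFibrations
    (h : ∀ s, IsCofibrantlyGeneratedBy (I s) (J s)) :
    (cornerGenerators hD I).rlp ≤ objectwise fun s => trivialFibrations (Fib M s) := by
  intro X Y p hp s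
  rw [rlp_cornerGenerators_cofibrations hD h] at hp
  refine (MorphismProperty.rlp_eq_of_wfs (cofibrations (Fib M s)) _).le _ fun A B f hf => ?_
  exact (hasLiftingProperty_freeHom_iff f p).1 (hp _ (objectwise_cofibrations_freeOnMap _ f hf))

theorem rlp_cornerGenerators_le_fibrations
    (h : ∀ s, IsCofibrantlyGeneratedBy (I s) (J s)) :
    (cornerGenerators hD J).rlp ≤ objectwise fun s => fibrations (Fib M s) := by
  intro X Y p hp s
  rw [rlp_cornerGenerators_trivialCofibrations hD h] at hp
  refine (MorphismProperty.rlp_eq_of_wfs (trivialCofibrations (Fib M s)) _).le _ fun A B f hf => ?_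
  exact (hasLiftingProperty_freeHom_iff f p).1
    (hp _ (objectwise_trivialCofibrations_freeOnMap _ f hf))

/-- For maps with the right lifting property, being an objectwise weak equivalence is the right
lifting property against more maps. -/
theorem rlp_cornerGenerators_eq_inf
    (h : ∀ s, IsCofibrantlyGeneratedBy (I s) (J s))
    [MorphismProperty.HasSmallObjectArgument.{v} (cornerGenerators hD I)] :
    (cornerGenerators hD I).rlp =
      (cornerGenerators hD J).rlp ⊓ objectwise fun s => weakEquivalences (Fib M s) := by
  have hW := objectwise_hasTwoOutOfThreeProperty (M := M) fun s => weakEquivalences (Fib M s)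
  have hIW : (cornerGenerators hD I).rlp ≤ objectwise fun s => weakEquivalences (Fib M s) :=
    (rlp_cornerGenerators_le_trivialFibrations hD h).trans (objectwise_le fun _ => inf_le_right)
  refine le_antisymm (le_inf ?_ hIW) ?_
  · rw [rlp_cornerGenerators_cofibrations hD h, rlp_cornerGenerators_trivialCofibrations hD h]
    exact MorphismProperty.antitone_rlp
      (objectwise_le fun s => trivialCofibrations_sub_cofibrations _)
  -- Retract argument: in the factorization of `g` by the corner maps of `I`, the first factor is an
  -- objectwise trivial cofibration by two out of three. So `g` lifts against it and is a retract of
  -- the second factor.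
  · rintro X Y g ⟨hg, hgW⟩
    let d := MorphismProperty.factorizationData (cornerGenerators hD I).rlp.llp
      (cornerGenerators hD I).rlp g
    have hc : objectwise (fun s => cofibrations (Fib M s)) d.i := fun s =>
      (h s).cofibrations_eq.ge _ (llp_rlp_le_objectwise
        ((cornerGenerators_le_cofibrations hD fun s => (h s).cofibrations_eq ▸
          MorphismProperty.le_llp_rlp _).trans
            (objectwise_le fun s => (h s).cofibrations_eq.le)) _ d.hi s)
    have hw : objectwise (fun s => weakEquivalences (Fib M s)) d.i := by
      refine MorphismProperty.of_postcomp _ d.i d.p (hIW _ d.hp) ?_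
      rw [d.fac]
      exact hgW
    rw [rlp_cornerGenerators_trivialCofibrations hD h] at hg
    have : HasLiftingProperty d.i g := hg _ fun s => ⟨hc s, hw s⟩
    exact MorphismProperty.of_retract (RetractArrow.ofRightLiftingProperty d.fac) d.hp

theorem isGeneratorConstruction_cornerGenerators :
    IsGeneratorConstruction M (cornerGenerators hD) where
  isSmall := isSmall_cornerGenerators hD
  cofibrations _ := cornerGenerators_le_cofibrations hD
  trivialCofibrations _ := cornerGenerators_le_trivialCofibrations hD
  rlp_le _ _ := rlp_cornerGenerators_le_fibrations hD
  rlp_congr I I' h := by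
    ext X Y p
    rw [rlp_cornerGenerators_iff, rlp_cornerGenerators_iff]
    simp only [h]
  exists_free := by
    rintro I hI _ _ _ ⟨s, f, hf⟩
    -- The map from `free s A` to the domain of the corner map is a cobase change of the map of
    -- boundaries, which is an objectwise cofibration.
    refine ⟨s, _, _, f, hf, ⟨pushout.inl _ _, fun t => ?_⟩, ⟨_, objectwise_cofibrations_id _⟩⟩
    exact (HomotopicalAlgebra.cofibrations (Fib M t)).of_isPushout
      ((IsPushout.of_hasPushout (boundaryIncl hD s _) (boundaryHom hD s f)).map
        (evaluation M t)) (objectwise_cofibrations_freeOnMap _ f (hI s f hf) t)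
  rlp_eq _ _ h _ _ := rlp_cornerGenerators_eq_inf hD h

end DiagramModel

/-! ### The two model structures. -/

namespace DiagramModel

open HirschhornModel

variable {D : Type v} [SmallCategory D] {M : Pseudofunctor (LocallyDiscrete D) Cat.{v, u}}
  [∀ s, ModelCategory (Fib M s)] [IsDiagramOfModelCategories M]

/-- The projective model structure; the shape need not be direct. -/
theorem exists_projective (hproper : ∀ s : D, IsProper (Fib M s))
    (hcellular : ∀ s : D, IsCellular (Fib M s)) :
    ∃ _ : ModelCategory (MDiagram M),
      IsDiagramProjective M ∧ IsBicompleteFunctorial (MDiagram M) ∧ IsProper (MDiagram M) ∧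
      IsCellular (MDiagram M) ∧ ∀ I J : ∀ s : D, MorphismProperty (Fib M s),
        (∀ s : D, IsCofibrantlyGeneratedBy (I s) (J s)) →
          IsCofibrantlyGeneratedBy (freeGenerators I) (freeGenerators J) := by
  obtain ⟨I, J, hgen, -, m, hw, -, hf, hb, hp, hc, hIJ⟩ :=
    exists_modelCategory_of_generators isGeneratorConstruction_freeGenerators hproper hcellular
  refine ⟨m, ⟨fun f => ?_, fun f => ?_⟩, hb, hp, hc, hIJ⟩
  · rw [hw]
    exact Iff.rfl
  · rw [hf, rlp_freeGenerators_iff]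
    exact forall_congr' fun s => by rw [(hgen s).fibrations_eq]

theorem exists_injective [Quiver.IsThin D] (hD : IsInverseCategory D)
    (hproper : ∀ s : D, IsProper (Fib M s)) (hcellular : ∀ s : D, IsCellular (Fib M s)) :
    ∃ _ : ModelCategory (MDiagram M),
      IsDiagramInjective M ∧ IsBicompleteFunctorial (MDiagram M) ∧ IsProper (MDiagram M) ∧
      IsCellular (MDiagram M) ∧ ∀ I J : ∀ s : D, MorphismProperty (Fib M s),
        (∀ s : D, IsCofibrantlyGeneratedBy (I s) (J s)) →
          IsCofibrantlyGeneratedBy (cornerGenerators hD I) (cornerGenerators hD J) := by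
  obtain ⟨I, J, hgen, hso, m, hw, hcf, -, hb, hp, hc, hIJ⟩ :=
    exists_modelCategory_of_generators (isGeneratorConstruction_cornerGenerators hD) hproper
      hcellular
  have hcof : cofibrations (MDiagram M) = objectwise fun s => cofibrations (Fib M s) := by
    rw [hcf]
    -- The saturation of objectwise cofibrations stays objectwise; conversely, the corner maps have
    -- the same right lifting class as all objectwise cofibrations.
    refine le_antisymm (fun _ _ f hf s => (hgen s).cofibrations_eq.ge _ (llp_rlp_le_objectwise
      ((cornerGenerators_le_cofibrations hD fun s => (hgen s).cofibrations_eq ▸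
        MorphismProperty.le_llp_rlp _).trans
          (objectwise_le fun s => (hgen s).cofibrations_eq.le)) _ hf s)) ?_
    rw [rlp_cornerGenerators_cofibrations hD hgen]
    exact MorphismProperty.le_llp_rlp _
  refine ⟨m, ⟨fun f => ?_, fun f => ?_⟩, hb, hp, hc, hIJ⟩
  · rw [hw]
    exact Iff.rfl
  · rw [hcof]
    exact Iff.rfl

end DiagramModel

end

theorem proposition3p3 {D : Type v} [SmallCategory D] [Quiver.IsThin D]
    (M : Pseudofunctor (LocallyDiscrete D) Cat.{v, u})
    [∀ s : D, ModelCategory (DiagramModel.Fib M s)]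
    [DiagramModel.IsDiagramOfModelCategories M]
    (hproper : ∀ s : D, HirschhornModel.IsProper (DiagramModel.Fib M s))
    (hcellular : ∀ s : D, HirschhornModel.IsCellular (DiagramModel.Fib M s)) :
    (IsDirectCategory D →
      ∃ _ : ModelCategory (DiagramModel.MDiagram M),
        DiagramModel.IsDiagramProjective M ∧
        HirschhornModel.IsBicompleteFunctorial (DiagramModel.MDiagram M) ∧
        HirschhornModel.IsProper (DiagramModel.MDiagram M) ∧
        HirschhornModel.IsCellular (DiagramModel.MDiagram M) ∧
        ∀ I J : ∀ s : D, MorphismProperty (DiagramModel.Fib M s),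
          (∀ s : D, HirschhornModel.IsCofibrantlyGeneratedBy (I s) (J s)) →
            HirschhornModel.IsCofibrantlyGeneratedBy
              (DiagramModel.freeGenerators I) (DiagramModel.freeGenerators J)) ∧
    (∀ hD : IsInverseCategory D,
      ∃ _ : ModelCategory (DiagramModel.MDiagram M),
        DiagramModel.IsDiagramInjective M ∧
        HirschhornModel.IsBicompleteFunctorial (DiagramModel.MDiagram M) ∧
        HirschhornModel.IsProper (DiagramModel.MDiagram M) ∧
        HirschhornModel.IsCellular (DiagramModel.MDiagram M) ∧
        ∀ I J : ∀ s : D, MorphismProperty (DiagramModel.Fib M s),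
          (∀ s : D, HirschhornModel.IsCofibrantlyGeneratedBy (I s) (J s)) →
            HirschhornModel.IsCofibrantlyGeneratedBy
              (DiagramModel.cornerGenerators hD I) (DiagramModel.cornerGenerators hD J)) :=
  ⟨fun _ => DiagramModel.exists_projective hproper hcellular,
    fun hD => DiagramModel.exists_injective hD hproper hcellular⟩
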